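/- Let $\Bbbk$ be a field of characteristic $p>2$. A super algebra is a $\mathbb{Z}_2$-graded $\Bbbk$-algebra $A=A_0\oplus A_1$; it is super-commutative if even elements are central and $ab=-ba$ for all odd $a,b$. A super Hopf algebra is a super algebra $A$ with a coassociative coproduct $\Delta : A\to A\otimes A$ and a counit $\varepsilon : A\to\Bbbk$ that are $\mathbb{Z}_2$-graded algebra maps, where $A\otimes A$ has the product $(a\otimes b)(c\otimes d)=(-1)^{|b||c|}ac\otimes bd$, and with an antipode. A super affine group $G$ is a group-valued functor on super-commutative algebras represented by a super-commutative super Hopf algebra $\mathcal{O}(G)$. A super $G$-module is a super right $\mathcal{O}(G)$-comodule, that is, a $\mathbb{Z}_2$-graded vector space $V$ with a coassociative, counital, grading-preserving linear map $V\to V\otimes\mathcal{O}(G)$. It is semisimple if every super subcomodule has a complementary super subcomodule. $G$ is linearly reductive if every super $G$-module is semisimple, algebraic if $\mathcal{O}(G)$ is a finitely generated algebra, and connected if the prime spectrum of the commutative ring $\mathcal{O}(G)_0$ is connected. Let $G$ be a linearly reductive super affine group over $\Bbbk$. Then: 1. $G$ is purely even, i.e. $\mathcal{O}(G)=\mathcal{O}(G)_0$;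 in other words $G$ is an ordinary affine group ($\mathcal{O}(G)$ is a commutative algebra and $\Delta$ is multiplicative for the usual product of $\mathcal{O}(G)\otimes\mathcal{O}(G)$). 2. If moreover $G$ is algebraic and connected, then $\mathcal{O}(G)\otimes_{\Bbbk}\overline{\Bbbk}$ is a group algebra over the algebraic closure $\overline{\Bbbk}$ of $\Bbbk$: there are an abelian group $\Gamma$ and an isomorphism $\mathcal{O}(G)\otimes_{\Bbbk}\overline{\Bbbk}\cong\overline{\Bbbk}[\Gamma]$ of Hopf algebras over $\overline{\Bbbk}$, where $\overline{\Bbbk}[\Gamma]$ has the coproduct $\gamma\mapsto\gamma\otimes\gamma$. -/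

import Mathlib

open scoped TensorProduct

universe u v w

noncomputable section

namespace SuperGroup

section Graded

variable {k : Type u} [Field k]

/-- A super vector space is a vector space `V` with a decomposition `𝒱` indexed by `ZMod 2`.
It is purely even if `V = V₀`. -/
def IsPurelyEven {V : Type v} [AddCommGroup V] [Module k V] (𝒱 : ZMod 2 → Submodule k V) : Prop :=
  𝒱 0 = ⊤

/-- The total grading on the tensor product of two super vector spaces:
`(V ⊗ W)_i = ⨁_{j + l = i} V_j ⊗ W_l`. -/
def tensorGrading {V : Type v} {W : Type w} [AddCommGroup V] [Module k V] [AddCommGroup W]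
    [Module k W] (𝒱 : ZMod 2 → Submodule k V) (𝒲 : ZMod 2 → Submodule k W) (i : ZMod 2) :
    Submodule k (V ⊗[k] W) :=
  ⨆ (j : ZMod 2) (l : ZMod 2) (_ : j + l = i), Submodule.map₂ (TensorProduct.mk k V W) (𝒱 j) (𝒲 l)

end Graded

section Hopf

variable {k : Type u} [Field k] {A : Type v} [Ring A] [Algebra k A]

/-- Super-commutativity of a super algebra: even elements are central and odd elements
anticommute. -/
class IsSuperCommutative (𝒜 : ZMod 2 → Submodule k A) : Prop where
  mul_comm_of_even : ∀ a ∈ 𝒜 0, ∀ b : A, a * b = b * a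
  mul_anticomm_of_odd : ∀ a ∈ 𝒜 1, ∀ b ∈ 𝒜 1, a * b = -(b * a)

/-- A super bialgebra: a super algebra with a coassociative counital coproduct such that the
coproduct `A → A ⊗ A` and the counit `A → k` are `ZMod 2`-graded algebra maps. Here `A ⊗ A` carries
the product `(a ⊗ b)(c ⊗ d) = (-1)^{|b||c|} ac ⊗ bd`, which is the one of `𝒜 ᵍ⊗[k] 𝒜`, and `k` is
purely even. -/
class IsSuperBialgebra (𝒜 : ZMod 2 → Submodule k A) [GradedAlgebra 𝒜] [Coalgebra k A] :
    Prop where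
  comul_mem : ∀ (i : ZMod 2), ∀ a ∈ 𝒜 i,
    Coalgebra.comul (R := k) a ∈ tensorGrading 𝒜 𝒜 i
  counit_odd : ∀ a ∈ 𝒜 1, Coalgebra.counit (R := k) a = 0
  counit_one : Coalgebra.counit (R := k) (1 : A) = 1
  counit_mul : ∀ a b : A, Coalgebra.counit (R := k) (a * b) =
    Coalgebra.counit (R := k) a * Coalgebra.counit (R := k) b
  comul_one : GradedTensorProduct.of k 𝒜 𝒜 (Coalgebra.comul (R := k) (1 : A)) = 1
  comul_mul : ∀ a b : A, GradedTensorProduct.of k 𝒜 𝒜 (Coalgebra.comul (R := k) (a * b)) =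
    GradedTensorProduct.of k 𝒜 𝒜 (Coalgebra.comul (R := k) a) *
      GradedTensorProduct.of k 𝒜 𝒜 (Coalgebra.comul (R := k) b)

/-- A super Hopf algebra: a super bialgebra with a (necessarily unique) antipode. -/
class IsSuperHopfAlgebra (𝒜 : ZMod 2 → Submodule k A) [GradedAlgebra 𝒜] [Coalgebra k A] : Prop
    extends IsSuperBialgebra 𝒜 where
  exists_antipode : ∃ S : A →ₗ[k] A,
    (∀ (i : ZMod 2), ∀ a ∈ 𝒜 i, S a ∈ 𝒜 i) ∧
    LinearMap.mul' k A ∘ₗ S.rTensor A ∘ₗ Coalgebra.comul =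
      Algebra.linearMap k A ∘ₗ Coalgebra.counit ∧
    LinearMap.mul' k A ∘ₗ S.lTensor A ∘ₗ Coalgebra.comul =
      Algebra.linearMap k A ∘ₗ Coalgebra.counit

/-- The even part `A₀` of a super-commutative super algebra, as a commutative ring. -/
abbrev evenCommRing (𝒜 : ZMod 2 → Submodule k A) [GradedAlgebra 𝒜] [IsSuperCommutative 𝒜] :
    CommRing (𝒜 0) where
  __ : Ring (𝒜 0) := inferInstance
  mul_comm a b := Subtype.ext (IsSuperCommutative.mul_comm_of_even (a : A) a.2 (b : A))

/-- The super affine group represented by `A` is connected: the prime spectrum of the even part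
`A₀` is connected. -/
def IsConnected (𝒜 : ZMod 2 → Submodule k A) [GradedAlgebra 𝒜] [IsSuperCommutative 𝒜] : Prop :=
  letI := evenCommRing 𝒜
  ConnectedSpace (PrimeSpectrum (𝒜 0))

end Hopf

section Comodule

variable {k : Type u} [Field k] {A : Type v} [Ring A] [Algebra k A] [Coalgebra k A]

/-- A super right `A`-comodule structure `ρ : V → V ⊗ A` on the super vector space `V`, that is,
a super left module structure over the super affine group represented by `A`. -/
structure IsSuperComodule (𝒜 : ZMod 2 → Submodule k A) {V : Type w} [AddCommGroup V] [Module k V]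
    (𝒱 : ZMod 2 → Submodule k V) (ρ : V →ₗ[k] V ⊗[k] A) : Prop where
  coassoc : (TensorProduct.assoc k V A A).toLinearMap ∘ₗ ρ.rTensor A ∘ₗ ρ =
    Coalgebra.comul.lTensor V ∘ₗ ρ
  counit : (TensorProduct.rid k V).toLinearMap ∘ₗ Coalgebra.counit.lTensor V ∘ₗ ρ = LinearMap.id
  map_mem : ∀ (i : ZMod 2), ∀ x ∈ 𝒱 i, ρ x ∈ tensorGrading 𝒱 𝒜 i

/-- A super subcomodule: a subspace `W = (W ∩ V₀) ⊕ (W ∩ V₁)` such that `ρ(W) ⊆ W ⊗ A`. -/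
structure IsSuperSubcomodule {V : Type w} [AddCommGroup V] [Module k V]
    (𝒱 : ZMod 2 → Submodule k V) (ρ : V →ₗ[k] V ⊗[k] A) (W : Submodule k V) : Prop where
  homogeneous : W = (W ⊓ 𝒱 0) ⊔ (W ⊓ 𝒱 1)
  map_mem : ∀ x ∈ W, ρ x ∈ LinearMap.range (W.subtype.rTensor A)

/-- A super comodule is semisimple if every super subcomodule has a complementary super
subcomodule. -/
def IsSemisimpleSuperComodule {V : Type w} [AddCommGroup V] [Module k V]
    (𝒱 : ZMod 2 → Submodule k V) (ρ : V →ₗ[k] V ⊗[k] A) : Prop :=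
  ∀ W : Submodule k V, IsSuperSubcomodule 𝒱 ρ W →
    ∃ W' : Submodule k V, IsSuperSubcomodule 𝒱 ρ W' ∧ IsCompl W W'

/-- The super affine group represented by `A` is linearly reductive: every super module over it
is semisimple. -/
def IsLinearlyReductive (𝒜 : ZMod 2 → Submodule k A) : Prop :=
  ∀ (V : Type v) [AddCommGroup V] [Module k V] (𝒱 : ZMod 2 → Submodule k V)
    [DirectSum.Decomposition 𝒱] (ρ : V →ₗ[k] V ⊗[k] A),
    IsSuperComodule 𝒜 𝒱 ρ → IsSemisimpleSuperComodule 𝒱 ρ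

end Comodule

end SuperGroup

end

/-!
# Linearly reductive super groups in odd characteristic

Write `A` for the coordinate algebra. Linear reductivity enters through a single consequence: a
complement of `k 1` in the regular comodule is the kernel of a normalized integral, a functional `l`
with `l 1 = 1` and `∑ l(a₁) a₂ = l(a) 1` (`exists_integral`). The data used from then on, a super
Hopf algebra with a normalized integral, are described by linear identities (`IsSuperHopf`), so they
survive an extension of the base field.

The characteristic enters through `a ↦ (a - P a) ^ p`, the Frobenius of the even part, where `P` is
the projection onto the odd part. It is a ring endomorphism which kills odd elements and commutes
with the coproduct, since the odd tensors in `Δ a` square to zero. A left-invariant operator `T`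
satisfies `∑ S(a₁) T(a₂) = ε(T a) 1`; applying Frobenius and then `l` to this identity shows that
`ε(T a) = 0` as soon as `l` kills all products of a Frobenius power with the `p`-th power of an
element `T w` (`false_of_integral_frob`). For derivations such `p`-th powers are derivatives,
hence killed by `l`. It follows that

* even left-invariant derivations are semisimple (`ker_sq_eq_of_derivation`);
* odd tangent vectors at the identity vanish over an algebraically closed field
  (`odd_derivation_eq_zero`).

**The odd part vanishes.** Over an algebraically closed field, let `B` be the super bialgebra
generated by a finite-dimensional graded subcoalgebra and the image of Frobenius. Its odd part is a
finitely generated module over its even part, and by the absence of odd tangent vectors it is equal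
to its product with the augmentation ideal. By Nakayama's lemma it is annihilated by some even `r`
with `ε(r) = 1`. If `J` is the ideal generated by the odd elements of `A`, then
`Δ r ∈ Ann(B₁) ⊗ A + A ⊗ J` (`comul_mem_annihilator_sup`). Frobenius kills `J`, so that applying it
to `∑ r₁ S(r₂) = 1` expresses `1` through elements annihilating the odd part of `B`
(`odd_eq_zero`).

**The connected algebraic case.** Now `A` is a commutative Noetherian Hopf algebra without
nontrivial idempotents; let `M` be its augmentation ideal. Krull's intersection theorem provides an
`f` with `ε(f) = 1` annihilating `⋂ Mⁿ`. The same lemma on the coproduct of an annihilator produces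
an idempotent from `f`, and connectedness yields `⋂ Mⁿ = 0` (`eq_zero_of_mem_augInf`). This
condition passes to the algebraic closure. There, a derivation `x` at the identity defines commuting
diagonalizable operators `D_x` and `D'_x`, the translations on the two sides. A root of the adjoint
action of `x` would make some `D_y` nilpotent on eigenvectors, so there are no roots, and `⋂ Mⁿ = 0`
gives `D_x = D'_x` (`IsCounitDerivation.central`). The distributions at the identity are shown to be
central by induction on their order: the integral of the adjoint orbit of a distribution is central
and differs from it by a derivation (`central_of_central_mul`). As `⋂ Mⁿ = 0`, the distributions
separate the points of `A`, and `A` is cocommutative (`leftConv_eq_rightConv`). Finally, averaging a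
projection against the integral gives complete reducibility (`exists_invariant_projection`), and a
cocommutative, completely reducible `A` is spanned by its grouplike elements
(`span_groupLike_eq_top`), which are linearly independent.
-/

noncomputable section

namespace SuperGroup

/-! ### Tensor slices and translation operators -/

section LinearAlgebra

variable {k : Type*} [Field k] {V W : Type*} [AddCommGroup V] [Module k V] [AddCommGroup W]
  [Module k W]

/-- Slicing a tensor with functionals on the left factor detects membership in `V ⊗ U`. -/
theorem mem_range_lTensor_subtype {U : Submodule k W} {t : V ⊗[k] W}
    (h : ∀ φ : V →ₗ[k] k, TensorProduct.lid k W (φ.rTensor W t) ∈ U) :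
    t ∈ LinearMap.range (U.subtype.lTensor V) := by
  rw [← lTensor_mkQ, LinearMap.mem_ker]
  classical
  let b := Module.Basis.ofVectorSpace k V
  apply (TensorProduct.equivFinsuppOfBasisLeft b).injective
  ext i
  have key : ∀ s : V ⊗[k] (W ⧸ U), TensorProduct.equivFinsuppOfBasisLeft b s i =
      TensorProduct.lid k _ ((b.coord i).rTensor _ s) := by
    intro s
    induction s with
    | zero => simp
    | tmul x y => simp
    | add x y hx hy => simp [hx, hy]
  rw [key, ← LinearMap.comp_apply (LinearMap.rTensor _ _), LinearMap.rTensor_comp_lTensor,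
    ← LinearMap.lTensor_comp_rTensor, LinearMap.comp_apply]
  have key2 : ∀ s : k ⊗[k] W, TensorProduct.lid k _ (U.mkQ.lTensor k s) =
      U.mkQ (TensorProduct.lid k _ s) := by
    intro s
    induction s with
    | zero => simp
    | tmul x y => simp
    | add x y hx hy => simp only [map_add, hx, hy]
  rw [key2]
  simpa using h (b.coord i)

/-- Slicing a tensor with functionals on the right factor detects membership in `U ⊗ W`. -/
theorem mem_range_rTensor_subtype {U : Submodule k V} {t : V ⊗[k] W}
    (h : ∀ φ : W →ₗ[k] k, TensorProduct.rid k V (φ.lTensor V t) ∈ U) :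
    t ∈ LinearMap.range (U.subtype.rTensor W) := by
  have h1 : TensorProduct.comm k V W t ∈ LinearMap.range (U.subtype.lTensor W) := by
    refine mem_range_lTensor_subtype fun φ => ?_
    convert h φ using 1
    generalize t = s
    induction s with
    | zero => simp
    | tmul x y => simp
    | add x y hx hy => simp only [map_add, hx, hy]
  obtain ⟨s, hs⟩ := h1
  refine ⟨TensorProduct.comm k W U s, ?_⟩
  rw [← (TensorProduct.comm k V W).symm_apply_apply t, ← hs]
  generalize s = s
  induction s with
  | zero => simp
  | tmul x y => simp
  | add x y hx hy => simp only [map_add, hx, hy]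

/-- A tensor is determined by its slices along functionals on the right factor. -/
theorem eq_of_rid_lTensor {t s : V ⊗[k] W}
    (h : ∀ φ : W →ₗ[k] k, TensorProduct.rid k V (φ.lTensor V t) =
      TensorProduct.rid k V (φ.lTensor V s)) : t = s := by
  have := mem_range_rTensor_subtype (U := (⊥ : Submodule k V)) (t := t - s) (fun φ => by
    simp [h φ])
  obtain ⟨r, hr⟩ := this
  rw [← sub_eq_zero, ← hr]
  have : (⊥ : Submodule k V).subtype = 0 := by
    ext x
    simpa using Subsingleton.elim x 0
  simp [this]

theorem exists_sum_of_mem_range_lTensor {U : Submodule k W} {t : V ⊗[k] W}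
    (h : t ∈ LinearMap.range (U.subtype.lTensor V)) :
    ∃ s : Finset (V × U), t = ∑ i ∈ s, i.1 ⊗ₜ[k] (i.2 : W) := by
  obtain ⟨r, rfl⟩ := h
  obtain ⟨s, hs⟩ := TensorProduct.exists_finset r
  exact ⟨s, by simp [hs]⟩

theorem exists_sum_of_mem_range_rTensor {U : Submodule k V} {t : V ⊗[k] W}
    (h : t ∈ LinearMap.range (U.subtype.rTensor W)) :
    ∃ s : Finset (U × W), t = ∑ i ∈ s, (i.1 : V) ⊗ₜ[k] i.2 := by
  obtain ⟨r, rfl⟩ := h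
  obtain ⟨s, hs⟩ := TensorProduct.exists_finset r
  exact ⟨s, by simp [hs]⟩

end LinearAlgebra

section Convolution

open Coalgebra

variable {k : Type*} [Field k] {A : Type*} [AddCommGroup A] [Module k A] [Coalgebra k A]

/-- The operator `a ↦ ∑ a₁ x(a₂)` attached to a functional `x`. -/
def rightConv (x : A →ₗ[k] k) : A →ₗ[k] A :=
  (TensorProduct.rid k A).toLinearMap ∘ₗ x.lTensor A ∘ₗ comul

/-- The operator `a ↦ ∑ x(a₁) a₂` attached to a functional `x`. -/
def leftConv (x : A →ₗ[k] k) : A →ₗ[k] A :=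
  (TensorProduct.lid k A).toLinearMap ∘ₗ x.rTensor A ∘ₗ comul

theorem rightConv_apply (x : A →ₗ[k] k) (a : A) :
    rightConv x a = TensorProduct.rid k A (x.lTensor A (comul a)) := rfl

theorem leftConv_apply (x : A →ₗ[k] k) (a : A) :
    leftConv x a = TensorProduct.lid k A (x.rTensor A (comul a)) := rfl

theorem rightConv_eq_sum (x : A →ₗ[k] k) {a : A} {ι : Type*} (r : Repr k a ι) :
    rightConv x a = ∑ i ∈ r.index, x (r.right i) • r.left i := by
  simp [rightConv_apply, ← r.eq]

theorem leftConv_eq_sum (x : A →ₗ[k] k) {a : A} {ι : Type*} (r : Repr k a ι) :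
    leftConv x a = ∑ i ∈ r.index, x (r.left i) • r.right i := by
  simp [leftConv_apply, ← r.eq]

/-- An operator `T` is left invariant if `Δ ∘ T = (id ⊗ T) ∘ Δ`. -/
def IsLeftInvariant (T : A →ₗ[k] A) : Prop :=
  ∀ a, comul (R := k) (T a) = T.lTensor A (comul a)

@[simp]
theorem counit_rightConv (x : A →ₗ[k] k) (a : A) : counit (R := k) (rightConv x a) = x a := by
  rw [rightConv_eq_sum x (ℛ k a)]
  conv_rhs => rw [← sum_counit_smul (ℛ k a)]
  simp [mul_comm]

@[simp]
theorem counit_leftConv (x : A →ₗ[k] k) (a : A) : counit (R := k) (leftConv x a) = x a := by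
  have h := congrArg (TensorProduct.rid k A) (sum_tmul_counit_eq (ℛ k a))
  rw [leftConv_eq_sum x (ℛ k a)]
  have h2 := congrArg x h
  simp only [map_sum, TensorProduct.rid_tmul, map_smul, one_smul, smul_eq_mul] at h2
  simp only [map_sum, map_smul, smul_eq_mul, ← h2, mul_comm]

theorem IsLeftInvariant.eq_rightConv {T : A →ₗ[k] A} (hT : IsLeftInvariant T) :
    T = rightConv (counit ∘ₗ T) := by
  ext a
  have h := congrArg (TensorProduct.rid k A) (lTensor_counit_comul (R := k) (T a))
  rw [hT a, ← LinearMap.comp_apply (LinearMap.lTensor _ _), ← LinearMap.lTensor_comp] at h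
  simpa [rightConv_apply] using h.symm

theorem IsLeftInvariant.comm_leftConv {T : A →ₗ[k] A} (hT : IsLeftInvariant T) (x : A →ₗ[k] k)
    (a : A) : leftConv x (T a) = T (leftConv x a) := by
  rw [leftConv_apply, hT a, leftConv_apply]
  generalize comul (R := k) a = t
  induction t with
  | zero => simp
  | tmul x y => simp
  | add x y hx hy => simp only [map_add, hx, hy]

theorem isLeftInvariant_rightConv (x : A →ₗ[k] k) : IsLeftInvariant (rightConv x) := by
  intro a
  have h := coassoc_apply (R := k) a
  have h1 : ∀ t : A ⊗[k] A, comul (R := k) (TensorProduct.rid k A (x.lTensor A t)) =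
      ((TensorProduct.rid k A).toLinearMap ∘ₗ x.lTensor A).lTensor A
        (TensorProduct.assoc k A A A (comul.rTensor A t)) := by
    intro t
    induction t with
    | zero => simp
    | add x y hx hy => simp only [map_add, hx, hy]
    | tmul b c =>
      simp only [LinearMap.lTensor_tmul, TensorProduct.rid_tmul, map_smul, LinearMap.rTensor_tmul]
      generalize comul (R := k) b = t
      induction t with
      | zero => simp
      | add x y hx hy => simp only [map_add, TensorProduct.add_tmul, smul_add, hx, hy]
      | tmul b c => simp
  rw [rightConv_apply, h1, h, ← LinearMap.comp_apply (LinearMap.lTensor _ _),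
    ← LinearMap.lTensor_comp]
  rfl

theorem rightConv_leftConv (x y : A →ₗ[k] k) (a : A) :
    leftConv x (rightConv y a) = rightConv y (leftConv x a) :=
  (isLeftInvariant_rightConv y).comm_leftConv x a

theorem IsLeftInvariant.comp {T U : A →ₗ[k] A} (hT : IsLeftInvariant T) (hU : IsLeftInvariant U) :
    IsLeftInvariant (T ∘ₗ U) := fun a => by
  rw [LinearMap.comp_apply, hT, hU, LinearMap.lTensor_comp, LinearMap.comp_apply]

theorem IsLeftInvariant.sub {T U : A →ₗ[k] A} (hT : IsLeftInvariant T) (hU : IsLeftInvariant U) :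
    IsLeftInvariant (T - U) := fun a => by
  rw [LinearMap.sub_apply, map_sub, hT, hU, LinearMap.lTensor_sub, LinearMap.sub_apply]

theorem IsLeftInvariant.smul {T : A →ₗ[k] A} (hT : IsLeftInvariant T) (c : k) :
    IsLeftInvariant (c • T) := fun a => by
  rw [LinearMap.smul_apply, map_smul, hT, LinearMap.lTensor_smul, LinearMap.smul_apply]

theorem isLeftInvariant_id : IsLeftInvariant (LinearMap.id : A →ₗ[k] A) := fun a => by simp

theorem rightConv_counit : rightConv (counit : A →ₗ[k] k) = LinearMap.id :=
  (isLeftInvariant_id.eq_rightConv).symm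

theorem rightConv_comp (x y : A →ₗ[k] k) :
    rightConv x ∘ₗ rightConv y = rightConv (x ∘ₗ rightConv y) := by
  rw [((isLeftInvariant_rightConv x).comp (isLeftInvariant_rightConv y)).eq_rightConv]
  congr 1
  ext a
  simp

/-- The orbit of an element under all operators `rightConv x` is finite-dimensional. -/
theorem exists_finiteDimensional_rightConv (a : A) :
    ∃ U : Submodule k A, FiniteDimensional k U ∧ ∀ x : A →ₗ[k] k, rightConv x a ∈ U := by
  refine ⟨Submodule.span k ((ℛ k a).left '' ((ℛ k a).index : Set (A × A))),
    FiniteDimensional.span_of_finite k ((Finset.finite_toSet _).image _), fun x => ?_⟩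
  rw [rightConv_eq_sum x (ℛ k a)]
  exact Submodule.sum_mem _ fun i hi => Submodule.smul_mem _ _
    (Submodule.subset_span ⟨i, hi, rfl⟩)

theorem leftConv_eq_rightConv_iff {x : A →ₗ[k] k} :
    leftConv x = rightConv x ↔
      ∀ (y : A →ₗ[k] k) (a : A), x (rightConv y a) = y (rightConv x a) := by
  constructor
  · intro h y a
    rw [← h, ← counit_rightConv y (leftConv x a), ← rightConv_leftConv, counit_leftConv]
  · intro h
    have h2 : ∀ y, rightConv x ∘ₗ rightConv y = rightConv y ∘ₗ rightConv x := by
      intro y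
      rw [rightConv_comp, rightConv_comp]
      congr 1
      ext a
      exact h y a
    ext a
    rw [← sub_eq_zero, ← (Module.forall_dual_apply_eq_zero_iff k _)]
    intro y
    rw [map_sub, sub_eq_zero, ← counit_rightConv y (leftConv x a), ← rightConv_leftConv,
      counit_leftConv]
    exact h y a

end Convolution

open Coalgebra

/-! ### Super Hopf algebras with an integral, and the Frobenius map -/

section SuperHopf

/-- A super-commutative super Hopf algebra with a normalized integral, encoded by linear maps: `P`
is the projection onto the odd part, `S` is the antipode and `l` is a functional with `l 1 = 1` and
`∑ l(a₁) a₂ = l(a) 1`. The sign rule enters through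
`(a ⊗ b)(c ⊗ d) = ac ⊗ bd - 2 a P(c) ⊗ P(b) d`, so that all axioms are linear identities and survive
an extension of the base field. -/
structure IsSuperHopf {k : Type*} [Field k] {A : Type*} [Ring A] [Algebra k A] [Coalgebra k A]
    (P S : A →ₗ[k] A) (l : A →ₗ[k] k) : Prop where
  odd_odd : ∀ a, P (P a) = P a
  odd_one : P 1 = 0
  odd_mul : ∀ a b, P (a * b) = P a * (b - P b) + (a - P a) * P b
  even_comm : ∀ a b, (a - P a) * b = b * (a - P a)
  anticomm : ∀ a b, P a * P b = -(P b * P a)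
  comul_odd : ∀ a, comul (R := k) (P a) = P.rTensor A (comul a) + P.lTensor A (comul a)
    - (2 : k) • TensorProduct.map P P (comul a)
  counit_odd : ∀ a, counit (R := k) (P a) = 0
  antipode_odd : ∀ a, S (P a) = P (S a)
  counit_one : counit (R := k) (1 : A) = 1
  counit_mul : ∀ a b : A, counit (R := k) (a * b) = counit (R := k) a * counit (R := k) b
  comul_one : comul (R := k) (1 : A) = 1 ⊗ₜ 1
  comul_mul : ∀ a b : A, comul (R := k) (a * b) = comul (R := k) a * comul (R := k) b -
    (2 : k) • (P.lTensor A (comul (R := k) a) * P.rTensor A (comul (R := k) b))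
  antipode_left : ∀ a, LinearMap.mul' k A (S.rTensor A (comul a)) = algebraMap k A (counit a)
  antipode_right : ∀ a, LinearMap.mul' k A (S.lTensor A (comul a)) = algebraMap k A (counit a)
  integral_one : l 1 = 1
  integral_comul : ∀ a, TensorProduct.lid k A (l.rTensor A (comul a)) = algebraMap k A (l a)

theorem two_ne_zero_of_charP (k : Type*) [Field k] (p : ℕ) [CharP k p] (hp : 2 < p) :
    (2 : k) ≠ 0 := by
  intro h
  have : ((2 : ℕ) : k) = 0 := by exact_mod_cast h
  rw [CharP.cast_eq_zero_iff k p] at this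
  exact absurd (Nat.le_of_dvd (by norm_num) this) (by omega)

variable {k : Type*} [Field k] {A : Type*} [Ring A] [Algebra k A] [Coalgebra k A]
  {P S : A →ₗ[k] A} {l : A →ₗ[k] k}

theorem sum_pow_char_of_commute {R : Type*} [Ring R] {p : ℕ} [Fact p.Prime] [CharP R p]
    {ι : Type*} (s : Finset ι) (f : ι → R) (h : ∀ i ∈ s, ∀ j ∈ s, Commute (f i) (f j)) :
    (∑ i ∈ s, f i) ^ p = ∑ i ∈ s, f i ^ p := by
  classical
  induction s using Finset.induction_on with
  | empty => simp [(Fact.out : p.Prime).ne_zero]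
  | insert a s ha ih =>
    rw [Finset.sum_insert ha, Finset.sum_insert ha, add_pow_char_of_commute,
      ih fun i hi j hj => h i (Finset.mem_insert_of_mem hi) j (Finset.mem_insert_of_mem hj)]
    exact Commute.sum_right _ _ _ fun i hi =>
      h a (Finset.mem_insert_self _ _) i (Finset.mem_insert_of_mem hi)

namespace IsSuperHopf

variable (H : IsSuperHopf P S l)
include H

theorem integral_rightConv (x : A →ₗ[k] k) (a : A) : l (rightConv x a) = l a * x 1 := by
  have h : ∀ t : A ⊗[k] A, l (TensorProduct.rid k A (x.lTensor A t)) =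
      x (TensorProduct.lid k A (l.rTensor A t)) := by
    intro t
    induction t with
    | zero => simp
    | add x y hx hy => simp only [map_add, hx, hy]
    | tmul b c => simp [mul_comm]
  rw [rightConv_apply, h, H.integral_comul, Algebra.algebraMap_eq_smul_one, map_smul, smul_eq_mul]

theorem nontrivial : Nontrivial A := by
  refine ⟨1, 0, fun h => ?_⟩
  have := H.counit_one
  rw [h, map_zero] at this
  exact zero_ne_one this

theorem antipode_leftInvariant {T : A →ₗ[k] A} (hT : IsLeftInvariant T) (a : A) :
    LinearMap.mul' k A (TensorProduct.map S T (comul a)) = algebraMap k A (counit (T a)) := by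
  rw [← H.antipode_left, hT a, ← LinearMap.comp_apply (LinearMap.rTensor _ _),
    LinearMap.rTensor_comp_lTensor]

theorem ev_comm (a b : A) : Commute (a - P a) b := H.even_comm a b

theorem odd_mul_odd_self (h2 : (2 : k) ≠ 0) (a : A) : P a * P a = 0 := by
  have h := H.anticomm a a
  have h3 : (2 : k) • (P a * P a) = 0 := by
    rw [two_smul]
    nth_rewrite 1 [h]
    simp
  exact (smul_eq_zero.mp h3).resolve_left h2

theorem ev_mul (a b : A) :
    a * b - P (a * b) = (a - P a) * (b - P b) + P a * P b := by
  rw [H.odd_mul]; noncomm_ring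

theorem odd_ev (a : A) : P (a - P a) = 0 := by rw [map_sub, H.odd_odd, sub_self]

theorem pow_ev (a : A) (n : ℕ) : P ((a - P a) ^ n) = 0 := by
  induction n with
  | zero => simpa using H.odd_one
  | succ n ih => rw [pow_succ, H.odd_mul, ih, H.odd_ev]; simp

theorem charP (p : ℕ) [CharP k p] : CharP A p := by
  have := H.nontrivial
  exact charP_of_injective_algebraMap (algebraMap k A).injective p

theorem odd_mul_odd_pow (h2 : (2 : k) ≠ 0) (a b : A) {p : ℕ} (hp : 2 ≤ p) :
    (P a * P b) ^ p = 0 := by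
  have : (P a * P b) ^ 2 = 0 := by
    rw [pow_two, mul_assoc, ← mul_assoc (P b), H.anticomm b a, neg_mul, mul_assoc (P a) (P b),
      H.odd_mul_odd_self h2]
    simp
  rw [← Nat.sub_add_cancel hp, pow_add, this, mul_zero]

/-- In odd characteristic `a ↦ (a - P a) ^ p`, the Frobenius of the even part, is a ring
endomorphism of a super-commutative algebra which kills odd elements. -/
def frob (p : ℕ) [Fact p.Prime] [CharP k p] (h2 : 2 < p) : A →+* A where
  toFun a := (a - P a) ^ p
  map_one' := by rw [H.odd_one]; simp
  map_mul' a b := by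
    have := H.charP p
    -- the even part of `a b` is `a₀ b₀ + a₁ b₁`, and `a₁ b₁` squares to zero
    rw [H.ev_mul, add_pow_char_of_commute _ ((H.ev_comm _ _).mul_left (H.ev_comm _ _)),
      H.odd_mul_odd_pow (two_ne_zero_of_charP k p h2) _ _ h2.le, add_zero, (H.ev_comm a _).mul_pow]
  map_zero' := by simp [(Fact.out : p.Prime).ne_zero]
  map_add' a b := by
    have := H.charP p
    rw [← add_pow_char_of_commute _ (H.ev_comm a _), map_add, add_sub_add_comm]

variable {p : ℕ} [Fact p.Prime] [CharP k p] (h2 : 2 < p)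

theorem frob_apply (a : A) : H.frob p h2 a = (a - P a) ^ p := rfl

theorem odd_frob (a : A) : P (H.frob p h2 a) = 0 := H.pow_ev a p

theorem frob_comm (a b : A) : Commute (H.frob p h2 a) b := (H.ev_comm a b).pow_left p

theorem frob_smul (c : k) (a : A) : H.frob p h2 (c • a) = c ^ p • H.frob p h2 a := by
  rw [frob_apply, frob_apply, map_smul, ← smul_sub, smul_pow]

theorem frob_odd (a : A) : H.frob p h2 (P a) = 0 := by
  rw [frob_apply, H.odd_odd, sub_self, zero_pow (Fact.out : p.Prime).ne_zero]

/-- Apply Frobenius to `∑ S(a₁) T(a₂) = ε(T a) 1` for a left-invariant operator `T`: if the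
integral kills all the terms that arise, then `ε(T a) = 0`. The subspace `W` only has to contain the
right tensor factors `a₂`. -/
theorem false_of_integral_frob {T : A →ₗ[k] A} (hT : IsLeftInvariant T) {a : A}
    (ha : counit (R := k) (T a) = 1) (W : Submodule k A) (hW : ∀ φ : A →ₗ[k] k, leftConv φ a ∈ W)
    (h : ∀ s : A, ∀ w ∈ W, l (H.frob p h2 s * H.frob p h2 (T w)) = 0) : False := by
  obtain ⟨s, hs⟩ := exists_sum_of_mem_range_lTensor (mem_range_lTensor_subtype hW)
  have h1 := H.antipode_leftInvariant hT a
  rw [hs, ha, map_one] at h1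
  simp only [map_sum, TensorProduct.map_tmul, LinearMap.mul'_apply] at h1
  have h3 := congrArg (fun z => l (H.frob p h2 z)) h1
  simp only [map_sum, map_mul, map_one, H.integral_one] at h3
  rw [Finset.sum_eq_zero fun i _ => h _ _ i.2.2] at h3
  exact zero_ne_one h3

end IsSuperHopf

end SuperHopf

/-! ### Coproduct and Frobenius -/

section FrobeniusComul

variable {k : Type*} [Field k] {A : Type*} [Ring A] [Algebra k A]

/-- Left multiplication `t ↦ (s ↦ t s)` in the super tensor product `A ⊗ A`, as an operator on the
underlying vector space. -/
def twistedMul (P : A →ₗ[k] A) : A ⊗[k] A →ₗ[k] Module.End k (A ⊗[k] A) :=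
  LinearMap.mul k (A ⊗[k] A) -
    (2 : k) • (LinearMap.mul k (A ⊗[k] A)).compl₁₂ (P.lTensor A) (P.rTensor A)

theorem twistedMul_apply (P : A →ₗ[k] A) (t s : A ⊗[k] A) :
    twistedMul P t s = t * s - (2 : k) • (P.lTensor A t * P.rTensor A s) := rfl

theorem twistedMul_tmul (P : A →ₗ[k] A) (a b c d : A) :
    twistedMul P (a ⊗ₜ b) (c ⊗ₜ d) = (a * c) ⊗ₜ (b * d) - (2 : k) • ((a * P c) ⊗ₜ (P b * d)) := by
  simp [twistedMul_apply]

namespace IsSuperHopf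

variable [Coalgebra k A] {P S : A →ₗ[k] A} {l : A →ₗ[k] k} (H : IsSuperHopf P S l)
include H

theorem twistedMul_even_tmul (a b c d : A) :
    twistedMul P ((a - P a) ⊗ₜ (b - P b)) (c ⊗ₜ d) = ((a - P a) * c) ⊗ₜ ((b - P b) * d) := by
  rw [twistedMul_tmul, H.odd_ev]; simp

theorem twistedMul_odd_tmul (a b c d : A) :
    twistedMul P (P a ⊗ₜ P b) (c ⊗ₜ d) = (P a * (c - (2 : k) • P c)) ⊗ₜ (P b * d) := by
  rw [twistedMul_tmul, H.odd_odd, mul_sub, TensorProduct.sub_tmul, mul_smul_comm,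
    TensorProduct.smul_tmul']

theorem commute_twistedMul_even (a b a' b' : A) :
    Commute (twistedMul P ((a - P a) ⊗ₜ (b - P b)))
      (twistedMul P ((a' - P a') ⊗ₜ (b' - P b'))) := by
  refine TensorProduct.ext' fun c d => ?_
  simp only [Module.End.mul_apply, H.twistedMul_even_tmul, ← mul_assoc]
  rw [H.even_comm a, H.even_comm b]

theorem commute_twistedMul_even_odd (a b a' b' : A) :
    Commute (twistedMul P ((a - P a) ⊗ₜ (b - P b))) (twistedMul P (P a' ⊗ₜ P b')) := by
  refine TensorProduct.ext' fun c d => ?_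
  have h : P ((a - P a) * c) = (a - P a) * P c := by
    rw [H.odd_mul, H.odd_ev]; simp
  simp only [Module.End.mul_apply, H.twistedMul_even_tmul, H.twistedMul_odd_tmul, h]
  rw [← mul_assoc, H.even_comm a, ← mul_assoc, H.even_comm b, mul_assoc, mul_assoc, mul_sub,
    mul_smul_comm]

theorem twistedMul_odd_mul (a b a' b' c d : A) :
    twistedMul P (P a ⊗ₜ P b) (twistedMul P (P a' ⊗ₜ P b') (c ⊗ₜ d)) =
      -((P a * P a' * c) ⊗ₜ (P b * P b' * d)) := by
  have h : P (P a' * (c - (2 : k) • P c)) = P a' * (c - P c) := by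
    rw [H.odd_mul, H.odd_odd, sub_self, zero_mul, add_zero, map_sub, map_smul, H.odd_odd]
    congr 1
    module
  rw [H.twistedMul_odd_tmul, H.twistedMul_odd_tmul, h, ← TensorProduct.neg_tmul, ← mul_assoc,
    mul_assoc (P a) (P a'), ← mul_neg]
  congr 2
  rw [← mul_smul_comm, ← mul_sub, ← mul_neg]
  congr 1
  module

theorem commute_twistedMul_odd (a b a' b' : A) :
    Commute (twistedMul P (P a ⊗ₜ P b)) (twistedMul P (P a' ⊗ₜ P b')) := by
  refine TensorProduct.ext' fun c d => ?_
  rw [Module.End.mul_apply, Module.End.mul_apply, H.twistedMul_odd_mul, H.twistedMul_odd_mul,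
    H.anticomm a a', H.anticomm b b']
  simp [TensorProduct.neg_tmul, TensorProduct.tmul_neg]

theorem twistedMul_odd_pow (h2 : (2 : k) ≠ 0) (a b : A) {p : ℕ} (hp : 2 ≤ p) :
    twistedMul P (P a ⊗ₜ P b) ^ p = 0 := by
  have : twistedMul P (P a ⊗ₜ P b) ^ 2 = 0 := by
    refine TensorProduct.ext' fun c d => ?_
    rw [pow_two, Module.End.mul_apply, H.twistedMul_odd_mul, H.odd_mul_odd_self h2]
    simp
  rw [← Nat.sub_add_cancel hp, pow_add, this, mul_zero]

theorem twistedMul_even_pow (a b : A) (n : ℕ) :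
    (twistedMul P ((a - P a) ⊗ₜ (b - P b)) ^ n) (1 ⊗ₜ 1) = ((a - P a) ^ n) ⊗ₜ ((b - P b) ^ n) := by
  induction n with
  | zero => simp
  | succ n ih =>
    rw [pow_succ', Module.End.mul_apply, ih, H.twistedMul_even_tmul, pow_succ', pow_succ']

/-- Powers of `Δ a` in the super tensor product are powers of the operator `twistedMul P (Δ a)`. -/
theorem comul_pow (a : A) (n : ℕ) :
    comul (R := k) (a ^ n) = (twistedMul P (comul a) ^ n) (1 ⊗ₜ 1) := by
  induction n with
  | zero => simpa using H.comul_one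
  | succ n ih => rw [pow_succ', H.comul_mul, ih, pow_succ', Module.End.mul_apply, twistedMul_apply]

variable {p : ℕ} [Fact p.Prime] [CharP k p] (h2 : 2 < p)

/-- The Frobenius of the even part is compatible with the coproduct: the contributions of the odd
tensors `P b ⊗ P c` to `Δ a` square to zero in the super tensor product. -/
theorem comul_frob {a : A} {ι : Type*} {s : Finset ι} {f g : ι → A}
    (h : comul (R := k) a = ∑ i ∈ s, f i ⊗ₜ g i) :
    comul (R := k) (H.frob p h2 a) = ∑ i ∈ s, H.frob p h2 (f i) ⊗ₜ H.frob p h2 (g i) := by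
  have hev : comul (R := k) (a - P a) = (∑ i ∈ s, (f i - P (f i)) ⊗ₜ (g i - P (g i))) +
      ∑ i ∈ s, P (f i) ⊗ₜ P (g i) := by
    rw [map_sub, H.comul_odd, h]
    simp only [map_sum, LinearMap.rTensor_tmul, LinearMap.lTensor_tmul, TensorProduct.map_tmul,
      Finset.smul_sum, ← Finset.sum_add_distrib, ← Finset.sum_sub_distrib]
    refine Finset.sum_congr rfl fun i _ => ?_
    simp only [TensorProduct.sub_tmul, TensorProduct.tmul_sub, two_smul]
    abel
  have : Nontrivial A := H.nontrivial
  have : CharP (Module.End k (A ⊗[k] A)) p :=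
    charP_of_injective_algebraMap (algebraMap k (Module.End k (A ⊗[k] A))).injective p
  rw [H.frob_apply, H.comul_pow, hev, map_add, map_sum, map_sum, add_pow_char_of_commute,
    sum_pow_char_of_commute, sum_pow_char_of_commute]
  · simp only [H.twistedMul_odd_pow (two_ne_zero_of_charP k p h2) _ _ h2.le,
      LinearMap.sum_apply, H.twistedMul_even_pow, Finset.sum_const_zero, add_zero, frob_apply]
  · exact fun i _ j _ => H.commute_twistedMul_odd _ _ _ _
  · exact fun i _ j _ => H.commute_twistedMul_even _ _ _ _
  · exact Commute.sum_left _ _ _ fun i _ => Commute.sum_right _ _ _ fun j _ =>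
      H.commute_twistedMul_even_odd _ _ _ _

theorem counit_frob (a : A) : counit (R := k) (H.frob p h2 a) = counit (R := k) a ^ p := by
  let e : A →* k := ⟨⟨counit (R := k), H.counit_one⟩, H.counit_mul⟩
  have := map_pow e (a - P a) p
  have h := H.counit_odd a
  simp only [e, MonoidHom.coe_mk, OneHom.coe_mk, map_sub, h, sub_zero] at this
  exact this

end IsSuperHopf

end FrobeniusComul

/-! ### Semisimplicity of derivations, and vanishing of odd derivations -/

section Eigenspaces

variable {k : Type*} [Field k] {V : Type*} [AddCommGroup V] [Module k V]

/-- An operator for which all `ker (Y - α)²` and `ker (Y - α)` agree on a finite-dimensional stable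
subspace is diagonalizable on this subspace. -/
theorem mem_iSup_eigenspace_of_semisimple [IsAlgClosed k] (Y : Module.End k V) (U : Submodule k V)
    [FiniteDimensional k U] (hU : ∀ v ∈ U, Y v ∈ U)
    (h : ∀ (α : k), ∀ v ∈ U, (Y - α • 1) ((Y - α • 1) v) = 0 → (Y - α • 1) v = 0) {v : V}
    (hv : v ∈ U) : v ∈ ⨆ α : k, U ⊓ Y.eigenspace α := by
  let f : Module.End k U := Y.restrict hU
  have hpow : ∀ (α : k) (n : ℕ) (w : U), ((f - α • 1) ^ n) w = 0 → (Y - α • 1) (w : V) = 0 := by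
    intro α n
    induction n with
    | zero => intro w hw; simp at hw; simp [hw]
    | succ n ih =>
      intro w hw
      rw [pow_succ, Module.End.mul_apply] at hw
      exact h α w w.2 (ih _ hw)
  have htop := Module.End.iSup_maxGenEigenspace_eq_top f
  have hmem : (⟨v, hv⟩ : U) ∈ ⨆ α, f.maxGenEigenspace α := htop ▸ Submodule.mem_top
  have := Submodule.mem_map_of_mem (f := U.subtype) hmem
  rw [Submodule.map_iSup] at this
  refine SetLike.le_def.1 (iSup_mono fun α => ?_) this
  rintro _ ⟨w, hw, rfl⟩
  obtain ⟨n, hn⟩ := (Module.End.mem_maxGenEigenspace f α w).1 hw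
  refine ⟨w.2, Module.End.mem_eigenspace_iff.2 ?_⟩
  have := hpow α n w hn
  simpa [sub_eq_zero] using this

end Eigenspaces

section Orbit

variable {k : Type*} [Field k] {A : Type*} [AddCommGroup A] [Module k A] [Coalgebra k A]

theorem rightConv_add (x y : A →ₗ[k] k) : rightConv (x + y) = rightConv x + rightConv y := by
  ext a; simp [rightConv_apply, LinearMap.lTensor_add]

theorem rightConv_smul (c : k) (x : A →ₗ[k] k) : rightConv (c • x) = c • rightConv x := by
  ext a; simp [rightConv_apply, LinearMap.lTensor_smul]

theorem leftConv_sub (x y : A →ₗ[k] k) : leftConv (x - y) = leftConv x - leftConv y := by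
  ext a; simp [leftConv_apply, LinearMap.rTensor_sub]

/-- The subcomodule generated by `a`: all elements `∑ a₁ x(a₂)`. -/
def rightOrbit (a : A) : Submodule k A where
  carrier := Set.range fun x : A →ₗ[k] k => rightConv x a
  add_mem' := by
    rintro _ _ ⟨x, rfl⟩ ⟨y, rfl⟩
    exact ⟨x + y, by simp [rightConv_add]⟩
  zero_mem' := ⟨0, by simp [rightConv_apply]⟩
  smul_mem' := by
    rintro c _ ⟨x, rfl⟩
    exact ⟨c • x, by simp [rightConv_smul]⟩

theorem self_mem_rightOrbit (a : A) : a ∈ rightOrbit (k := k) a :=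
  ⟨counit, by simp [rightConv_counit]⟩

instance finiteDimensional_rightOrbit (a : A) : FiniteDimensional k (rightOrbit (k := k) a) := by
  obtain ⟨U, hU, h⟩ := exists_finiteDimensional_rightConv (k := k) a
  refine Submodule.finiteDimensional_of_le (S₂ := U) ?_
  rintro _ ⟨x, rfl⟩
  exact h x

theorem rightConv_mem_rightOrbit (x : A →ₗ[k] k) {a b : A} (hb : b ∈ rightOrbit (k := k) a) :
    rightConv x b ∈ rightOrbit (k := k) a := by
  obtain ⟨y, rfl⟩ := hb
  exact ⟨x ∘ₗ rightConv y, by simp [← rightConv_comp]⟩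

end Orbit

section OddDerivations

variable {k : Type*} [Field k] {A : Type*} [Ring A] [Algebra k A] [Coalgebra k A]
  {P S : A →ₗ[k] A} {l : A →ₗ[k] k}

/-- A subalgebra which is graded and satisfies `Δ(B) ⊆ (B ⊗ A) ∩ (A ⊗ B) = B ⊗ B`, a condition
expressed through the slices of `Δ b` along functionals. -/
structure IsSubBialgebra (P : A →ₗ[k] A) (B : Subalgebra k A) : Prop where
  odd_mem : ∀ b ∈ B, P b ∈ B
  left_mem : ∀ φ : A →ₗ[k] k, ∀ b ∈ B, leftConv φ b ∈ B
  right_mem : ∀ φ : A →ₗ[k] k, ∀ b ∈ B, rightConv φ b ∈ B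

namespace IsSuperHopf

variable (H : IsSuperHopf P S l) {p : ℕ} [Fact p.Prime] [CharP k p] (h2 : 2 < p)
include H

/-- An even left-invariant derivation `Y` annihilated by the integral is semisimple. If
`(Y - α)² w = 0` and `u = (Y - α) w`, then `Y (w u ^ (p - 1)) = u ^ p`, so the integral kills
`u ^ p`, and `false_of_integral_frob` applies to `Y - α`. -/
theorem ker_sq_eq_of_derivation {B : Subalgebra k A} (hB : IsSubBialgebra P B)
    (hF : ∀ a, H.frob p h2 a ∈ B) {Y : A →ₗ[k] A} (hY : IsLeftInvariant Y)
    (hYB : ∀ b ∈ B, Y b ∈ B) (hYP : ∀ a, Y (P a) = P (Y a))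
    (hder : ∀ a ∈ B, ∀ b ∈ B, P b = 0 → Y (a * b) = a * Y b + Y a * b)
    (hYF : ∀ a, Y (H.frob p h2 a) = 0) (hl : ∀ a, l (Y a) = 0) (α : k) {a : A} (ha : a ∈ B)
    (h : (Y - α • 1) ((Y - α • 1) a) = 0) : (Y - α • 1) a = 0 := by
  by_contra hne
  set T : A →ₗ[k] A := Y - α • 1 with hTdef
  have hT : IsLeftInvariant T := hY.sub (isLeftInvariant_id.smul α)
  have hTP : ∀ a, T (P a) = P (T a) := fun a => by simp [hTdef, hYP]
  have hTB : ∀ b ∈ B, T b ∈ B := fun b hb => by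
    simpa [hTdef] using B.sub_mem (hYB b hb) (B.smul_mem hb α)
  -- left-invariant operators commute with right-invariant ones, so `W` contains all `leftConv φ a`
  let W : Submodule k A := Subalgebra.toSubmodule B ⊓ LinearMap.ker (T ∘ₗ T)
  have hW : ∀ φ : A →ₗ[k] k, ∀ w ∈ W, leftConv φ w ∈ W := by
    rintro φ w ⟨hwB, hwT⟩
    refine ⟨hB.left_mem φ w hwB, ?_⟩
    change (T ∘ₗ T) (leftConv φ w) = 0
    rw [← (hT.comp hT).comm_leftConv, LinearMap.mem_ker.1 hwT, map_zero]
  have haW : a ∈ W := ⟨ha, h⟩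
  obtain ⟨φ, hφ⟩ : ∃ φ : A →ₗ[k] k, φ (T a) ≠ 0 := by
    by_contra! hcon
    exact hne ((Module.forall_dual_apply_eq_zero_iff k _).1 hcon)
  -- translate `a` and rescale it in order to obtain `ε(T a) = 1`
  rw [← counit_leftConv, hT.comm_leftConv] at hφ
  refine H.false_of_integral_frob h2 hT
    (a := (counit (R := k) (T (leftConv φ a)))⁻¹ • leftConv φ a) ?_ W ?_ ?_
  · rw [map_smul, map_smul, smul_eq_mul, inv_mul_cancel₀ hφ]
  · exact fun ψ => hW ψ _ (W.smul_mem _ (hW φ a haW))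
  · rintro s w ⟨hwB, hwT⟩
    set w0 := w - P w with hw0
    have hw0B : w0 ∈ B := B.sub_mem hwB (hB.odd_mem w hwB)
    set u := T w0 with hu
    have huP : P u = 0 := by rw [hu, ← hTP, hw0, H.odd_ev, map_zero]
    have hfu : H.frob p h2 (T w) = u ^ p := by rw [H.frob_apply, hu, hw0, map_sub, hTP]
    have hTu : T u = 0 := by
      have h1 : T (T w) = 0 := hwT
      rw [hu, hw0, map_sub, map_sub, hTP, hTP, h1, map_zero, sub_zero]
    have hYu : Y u = α • u := by simpa [hTdef, sub_eq_zero] using hTu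
    have hYw : Y w0 = α • w0 + u := by
      have : T w0 = Y w0 - α • w0 := by simp [hTdef]
      rw [hu, this]; abel
    have huB : u ∈ B := hTB _ hw0B
    have hpowP : ∀ n, P (u ^ n) = 0 := fun n => by
      have := H.pow_ev u n; rwa [huP, sub_zero] at this
    have hYpow : ∀ n : ℕ, Y (u ^ n) = (n : k) • α • u ^ n := by
      intro n
      induction n with
      | zero => simpa using hYF 1
      | succ n ih =>
        rw [pow_succ, hder _ (B.pow_mem huB n) _ huB huP, ih, hYu]
        push_cast
        simp only [mul_smul_comm, smul_mul_assoc]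
        module
    have hp1 : p - 1 + 1 = p := Nat.sub_add_cancel (by omega)
    have hpk : ((p - 1 : ℕ) : k) = -1 := by
      have : ((p - 1 : ℕ) : k) + 1 = 0 := by
        rw [← Nat.cast_add_one, hp1, CharP.cast_eq_zero]
      exact eq_neg_of_add_eq_zero_left this
    have hY1 : Y (w0 * u ^ (p - 1)) = u ^ p := by
      rw [hder _ hw0B _ (B.pow_mem huB _) (hpowP _), hYpow, hYw, hpk, add_mul, ← pow_succ', hp1]
      simp
    have hY2 : Y (w0 * u ^ (p - 1) * H.frob p h2 s) = u ^ p * H.frob p h2 s := by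
      rw [hder _ (B.mul_mem hw0B (B.pow_mem huB _)) _ (hF s) (H.odd_frob h2 s), hYF, hY1,
        mul_zero, zero_add]
    rw [hfu, (H.frob_comm h2 s _).eq, ← hY2, hl]

/-- Translation along an odd functional reverses parity. -/
theorem rightConv_odd {x : A →ₗ[k] k} (hx : ∀ a, x (P a) = x a) (a : A) :
    P (rightConv x a) = rightConv x (a - P a) := by
  have hxP : x ∘ₗ P = x := LinearMap.ext hx
  rw [map_sub, rightConv_apply x (P a), H.comul_odd]
  simp only [map_sub, map_add, map_smul]
  rw [← LinearMap.comp_apply (LinearMap.lTensor _ _) (LinearMap.lTensor _ _),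
    ← LinearMap.lTensor_comp, hxP, ← rightConv_apply, rightConv_apply]
  generalize comul (R := k) a = t
  induction t with
  | zero => simp
  | add x y hx hy =>
    simp only [map_add, hx, hy, smul_add]
    abel
  | tmul b c =>
    simp only [LinearMap.lTensor_tmul, LinearMap.rTensor_tmul, TensorProduct.map_tmul,
      TensorProduct.rid_tmul, hx, map_smul]
    module

/-- The super Leibniz rule for the translation along an odd derivation at the identity. -/
theorem rightConv_mul {B : Subalgebra k A} (hB : IsSubBialgebra P B) {x : A →ₗ[k] k}
    (hx : ∀ a, x (P a) = x a)
    (hder : ∀ a ∈ B, ∀ b ∈ B, x (a * b) = x a * counit b + counit a * x b)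
    {a b : A} (ha : a ∈ B) (hb : b ∈ B) :
    rightConv x (a * b) = a * rightConv x b + rightConv x a * (b - (2 : k) • P b) := by
  obtain ⟨s, hs⟩ := exists_sum_of_mem_range_lTensor (U := Subalgebra.toSubmodule B)
    (mem_range_lTensor_subtype fun φ => hB.left_mem φ a ha)
  obtain ⟨t, ht⟩ := exists_sum_of_mem_range_lTensor (U := Subalgebra.toSubmodule B)
    (mem_range_lTensor_subtype fun φ => hB.left_mem φ b hb)
  have h1 : a = ∑ i ∈ s, counit (R := k) (i.2 : A) • i.1 := by
    conv_lhs => rw [← LinearMap.id_apply (R := k) a, ← rightConv_counit, rightConv_apply, hs]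
    simp
  have h3 : b = ∑ i ∈ t, counit (R := k) (i.2 : A) • i.1 := by
    conv_lhs => rw [← LinearMap.id_apply (R := k) b, ← rightConv_counit, rightConv_apply, ht]
    simp
  have h4 : rightConv x a = ∑ i ∈ s, x (i.2 : A) • i.1 := by
    rw [rightConv_apply, hs]; simp
  have h5 : rightConv x b = ∑ i ∈ t, x (i.2 : A) • i.1 := by
    rw [rightConv_apply, ht]; simp
  rw [rightConv_apply, H.comul_mul, hs, ht, h4, h5]
  conv_rhs => rw [h1, h3]
  simp only [map_sub, map_smul, map_sum, Finset.sum_mul_sum, LinearMap.lTensor_tmul,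
    LinearMap.rTensor_tmul, Algebra.TensorProduct.tmul_mul_tmul, TensorProduct.rid_tmul,
    Finset.smul_sum, ← Finset.sum_sub_distrib, ← Finset.sum_add_distrib]
  refine Finset.sum_congr rfl fun i _ => Finset.sum_congr rfl fun j _ => ?_
  rw [hder _ i.2.2 _ j.2.2, hder _ (hB.odd_mem _ i.2.2) _ j.2.2, hx, H.counit_odd]
  simp only [mul_sub, mul_smul_comm, smul_mul_assoc]
  module

/-- Over an algebraically closed field there are no odd tangent vectors. For an odd derivation
`D = rightConv x`, the even derivation `D²` is semisimple, and an odd eigenvector `w` of `D²`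
satisfies `D (w (D w) ^ (p - 1)) = (D w) ^ p`; hence the integral kills the `p`-th powers of all
`D w`, and `false_of_integral_frob` applies to `D`. -/
theorem odd_derivation_eq_zero [IsAlgClosed k] {B : Subalgebra k A} (hB : IsSubBialgebra P B)
    (hF : ∀ a, H.frob p h2 a ∈ B) {x : A →ₗ[k] k} (hx : ∀ a, x (P a) = x a)
    (hder : ∀ a ∈ B, ∀ b ∈ B, x (a * b) = x a * counit b + counit a * x b)
    {b : A} (hb : b ∈ B) : x b = 0 := by
  set D : A →ₗ[k] A := rightConv x with hD
  have hx1 : x 1 = 0 := by rw [← hx, H.odd_one, map_zero]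
  have hDB : ∀ b ∈ B, D b ∈ B := hB.right_mem x
  have hPD : ∀ a, P (D a) = D (a - P a) := H.rightConv_odd hx
  have hDP : ∀ a, P a = 0 → P (D a) = D a := fun a ha => by rw [hPD, ha, sub_zero]
  have hmul : ∀ a ∈ B, ∀ b ∈ B, D (a * b) = a * D b + D a * (b - (2 : k) • P b) :=
    fun a ha b hb => H.rightConv_mul hB hx hder ha hb
  have hmul0 : ∀ a ∈ B, ∀ b ∈ B, P b = 0 → D (a * b) = a * D b + D a * b := fun a ha b hb h0 => by
    rw [hmul a ha b hb, h0, smul_zero, sub_zero]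
  have hDF : ∀ a, D (H.frob p h2 a) = 0 := by
    intro a
    have h := H.comul_frob h2 (ℛ k a).eq.symm
    rw [hD, rightConv_apply, h]
    simp only [map_sum, LinearMap.lTensor_tmul, TensorProduct.rid_tmul]
    refine Finset.sum_eq_zero fun i _ => ?_
    rw [← hx, H.odd_frob, map_zero, zero_smul]
  have hlD : ∀ a, l (D a) = 0 := fun a => by rw [hD, H.integral_rightConv, hx1, mul_zero]
  -- the super Leibniz rule makes the square of the odd derivation `D` an even derivation
  let Y : Module.End k A := D ∘ₗ D
  have hYsemi : ∀ (α : k), ∀ v ∈ B, (Y - α • 1) ((Y - α • 1) v) = 0 → (Y - α • 1) v = 0 := by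
    intro α v hv
    refine H.ker_sq_eq_of_derivation h2 hB hF
      ((isLeftInvariant_rightConv x).comp (isLeftInvariant_rightConv x))
      (fun b hb => hDB _ (hDB b hb)) ?_ ?_ ?_ ?_ α hv
    · intro a
      simp only [LinearMap.comp_apply]
      rw [← hD, hPD, hPD, map_sub D a, sub_sub_cancel]
    · intro a ha b hb h0
      simp only [LinearMap.comp_apply]
      rw [← hD, hmul0 a ha b hb h0, map_add, hmul a ha _ (hDB b hb), hmul0 _ (hDB a ha) b hb h0,
        hDP b h0]
      simp only [mul_sub, two_smul, mul_add]
      abel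
    · intro a
      rw [LinearMap.comp_apply, ← hD, hDF, map_zero]
    · intro a
      exact hlD _
  -- the integral kills the `p`-th powers coming from an eigenvector of `D²`
  have heig : ∀ (α : k), ∀ w ∈ B, Y w = α • w → ∀ s,
      l (H.frob p h2 s * H.frob p h2 (D w)) = 0 := by
    intro α w hw hYw s
    -- `D` reverses parity, so the even part of `D w` only involves the odd part `v` of `w`
    set v := P w with hv
    have hvB : v ∈ B := hB.odd_mem w hw
    set u := D v with hu
    have hvP : P v = v := H.odd_odd w
    have huP : P u = 0 := by rw [hu, hPD, hvP, sub_self, map_zero]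
    have huB : u ∈ B := hDB v hvB
    have hDu : D u = α • v := by
      change D (D v) = _
      have h1 : D (D (P w)) = P (D (D w)) := by
        rw [hPD, hPD, map_sub D w, sub_sub_cancel]
      rw [hv, h1]
      change P (Y w) = _
      rw [hYw, map_smul]
    have hfu : H.frob p h2 (D w) = u ^ p := by
      rw [H.frob_apply, hPD, hu, hv, map_sub, sub_sub_cancel]
    have hpowP : ∀ n, P (u ^ n) = 0 := fun n => by
      have := H.pow_ev u n; rwa [huP, sub_zero] at this
    have hcomm : ∀ n, v * u ^ n = u ^ n * v := fun n => by
      have := H.even_comm (u ^ n) v; rw [hpowP, sub_zero] at this; exact this.symm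
    have hvv : v * v = 0 := H.odd_mul_odd_self (two_ne_zero_of_charP k p h2) w
    -- `D u` is a multiple of `v`, and `v * v = 0`
    have hvD : ∀ n : ℕ, v * D (u ^ n) = 0 := by
      intro n
      induction n with
      | zero =>
        have h1 := hDF 1
        rw [map_one] at h1
        rw [pow_zero, h1, mul_zero]
      | succ n ih =>
        rw [pow_succ, hmul0 _ (B.pow_mem huB n) _ huB huP, mul_add, ← mul_assoc, ← mul_assoc, ih,
          hDu, hcomm, mul_smul_comm, mul_assoc, hvv]
        simp
    have hp1 : p - 1 + 1 = p := Nat.sub_add_cancel (by omega)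
    have h1 : D (v * u ^ (p - 1)) = u ^ p := by
      rw [hmul0 _ hvB _ (B.pow_mem huB _) (hpowP _), hvD, zero_add, ← hu, ← pow_succ', hp1]
    have h3 : D (v * u ^ (p - 1) * H.frob p h2 s) = u ^ p * H.frob p h2 s := by
      rw [hmul0 _ (B.mul_mem hvB (B.pow_mem huB _)) _ (hF s) (H.odd_frob h2 s), hDF, h1,
        mul_zero, zero_add]
    rw [hfu, (H.frob_comm h2 s _).eq, ← h3, hlD]
  by_contra hne
  refine H.false_of_integral_frob h2 (isLeftInvariant_rightConv x) (a := (x b)⁻¹ • b) ?_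
    (Subalgebra.toSubmodule B) ?_ ?_
  · rw [map_smul, map_smul, counit_rightConv, smul_eq_mul, inv_mul_cancel₀ hne]
  · exact fun φ => hB.left_mem φ _ (B.smul_mem hb _)
  · intro s w hw
    have hUB : rightOrbit (k := k) w ≤ Subalgebra.toSubmodule B := by
      rintro _ ⟨φ, rfl⟩
      exact hB.right_mem φ w hw
    have hmem := mem_iSup_eigenspace_of_semisimple Y (rightOrbit (k := k) w)
      (fun v hv => rightConv_mem_rightOrbit x (rightConv_mem_rightOrbit x hv))
      (fun α v hv => hYsemi α v (hUB hv)) (self_mem_rightOrbit w)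
    refine Submodule.iSup_induction (fun α : k => rightOrbit (k := k) w ⊓ Y.eigenspace α)
      (motive := fun w => l (H.frob p h2 s * H.frob p h2 (D w)) = 0) hmem ?_ ?_ ?_
    · rintro α v ⟨hv1, hv2⟩
      exact heig α v (hUB hv1) (Module.End.mem_eigenspace_iff.1 hv2) s
    · simp
    · intro v w hv hw
      rw [map_add, map_add, mul_add, map_add, hv, hw, add_zero]

end IsSuperHopf

end OddDerivations

/-! ### The coproduct of an annihilator -/

section LinearAlgebra

variable {k : Type*} [Field k] {V W : Type*} [AddCommGroup V] [Module k V] [AddCommGroup W]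
  [Module k W]

/-- Slicing a tensor on both sides detects membership in `U ⊗ U'`. -/
theorem mem_range_map_subtype {U : Submodule k V} {U' : Submodule k W} {t : V ⊗[k] W}
    (h : ∀ φ : V →ₗ[k] k, TensorProduct.lid k W (φ.rTensor W t) ∈ U')
    (h' : ∀ φ : W →ₗ[k] k, TensorProduct.rid k V (φ.lTensor V t) ∈ U) :
    t ∈ LinearMap.range (TensorProduct.map U.subtype U'.subtype) := by
  obtain ⟨s, rfl⟩ := mem_range_lTensor_subtype h
  have hs : s ∈ LinearMap.range (U.subtype.rTensor U') := by
    refine mem_range_rTensor_subtype fun ψ => ?_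
    obtain ⟨φ, rfl⟩ := LinearMap.exists_extend ψ
    have := h' φ
    rwa [← LinearMap.comp_apply, ← LinearMap.lTensor_comp] at this
  obtain ⟨r, rfl⟩ := hs
  exact ⟨r, by rw [← LinearMap.comp_apply, LinearMap.lTensor_comp_rTensor]⟩

/-- Slicing a tensor along the functionals vanishing on `J` detects membership in
`U ⊗ W + V ⊗ J`. -/
theorem mem_range_rTensor_sup_range_lTensor {U : Submodule k V} {J : Submodule k W}
    {t : V ⊗[k] W}
    (h : ∀ φ : W →ₗ[k] k, (∀ j ∈ J, φ j = 0) → TensorProduct.rid k V (φ.lTensor V t) ∈ U) :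
    t ∈ LinearMap.range (U.subtype.rTensor W) ⊔ LinearMap.range (J.subtype.lTensor V) := by
  have h1 : J.mkQ.lTensor V t ∈ LinearMap.range (U.subtype.rTensor (W ⧸ J)) := by
    refine mem_range_rTensor_subtype fun φ => ?_
    rw [← LinearMap.comp_apply (LinearMap.lTensor _ _), ← LinearMap.lTensor_comp]
    exact h _ fun j hj => by simp [(Submodule.Quotient.mk_eq_zero J).2 hj]
  obtain ⟨s, hs⟩ := h1
  obtain ⟨s', rfl⟩ := LinearMap.lTensor_surjective U J.mkQ_surjective s
  rw [← sub_add_cancel t (U.subtype.rTensor W s'), add_comm]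
  refine Submodule.add_mem_sup ⟨s', rfl⟩ ?_
  rw [← lTensor_mkQ, LinearMap.mem_ker, map_sub, ← hs, sub_eq_zero,
    ← LinearMap.comp_apply, ← LinearMap.comp_apply, LinearMap.lTensor_comp_rTensor,
    LinearMap.rTensor_comp_lTensor]

end LinearAlgebra

section Annihilator

variable {k : Type*} [Field k] {A : Type*} [Ring A] [Algebra k A] [Coalgebra k A]
  {P S : A →ₗ[k] A} {l : A →ₗ[k] k}

namespace IsSuperHopf

variable (H : IsSuperHopf P S l)
include H

/-- The identity `∑ Δ(a₁) (1 ⊗ S(a₂)) = a ⊗ 1`. -/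
theorem comul_mul_antipode (a : A) :
    LinearMap.mul' k (A ⊗[k] A) (TensorProduct.map comul (TensorProduct.mk k A A 1 ∘ₗ S)
      (comul (R := k) a)) = a ⊗ₜ 1 := by
  have h : ∀ t : A ⊗[k] A, LinearMap.mul' k (A ⊗[k] A)
      (TensorProduct.map comul (TensorProduct.mk k A A 1 ∘ₗ S) t) =
      (LinearMap.mul' k A ∘ₗ S.lTensor A).lTensor A
        (TensorProduct.assoc k A A A (comul.rTensor A t)) := by
    intro t
    induction t with
    | zero => simp
    | add x y hx hy => simp only [map_add, hx, hy]
    | tmul b c =>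
      simp only [LinearMap.rTensor_tmul, TensorProduct.map_tmul, LinearMap.mul'_apply]
      generalize comul (R := k) b = t
      induction t with
      | zero => simp
      | add x y hx hy => simp only [map_add, TensorProduct.add_tmul, add_mul, hx, hy]
      | tmul b c => simp
  have h1 : (LinearMap.mul' k A ∘ₗ S.lTensor A) ∘ₗ comul =
      Algebra.linearMap k A ∘ₗ counit := by
    ext a
    simpa using H.antipode_right a
  rw [h, coassoc_apply, ← LinearMap.comp_apply (LinearMap.lTensor _ _), ← LinearMap.lTensor_comp,
    h1, LinearMap.lTensor_comp, LinearMap.comp_apply, lTensor_counit_comul]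
  simp

/-- Let `f` be an element annihilating a subspace `X` with `Δ(X) ⊆ X ⊗ A + A ⊗ J'`. Then all
translates of `f` along functionals vanishing on `J` annihilate `X`: compare
`∑ Δ(f x₁) (1 ⊗ S(x₂))` with `Δ(f) (x ⊗ 1)` modulo `A ⊗ J`. -/
theorem rightConv_mul_eq_zero {X J J' : Submodule k A} (hJ : ∀ a, ∀ j ∈ J, a * j ∈ J)
    (hodd : ∀ a, P a ∈ J) (hS : ∀ j ∈ J', S j ∈ J)
    (hX : ∀ x ∈ X, comul (R := k) x ∈
      LinearMap.range (X.subtype.rTensor A) ⊔ LinearMap.range (J'.subtype.lTensor A))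
    {f : A} (hf : ∀ x ∈ X, f * x = 0) {φ : A →ₗ[k] k} (hφ : ∀ j ∈ J, φ j = 0)
    {x : A} (hx : x ∈ X) : rightConv φ f * x = 0 := by
  have hφP : φ ∘ₗ P = 0 := LinearMap.ext fun a => hφ _ (hodd a)
  have h1 : ∀ t : A ⊗[k] A, LinearMap.mul' k (A ⊗[k] A)
      (TensorProduct.map (comul ∘ₗ LinearMap.mulLeft k f) (TensorProduct.mk k A A 1 ∘ₗ S) t) =
      twistedMul P (comul f) (LinearMap.mul' k (A ⊗[k] A)
      (TensorProduct.map comul (TensorProduct.mk k A A 1 ∘ₗ S) t)) := by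
    intro t
    induction t with
    | zero => simp
    | add x y hx hy => simp only [map_add, hx, hy]
    | tmul b c =>
      have h : ∀ t : A ⊗[k] A, P.rTensor A (t * 1 ⊗ₜ S c) = P.rTensor A t * 1 ⊗ₜ S c := by
        intro t
        induction t with
        | zero => simp
        | add x y hx hy => simp only [map_add, add_mul, hx, hy]
        | tmul b c => simp
      simp only [TensorProduct.map_tmul, LinearMap.mul'_apply, LinearMap.comp_apply,
        LinearMap.mulLeft_apply, TensorProduct.mk_apply, twistedMul_apply, H.comul_mul, h]
      simp only [sub_mul, mul_assoc, smul_mul_assoc]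
  -- the sign terms involve `P` on the right tensor factor and disappear under `φ`
  have h2 := h1 (comul x)
  rw [H.comul_mul_antipode, twistedMul_apply] at h2
  have h3 : ∀ (t : A ⊗[k] A) (y : A), TensorProduct.rid k A (φ.lTensor A (t * y ⊗ₜ 1)) =
      TensorProduct.rid k A (φ.lTensor A t) * y := by
    intro t y
    induction t with
    | zero => simp
    | add x y hx hy => simp only [map_add, add_mul, hx, hy]
    | tmul b c => simp
  have h4 : ∀ (t : A ⊗[k] A), ∀ j ∈ J, TensorProduct.rid k A (φ.lTensor A (t * 1 ⊗ₜ j)) = 0 := by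
    intro t j hj
    induction t with
    | zero => simp
    | add x y hx hy => simp only [map_add, add_mul, hx, hy, add_zero]
    | tmul b c => simp [hφ _ (hJ c j hj)]
  have h5 := congrArg (fun z => TensorProduct.rid k A (φ.lTensor A z)) h2
  simp only [map_sub, map_smul, LinearMap.rTensor_tmul, h3] at h5
  rw [← LinearMap.comp_apply (LinearMap.lTensor _ _) (LinearMap.lTensor _ _),
    ← LinearMap.lTensor_comp, hφP, LinearMap.lTensor_zero, LinearMap.zero_apply, map_zero, zero_mul,
    smul_zero, sub_zero, ← rightConv_apply] at h5
  rw [← h5]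
  obtain ⟨y, hy, z, hz, hyz⟩ := Submodule.mem_sup.1 (hX x hx)
  obtain ⟨s, rfl⟩ := exists_sum_of_mem_range_rTensor hy
  obtain ⟨t, rfl⟩ := exists_sum_of_mem_range_lTensor hz
  rw [← hyz]
  simp only [map_add, map_sum, TensorProduct.map_tmul, LinearMap.mul'_apply, LinearMap.comp_apply,
    LinearMap.mulLeft_apply, TensorProduct.mk_apply]
  rw [Finset.sum_eq_zero, Finset.sum_eq_zero, add_zero]
  · exact fun i _ => h4 _ _ (hS _ i.2.2)
  · intro i _
    rw [hf _ i.1.2]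
    simp

/-- Let `f` be an element annihilating a subspace `X` with `Δ(X) ⊆ X ⊗ A + A ⊗ J'`, and `J` a left
ideal containing the odd part and `S(J')`. Then `Δ(f) ∈ Ann(X) ⊗ A + A ⊗ J`. -/
theorem comul_mem_annihilator_sup {X J J' : Submodule k A} (hJ : ∀ a, ∀ j ∈ J, a * j ∈ J)
    (hodd : ∀ a, P a ∈ J) (hS : ∀ j ∈ J', S j ∈ J)
    (hX : ∀ x ∈ X, comul (R := k) x ∈
      LinearMap.range (X.subtype.rTensor A) ⊔ LinearMap.range (J'.subtype.lTensor A))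
    {f : A} (hf : ∀ x ∈ X, f * x = 0) :
    ∃ (Ann : Submodule k A) (s : Finset (Ann × A)) (t : Finset (A × J)),
      (∀ g ∈ Ann, ∀ x ∈ X, g * x = 0) ∧
      comul (R := k) f = ∑ i ∈ s, (i.1 : A) ⊗ₜ i.2 + ∑ i ∈ t, i.1 ⊗ₜ (i.2 : A) := by
  let Ann : Submodule k A := ⨅ x : X, LinearMap.ker (LinearMap.mulRight k (x : A))
  have hAnn : ∀ g, g ∈ Ann ↔ ∀ x ∈ X, g * x = 0 := fun g => by simp [Ann]
  have h := mem_range_rTensor_sup_range_lTensor (U := Ann) (J := J) (t := comul (R := k) f)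
    fun φ hφ => (hAnn _).2 fun x hx => H.rightConv_mul_eq_zero hJ hodd hS hX hf hφ hx
  obtain ⟨y, hy, z, hz, hyz⟩ := Submodule.mem_sup.1 h
  obtain ⟨s, rfl⟩ := exists_sum_of_mem_range_rTensor hy
  obtain ⟨t, rfl⟩ := exists_sum_of_mem_range_lTensor hz
  exact ⟨Ann, s, t, fun g hg => (hAnn g).1 hg, hyz.symm⟩

end IsSuperHopf

end Annihilator

/-! ### Finite-dimensional subcoalgebras -/

section Subcoalgebra

variable {k : Type*} [Field k] {A : Type*} [AddCommGroup A] [Module k A] [Coalgebra k A]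

theorem exists_finiteDimensional_leftConv (a : A) :
    ∃ U : Submodule k A, FiniteDimensional k U ∧ ∀ x : A →ₗ[k] k, leftConv x a ∈ U := by
  refine ⟨Submodule.span k ((ℛ k a).right '' ((ℛ k a).index : Set (A × A))),
    FiniteDimensional.span_of_finite k ((Finset.finite_toSet _).image _), fun x => ?_⟩
  rw [leftConv_eq_sum x (ℛ k a)]
  exact Submodule.sum_mem _ fun i hi => Submodule.smul_mem _ _
    (Submodule.subset_span ⟨i, hi, rfl⟩)

theorem leftConv_counit : leftConv (counit : A →ₗ[k] k) = LinearMap.id := by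
  ext a
  simp [leftConv_apply]

theorem leftConv_comp (x y : A →ₗ[k] k) :
    leftConv x ∘ₗ leftConv y = leftConv (x ∘ₗ leftConv y) := by
  ext a
  rw [← sub_eq_zero, ← Module.forall_dual_apply_eq_zero_iff k]
  intro z
  rw [map_sub, sub_eq_zero, LinearMap.comp_apply, ← counit_rightConv z, ← counit_rightConv z,
    ← rightConv_leftConv, ← rightConv_leftConv, ← rightConv_leftConv, counit_leftConv,
    counit_leftConv]
  rfl

/-- Every element of a coalgebra lies in a finite-dimensional subcoalgebra. -/
theorem exists_finiteDimensional_subcoalgebra (a : A) :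
    ∃ C : Submodule k A, FiniteDimensional k C ∧ a ∈ C ∧
      (∀ φ : A →ₗ[k] k, ∀ c ∈ C, leftConv φ c ∈ C) ∧
      ∀ φ : A →ₗ[k] k, ∀ c ∈ C, rightConv φ c ∈ C := by
  classical
  let U := rightOrbit (k := k) a
  let b := Module.finBasis k U
  choose V hV hVmem using fun u : A => exists_finiteDimensional_leftConv (k := k) u
  let D : Submodule k A := ⨆ i, V (b i : A)
  let C : Submodule k A := Submodule.span k {c | ∃ (φ : A →ₗ[k] k), ∃ u ∈ U, c = leftConv φ u}
  have hC : ∀ φ : A →ₗ[k] k, ∀ u ∈ U, leftConv φ u ∈ C := fun φ u hu =>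
    Submodule.subset_span ⟨φ, u, hu, rfl⟩
  have hCD : C ≤ D := by
    refine Submodule.span_le.2 ?_
    rintro _ ⟨φ, u, hu, rfl⟩
    have := congrArg (fun z : U => leftConv φ (z : A)) (b.sum_repr ⟨u, hu⟩)
    simp only [AddSubmonoidClass.coe_finsetSum, map_sum, SetLike.val_smul, map_smul] at this
    rw [← this]
    exact Submodule.sum_mem _ fun i _ => D.smul_mem _
      (le_iSup (fun i => V (b i : A)) i (hVmem _ φ))
  have : FiniteDimensional k D := Submodule.finiteDimensional_iSup _
  refine ⟨C, Submodule.finiteDimensional_of_le hCD, ?_, ?_, ?_⟩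
  · have := hC counit a (self_mem_rightOrbit a)
    rwa [leftConv_counit] at this
  · intro φ c hc
    induction hc using Submodule.span_induction with
    | zero => simp
    | add x y _ _ hx hy => rw [map_add]; exact C.add_mem hx hy
    | smul r x _ hx => rw [map_smul]; exact C.smul_mem _ hx
    | mem x hx =>
      obtain ⟨ψ, u, hu, rfl⟩ := hx
      rw [← LinearMap.comp_apply, leftConv_comp]
      exact hC _ u hu
  · intro φ c hc
    induction hc using Submodule.span_induction with
    | zero => simp
    | add x y _ _ hx hy => rw [map_add]; exact C.add_mem hx hy
    | smul r x _ hx => rw [map_smul]; exact C.smul_mem _ hx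
    | mem x hx =>
      obtain ⟨ψ, u, hu, rfl⟩ := hx
      rw [← rightConv_leftConv]
      exact hC _ _ (rightConv_mem_rightOrbit φ hu)

end Subcoalgebra

section PurelyEven

variable {k : Type*} [Field k] {A : Type*} [Ring A] [Algebra k A] [Coalgebra k A]
  {P S : A →ₗ[k] A} {l : A →ₗ[k] k}

namespace IsSuperHopf

variable (H : IsSuperHopf P S l)
include H

theorem rightConv_apply_odd (φ : A →ₗ[k] k) (a : A) :
    rightConv φ (P a) = P (rightConv φ a) + rightConv (φ ∘ₗ P) a
      - (2 : k) • P (rightConv (φ ∘ₗ P) a) := by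
  rw [rightConv_apply, H.comul_odd, rightConv_apply, rightConv_apply]
  generalize comul (R := k) a = t
  induction t with
  | zero => simp
  | add x y hx hy =>
    simp only [map_add, map_sub, smul_add, map_smul] at hx hy ⊢
    linear_combination (norm := module) hx + hy
  | tmul b c => simp

theorem leftConv_apply_odd (φ : A →ₗ[k] k) (a : A) :
    leftConv φ (P a) = leftConv (φ ∘ₗ P) a + P (leftConv φ a)
      - (2 : k) • P (leftConv (φ ∘ₗ P) a) := by
  rw [leftConv_apply, H.comul_odd, leftConv_apply, leftConv_apply]
  generalize comul (R := k) a = t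
  induction t with
  | zero => simp
  | add x y hx hy =>
    simp only [map_add, map_sub, smul_add, map_smul] at hx hy ⊢
    linear_combination (norm := module) hx + hy
  | tmul b c => simp

/-- Every element lies in a finite-dimensional graded subcoalgebra. -/
theorem exists_finiteDimensional_graded_subcoalgebra (a : A) :
    ∃ C : Submodule k A, FiniteDimensional k C ∧ a ∈ C ∧ (∀ c ∈ C, P c ∈ C) ∧
      (∀ φ : A →ₗ[k] k, ∀ c ∈ C, leftConv φ c ∈ C) ∧
      ∀ φ : A →ₗ[k] k, ∀ c ∈ C, rightConv φ c ∈ C := by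
  obtain ⟨C, hfin, ha, hl, hr⟩ := exists_finiteDimensional_subcoalgebra (k := k) a
  have hP : ∀ c ∈ C, P c ∈ C ⊔ C.map P := fun c hc => Submodule.mem_sup_right ⟨c, hc, rfl⟩
  have hC : ∀ c ∈ C, c ∈ C ⊔ C.map P := fun c hc => Submodule.mem_sup_left hc
  refine ⟨C ⊔ C.map P, inferInstance, hC a ha, ?_, ?_, ?_⟩
  · intro c hc
    obtain ⟨x, hx, _, ⟨y, hy, rfl⟩, rfl⟩ := Submodule.mem_sup.1 hc
    rw [map_add, H.odd_odd]
    exact Submodule.add_mem _ (hP x hx) (hP y hy)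
  · intro φ c hc
    obtain ⟨x, hx, _, ⟨y, hy, rfl⟩, rfl⟩ := Submodule.mem_sup.1 hc
    rw [map_add, H.leftConv_apply_odd]
    exact Submodule.add_mem _ (hC _ (hl φ x hx)) (Submodule.sub_mem _ (Submodule.add_mem _
      (hC _ (hl _ y hy)) (hP _ (hl _ y hy))) (Submodule.smul_mem _ _ (hP _ (hl _ y hy))))
  · intro φ c hc
    obtain ⟨x, hx, _, ⟨y, hy, rfl⟩, rfl⟩ := Submodule.mem_sup.1 hc
    rw [map_add, H.rightConv_apply_odd]
    exact Submodule.add_mem _ (hC _ (hr φ x hx)) (Submodule.sub_mem _ (Submodule.add_mem _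
      (hP _ (hr _ y hy)) (hC _ (hr _ y hy))) (Submodule.smul_mem _ _ (hP _ (hr _ y hy))))

/-- A subalgebra generated by a `P`-stable set whose coproducts it contains is a
sub-super-bialgebra. -/
theorem isSubBialgebra_adjoin {G : Set A} (hP : ∀ c ∈ G, P c ∈ Algebra.adjoin k G)
    (hG : ∀ c ∈ G, comul (R := k) c ∈ LinearMap.range (TensorProduct.map
      (Algebra.adjoin k G).val.toLinearMap (Algebra.adjoin k G).val.toLinearMap)) :
    IsSubBialgebra P (Algebra.adjoin k G) := by
  set B := Algebra.adjoin k G with hBdef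
  have hPB : ∀ b ∈ B, P b ∈ B := by
    intro b hb
    induction hb using Algebra.adjoin_induction with
    | mem c hc => exact hP c hc
    | algebraMap r =>
      rw [Algebra.algebraMap_eq_smul_one, map_smul, H.odd_one, smul_zero]
      exact B.zero_mem
    | add x y _ _ hx hy => rw [map_add]; exact B.add_mem hx hy
    | mul x y hxB hyB hx hy =>
      rw [H.odd_mul]
      exact B.add_mem (B.mul_mem hx (B.sub_mem hyB hy)) (B.mul_mem (B.sub_mem hxB hx) hy)
  let R : Subalgebra k (A ⊗[k] A) := (Algebra.TensorProduct.map B.val B.val).range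
  have hR : ∀ t, t ∈ R ↔ t ∈ LinearMap.range (TensorProduct.map
      B.val.toLinearMap B.val.toLinearMap) := fun t => Iff.rfl
  let P' : B →ₗ[k] B :=
    P.restrict (p := Subalgebra.toSubmodule B) (q := Subalgebra.toSubmodule B) hPB
  have hP' : ∀ b : B, (P' b : A) = P b := fun _ => rfl
  have hRr : ∀ t ∈ R, P.rTensor A t ∈ R := by
    rintro _ ⟨t, rfl⟩
    refine ⟨P'.rTensor B t, ?_⟩
    induction t with
    | zero => simp
    | add x y hx hy => simp only [map_add] at hx hy ⊢; rw [hx, hy]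
    | tmul x y => simp [hP']
  have hRl : ∀ t ∈ R, P.lTensor A t ∈ R := by
    rintro _ ⟨t, rfl⟩
    refine ⟨P'.lTensor B t, ?_⟩
    induction t with
    | zero => simp
    | add x y hx hy => simp only [map_add] at hx hy ⊢; rw [hx, hy]
    | tmul x y => simp [hP']
  have hcomul : ∀ b ∈ B, comul (R := k) b ∈ R := by
    intro b hb
    induction hb using Algebra.adjoin_induction with
    | mem c hc => exact (hR _).2 (hG c hc)
    | algebraMap r =>
      rw [Algebra.algebraMap_eq_smul_one, map_smul, H.comul_one]
      exact R.smul_mem R.one_mem r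
    | add x y _ _ hx hy => rw [map_add]; exact R.add_mem hx hy
    | mul x y _ _ hx hy =>
      rw [H.comul_mul]
      exact R.sub_mem (R.mul_mem hx hy) (R.smul_mem (R.mul_mem (hRl _ hx) (hRr _ hy)) _)
  refine ⟨hPB, fun φ b hb => ?_, fun φ b hb => ?_⟩
  · obtain ⟨t, ht⟩ := hcomul b hb
    rw [leftConv_apply, ← ht]
    clear ht
    induction t with
    | zero => simp
    | add x y hx hy => simp only [map_add]; exact B.add_mem hx hy
    | tmul x y => simpa using B.smul_mem y.2 _
  · obtain ⟨t, ht⟩ := hcomul b hb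
    rw [rightConv_apply, ← ht]
    clear ht
    induction t with
    | zero => simp
    | add x y hx hy => simp only [map_add]; exact B.add_mem hx hy
    | tmul x y => simpa using B.smul_mem x.2 _

end IsSuperHopf

end PurelyEven

/-! ### Vanishing of the odd part -/

section PurelyEven

variable {k : Type*} [Field k] {A : Type*} [Ring A] [Algebra k A] [Coalgebra k A]
  {P S : A →ₗ[k] A} {l : A →ₗ[k] k}

namespace IsSuperHopf

variable (H : IsSuperHopf P S l)
include H

/-- The even part of a graded subalgebra. -/
def evenSubalgebra (B : Subalgebra k A) : Subalgebra k A where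
  carrier := {b | b ∈ B ∧ P b = 0}
  mul_mem' := by
    rintro a b ⟨ha, ha0⟩ ⟨hb, hb0⟩
    exact ⟨B.mul_mem ha hb, by rw [H.odd_mul, ha0, hb0]; simp⟩
  add_mem' := by
    rintro a b ⟨ha, ha0⟩ ⟨hb, hb0⟩
    exact ⟨B.add_mem ha hb, by rw [map_add, ha0, hb0, add_zero]⟩
  algebraMap_mem' r := ⟨B.algebraMap_mem r, by
    rw [Algebra.algebraMap_eq_smul_one, map_smul, H.odd_one, smul_zero]⟩

/-- The even part of a graded subalgebra is a commutative ring. -/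
abbrev evenSubalgebraCommRing (B : Subalgebra k A) : CommRing (H.evenSubalgebra B) where
  __ : Ring (H.evenSubalgebra B) := inferInstance
  mul_comm a b := Subtype.ext (by
    have := H.even_comm (a : A) b
    rwa [a.2.2, sub_zero] at this)

variable {p : ℕ} [Fact p.Prime] [CharP k p] (h2 : 2 < p)

include h2 in
/-- If an `r` with `ε(r) = 1` annihilates the odd part of a sub-super-bialgebra, then this odd part
vanishes. Let `J` be the ideal generated by all odd elements. Since `Δ(r) ∈ Ann ⊗ A + A ⊗ J` and
Frobenius kills `J`, applying Frobenius to `∑ r₁ S(r₂) = 1` gives `1` as a combination of elements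
`Frob(g)` with `g ∈ Ann`. -/
theorem odd_eq_zero_of_annihilator {B : Subalgebra k A} (hB : IsSubBialgebra P B) {r : A}
    (hr1 : counit (R := k) r = 1)
    (hr : ∀ b ∈ B, P b = b → r * b = 0) {a : A} (ha : a ∈ B) (haP : P a = a) : a = 0 := by
  -- the odd part of `B`
  let X : Submodule k A := Subalgebra.toSubmodule B ⊓ LinearMap.ker (P - LinearMap.id)
  have hXmem : ∀ x, x ∈ X ↔ x ∈ B ∧ P x = x := fun x => by
    simp [X, sub_eq_zero]
  let J : Submodule k A := Submodule.span k {z | ∃ b c, z = P b * c}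
  have hJmem : ∀ b c, P b * c ∈ J := fun b c => Submodule.subset_span ⟨b, c, rfl⟩
  have hJ : ∀ a, ∀ j ∈ J, a * j ∈ J := by
    intro a j hj
    induction hj using Submodule.span_induction with
    | zero => simp
    | add x y _ _ hx hy => rw [mul_add]; exact J.add_mem hx hy
    | smul r x _ hx => rw [mul_smul_comm]; exact J.smul_mem _ hx
    | mem x hx =>
      obtain ⟨b, c, rfl⟩ := hx
      have : a * (P b * c) = P b * ((a - P a) * c) - P b * (P a * c) := by
        calc a * (P b * c) = ((a - P a) * P b) * c + (P a * P b) * c := by noncomm_ring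
          _ = _ := by rw [H.even_comm, H.anticomm]; noncomm_ring
      rw [this]
      exact J.sub_mem (hJmem _ _) (hJmem _ _)
  have hodd : ∀ a, P a ∈ J := fun a => by simpa using hJmem a 1
  have hS : ∀ j ∈ LinearMap.range P, S j ∈ J := by
    rintro _ ⟨b, rfl⟩
    rw [H.antipode_odd]
    exact hodd _
  have hX : ∀ x ∈ X, comul (R := k) x ∈
      LinearMap.range (X.subtype.rTensor A) ⊔
        LinearMap.range ((LinearMap.range P).subtype.lTensor A) := by
    intro x hx
    obtain ⟨hxB, hxP⟩ := (hXmem x).1 hx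
    obtain ⟨s, hs⟩ := exists_sum_of_mem_range_rTensor (U := Subalgebra.toSubmodule B)
      (mem_range_rTensor_subtype fun φ => hB.right_mem φ x hxB)
    have : comul (R := k) x = ∑ i ∈ s, (P i.1 ⊗ₜ (i.2 - P i.2) + ((i.1 : A) - P i.1) ⊗ₜ P i.2) := by
      conv_lhs => rw [← hxP, H.comul_odd, hs]
      simp only [map_sum, LinearMap.rTensor_tmul, LinearMap.lTensor_tmul, TensorProduct.map_tmul,
        Finset.smul_sum, ← Finset.sum_add_distrib, ← Finset.sum_sub_distrib]
      refine Finset.sum_congr rfl fun i _ => ?_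
      simp only [TensorProduct.sub_tmul, TensorProduct.tmul_sub, two_smul]
      abel
    rw [this]
    refine Submodule.sum_mem _ fun i _ => Submodule.add_mem_sup ?_ ?_
    · exact ⟨(⟨P i.1, (hXmem _).2 ⟨hB.odd_mem _ i.1.2, H.odd_odd _⟩⟩ : X) ⊗ₜ (i.2 - P i.2), by simp⟩
    · exact ⟨((i.1 : A) - P i.1) ⊗ₜ (⟨P i.2, i.2, rfl⟩ : LinearMap.range P), by simp⟩
  obtain ⟨Ann, s, t, hAnn, hst⟩ := H.comul_mem_annihilator_sup hJ hodd hS hX (f := r)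
    fun x hx => hr x ((hXmem x).1 hx).1 ((hXmem x).1 hx).2
  have hJF : ∀ j ∈ J, H.frob p h2 j = 0 := by
    intro j hj
    induction hj using Submodule.span_induction with
    | zero => simp
    | add x y _ _ hx hy => rw [map_add, hx, hy, add_zero]
    | smul r x _ hx => rw [H.frob_smul, hx, smul_zero]
    | mem x hx =>
      obtain ⟨b, c, rfl⟩ := hx
      rw [map_mul, H.frob_odd, zero_mul]
  -- the odd component of `g a = 0` is `(g - P g) a`, as `a` is odd
  have hAnnF : ∀ g ∈ Ann, H.frob p h2 g * a = 0 := by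
    intro g hg
    have h1 := hAnn g hg a ((hXmem a).2 ⟨ha, haP⟩)
    have h3 : (g - P g) * a = 0 := by
      have h4 := H.odd_mul g a
      rw [h1, map_zero, haP, sub_self, mul_zero, zero_add] at h4
      exact h4.symm
    rw [H.frob_apply, ← Nat.sub_add_cancel (Fact.out : p.Prime).one_le, pow_succ, mul_assoc, h3,
      mul_zero]
  have hfr : comul (R := k) (H.frob p h2 r) =
      ∑ i ∈ s, H.frob p h2 (i.1 : A) ⊗ₜ H.frob p h2 i.2 := by
    have := H.comul_frob h2 (a := r) (s := s.disjSum t)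
      (f := Sum.elim (fun i => (i.1 : A)) fun i => i.1)
      (g := Sum.elim (fun i => i.2) fun i => (i.2 : A)) (by rw [hst, Finset.sum_disjSum]; rfl)
    rw [this, Finset.sum_disjSum]
    simp only [Sum.elim_inl, Sum.elim_inr]
    rw [Finset.sum_eq_zero (s := t), add_zero]
    intro i _
    rw [hJF _ i.2.2, TensorProduct.tmul_zero]
  have hone := H.antipode_right (H.frob p h2 r)
  rw [hfr, H.counit_frob, hr1, one_pow, map_one] at hone
  simp only [map_sum, LinearMap.lTensor_tmul, LinearMap.mul'_apply] at hone
  rw [← one_mul a, ← hone, Finset.sum_mul]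
  refine Finset.sum_eq_zero fun i _ => ?_
  rw [(H.frob_comm h2 _ _).eq, mul_assoc, hAnnF _ i.1.2, mul_zero]

include h2 in
/-- Over an algebraically closed field of odd characteristic, a super-commutative super Hopf
algebra with a normalized integral is purely even. -/
theorem odd_eq_zero [IsAlgClosed k] (a : A) : P a = 0 := by
  -- `G` contains the image of Frobenius, as `odd_derivation_eq_zero` requires of the subalgebra
  obtain ⟨C, hfin, haC, hCP, hCl, hCr⟩ := H.exists_finiteDimensional_graded_subcoalgebra a
  let G : Set A := C ∪ Set.range (H.frob p h2)
  let B : Subalgebra k A := Algebra.adjoin k G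
  have hCB : ∀ c ∈ C, c ∈ B := fun c hc => Algebra.subset_adjoin (Or.inl hc)
  have hFB : ∀ c, H.frob p h2 c ∈ B := fun c => Algebra.subset_adjoin (Or.inr ⟨c, rfl⟩)
  have hB : IsSubBialgebra P B := by
    refine H.isSubBialgebra_adjoin ?_ ?_
    · rintro c (hc | ⟨c, rfl⟩)
      · exact hCB _ (hCP c hc)
      · rw [H.odd_frob]; exact B.zero_mem
    · rintro c (hc | ⟨c, rfl⟩)
      · obtain ⟨t, ht⟩ := mem_range_map_subtype (U := C) (U' := C) (t := comul (R := k) c)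
          (fun φ => hCl φ c hc) (fun φ => hCr φ c hc)
        let j : C →ₗ[k] B := C.subtype.codRestrict (Subalgebra.toSubmodule B) fun c => hCB c c.2
        exact ⟨TensorProduct.map j j t, by
          rw [← ht, ← LinearMap.comp_apply, ← TensorProduct.map_comp]; rfl⟩
      · rw [H.comul_frob h2 (ℛ k c).eq.symm]
        exact Submodule.sum_mem _ fun i _ =>
          ⟨(⟨_, hFB ((ℛ k c).left i)⟩ : B) ⊗ₜ (⟨_, hFB ((ℛ k c).right i)⟩ : B), by simp⟩
  -- the odd part of `B` is a finitely generated module over the even part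
  let _ := H.evenSubalgebraCommRing B
  let B0 := H.evenSubalgebra B
  let b := Module.finBasis k C
  let N : Submodule B0 A := Submodule.span B0 (Set.range fun i => P (b i))
  have hNC : ∀ c ∈ C, P c ∈ N := by
    intro c hc
    have := congrArg (fun z : C => P (z : A)) (b.sum_repr ⟨c, hc⟩)
    simp only [AddSubmonoidClass.coe_finsetSum, map_sum, SetLike.val_smul, map_smul] at this
    rw [← this]
    refine Submodule.sum_mem _ fun i _ => ?_
    rw [← algebraMap_smul B0]
    exact N.smul_mem _ (Submodule.subset_span ⟨i, rfl⟩)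
  have hev : ∀ b ∈ B, b - P b ∈ B0 := fun b hb =>
    ⟨B.sub_mem hb (hB.odd_mem b hb), H.odd_ev b⟩
  have hNB : ∀ b ∈ B, P b ∈ N := by
    intro b hb
    induction hb using Algebra.adjoin_induction with
    | mem c hc =>
      rcases hc with hc | ⟨c, rfl⟩
      · exact hNC c hc
      · rw [H.odd_frob]; exact N.zero_mem
    | algebraMap r =>
      rw [Algebra.algebraMap_eq_smul_one, map_smul, H.odd_one, smul_zero]
      exact N.zero_mem
    | add x y _ _ hx hy => rw [map_add]; exact N.add_mem hx hy
    | mul x y hxB hyB hx hy =>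
      rw [H.odd_mul, ← H.even_comm]
      exact N.add_mem (N.smul_mem ⟨_, hev y hyB⟩ hx) (N.smul_mem ⟨_, hev x hxB⟩ hy)
  have hNodd : ∀ n ∈ N, n ∈ B ∧ P n = n := by
    intro n hn
    induction hn using Submodule.span_induction with
    | zero => exact ⟨B.zero_mem, map_zero _⟩
    | add x y _ _ hx hy => exact ⟨B.add_mem hx.1 hy.1, by rw [map_add, hx.2, hy.2]⟩
    | smul r x _ hx =>
      refine ⟨B.mul_mem r.2.1 hx.1, ?_⟩
      change P ((r : A) * x) = (r : A) * x
      rw [H.odd_mul, r.2.2, hx.2]; simp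
    | mem x hx =>
      obtain ⟨i, rfl⟩ := hx
      exact ⟨hCB _ (hCP _ (b i).2), H.odd_odd _⟩
  let e : B0 →+* k :=
    { toFun := fun z => counit (R := k) (z : A)
      map_one' := H.counit_one
      map_mul' := fun x y => H.counit_mul x y
      map_zero' := map_zero _
      map_add' := fun x y => map_add _ _ _ }
  let I : Ideal B0 := RingHom.ker e
  have hle : N ≤ I • N := by
    -- otherwise a functional vanishing on `I • N` gives a nonzero odd tangent vector `x0 ∘ₗ P`
    intro c hc
    by_contra hcI
    let Q : Submodule k A := (I • N).restrictScalars k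
    obtain ⟨x0, hx0c, hx0Q⟩ := Submodule.exists_le_ker_of_notMem (p := Q) (v := c) hcI
    have hx0Q' : ∀ m : A, (hm : m ∈ B0) → counit (R := k) m = 0 → ∀ n ∈ N, x0 (m * n) = 0 :=
      fun m hm hm0 n hn => by
        have h1 : (⟨m, hm⟩ : B0) ∈ I := hm0
        have h3 : (⟨m, hm⟩ : B0) • n ∈ I • N := Submodule.smul_mem_smul h1 hn
        exact hx0Q h3
    have hev1 : ∀ b ∈ B, ∀ n ∈ N, x0 ((b - P b) * n) = counit (R := k) b * x0 n := by
      intro b hb n hn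
      have h1 := hx0Q' ((b - P b) - algebraMap k A (counit (R := k) b))
        (B0.sub_mem (hev b hb) (B0.algebraMap_mem _)) (by
          rw [map_sub, map_sub, H.counit_odd, Algebra.algebraMap_eq_smul_one, map_smul,
            H.counit_one]
          simp) n hn
      rw [sub_mul, map_sub, sub_eq_zero, ← Algebra.smul_def, map_smul] at h1
      exact h1
    have h0 := H.odd_derivation_eq_zero h2 hB hFB (x := x0 ∘ₗ P)
      (fun a => by simp [H.odd_odd]) (fun a ha b hb => by
        simp only [LinearMap.comp_apply]
        rw [H.odd_mul, ← H.even_comm, map_add, hev1 b hb _ (hNB a ha), hev1 a ha _ (hNB b hb),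
          mul_comm])
      (hNodd c hc).1
    rw [LinearMap.comp_apply, (hNodd c hc).2] at h0
    exact hx0c h0
  obtain ⟨r, hrI, hrN⟩ := Submodule.exists_sub_one_mem_and_smul_eq_zero_of_fg_of_le_smul I N
    (Submodule.fg_span (Set.finite_range _)) hle
  have hr1 : counit (R := k) (r : A) = 1 := by
    have h1 : counit (R := k) ((r : A) - 1) = 0 := hrI
    rwa [map_sub, H.counit_one, sub_eq_zero] at h1
  refine H.odd_eq_zero_of_annihilator h2 hB hr1 ?_ (hB.odd_mem a (hCB a haC)) (H.odd_odd a)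
  intro z hz hzP
  exact hrN z (hzP ▸ hNB z hz)

end IsSuperHopf

end PurelyEven

/-! ### Extension of the base field -/

section BaseChange

variable {k : Type*} [Field k] {A : Type*} [Ring A] [Algebra k A]
  (K : Type*) [Field K] [Algebra k K]

/-- The canonical map `A ⊗ A → A_K ⊗ A_K`. -/
def baseChangeTensor : A ⊗[k] A →ₐ[k] (K ⊗[k] A) ⊗[K] (K ⊗[k] A) :=
  Algebra.TensorProduct.lift
    (((Algebra.TensorProduct.includeLeft :
      K ⊗[k] A →ₐ[K] (K ⊗[k] A) ⊗[K] (K ⊗[k] A)).restrictScalars k).comp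
        Algebra.TensorProduct.includeRight)
    (((Algebra.TensorProduct.includeRight :
      K ⊗[k] A →ₐ[K] (K ⊗[k] A) ⊗[K] (K ⊗[k] A)).restrictScalars k).comp
        Algebra.TensorProduct.includeRight)
    (fun a b => by rw [commute_iff_eq]; simp)

@[simp]
theorem baseChangeTensor_tmul (a b : A) :
    baseChangeTensor K (a ⊗ₜ[k] b) = ((1 : K) ⊗ₜ[k] a) ⊗ₜ[K] ((1 : K) ⊗ₜ[k] b) := by
  rw [baseChangeTensor, Algebra.TensorProduct.lift_tmul]
  simp

theorem comul_one_tmul [Coalgebra k A] (a : A) :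
    comul (R := K) ((1 : K) ⊗ₜ[k] a) = baseChangeTensor K (comul (R := k) a) := by
  rw [TensorProduct.comul_tmul]
  generalize comul (R := k) a = t
  induction t with
  | zero => simp
  | add x y hx hy => rw [TensorProduct.tmul_add, map_add, map_add, hx, hy]
  | tmul x y => simp

theorem tmul_eq_smul_one_tmul (c : K) (a : A) : c ⊗ₜ[k] a = c • ((1 : K) ⊗ₜ[k] a) := by
  rw [TensorProduct.smul_tmul', smul_eq_mul, mul_one]

theorem baseChange_ext {W : Type*} [AddCommGroup W] [Module K W] {f g : K ⊗[k] A →ₗ[K] W}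
    (h : ∀ a, f (1 ⊗ₜ a) = g (1 ⊗ₜ a)) (z : K ⊗[k] A) : f z = g z := by
  induction z with
  | zero => simp
  | add x y hx hy => rw [map_add, map_add, hx, hy]
  | tmul c a => rw [tmul_eq_smul_one_tmul, map_smul, map_smul, h]

theorem baseChange_ext₂ {W : Type*} [AddCommGroup W] [Module K W]
    {f g : K ⊗[k] A →ₗ[K] K ⊗[k] A →ₗ[K] W}
    (h : ∀ a b, f (1 ⊗ₜ a) (1 ⊗ₜ b) = g (1 ⊗ₜ a) (1 ⊗ₜ b)) (y z : K ⊗[k] A) : f y z = g y z := by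
  have : f y = g y := baseChange_ext K (fun a => LinearMap.ext fun z =>
    baseChange_ext K (fun b => h a b) z) y
  rw [this]

/-- The extension of scalars of a functional. -/
def functionalBaseChange (l : A →ₗ[k] k) : K ⊗[k] A →ₗ[K] K :=
  (TensorProduct.AlgebraTensorModule.rid k K K).toLinearMap ∘ₗ l.baseChange K

@[simp]
theorem functionalBaseChange_tmul (l : A →ₗ[k] k) (c : K) (a : A) :
    functionalBaseChange K l (c ⊗ₜ a) = l a • c := by
  simp [functionalBaseChange]

theorem rTensor_baseChangeTensor (P : A →ₗ[k] A) (t : A ⊗[k] A) :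
    (P.baseChange K).rTensor (K ⊗[k] A) (baseChangeTensor K t) =
      baseChangeTensor K (P.rTensor A t) := by
  induction t with
  | zero => simp
  | add x y hx hy => simp only [map_add, hx, hy]
  | tmul x y => simp

theorem lTensor_baseChangeTensor (P : A →ₗ[k] A) (t : A ⊗[k] A) :
    (P.baseChange K).lTensor (K ⊗[k] A) (baseChangeTensor K t) =
      baseChangeTensor K (P.lTensor A t) := by
  induction t with
  | zero => simp
  | add x y hx hy => simp only [map_add, hx, hy]
  | tmul x y => simp

theorem mul'_baseChangeTensor (t : A ⊗[k] A) :
    LinearMap.mul' K (K ⊗[k] A) (baseChangeTensor K t) = 1 ⊗ₜ LinearMap.mul' k A t := by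
  induction t with
  | zero => simp
  | add x y hx hy => simp only [map_add, hx, hy, TensorProduct.tmul_add]
  | tmul x y => simp

/-- Super Hopf algebras with a normalized integral are stable under extension of the base field. -/
theorem IsSuperHopf.baseChange [Coalgebra k A] {P S : A →ₗ[k] A} {l : A →ₗ[k] k}
    (H : IsSuperHopf P S l) :
    IsSuperHopf (P.baseChange K) (S.baseChange K) (functionalBaseChange K l) where
  odd_odd := baseChange_ext K (f := (P.baseChange K) ∘ₗ (P.baseChange K)) (g := P.baseChange K)
    fun a => by simp [H.odd_odd]
  odd_one := by simp [Algebra.TensorProduct.one_def, H.odd_one]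
  odd_mul := by
    let m := LinearMap.mul K (K ⊗[k] A)
    let Q := P.baseChange K
    refine baseChange_ext₂ K (f := m.compr₂ Q)
      (g := m.compl₁₂ Q (LinearMap.id - Q) + m.compl₁₂ (LinearMap.id - Q) Q) fun a b => ?_
    simp [m, Q, H.odd_mul, TensorProduct.tmul_add, ← TensorProduct.tmul_sub]
  even_comm := by
    let m := LinearMap.mul K (K ⊗[k] A)
    let Q := P.baseChange K
    refine baseChange_ext₂ K (f := m.compl₁₂ (LinearMap.id - Q) LinearMap.id)
      (g := m.flip.compl₁₂ (LinearMap.id - Q) LinearMap.id) fun a b => ?_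
    simp [m, Q, ← TensorProduct.tmul_sub, H.even_comm]
  anticomm := by
    let m := LinearMap.mul K (K ⊗[k] A)
    let Q := P.baseChange K
    refine baseChange_ext₂ K (f := m.compl₁₂ Q Q) (g := -(m.flip.compl₁₂ Q Q)) fun a b => ?_
    simp only [m, Q, LinearMap.compl₁₂_apply, LinearMap.mul_apply', LinearMap.baseChange_tmul,
      Algebra.TensorProduct.tmul_mul_tmul, LinearMap.neg_apply, LinearMap.flip_apply]
    rw [H.anticomm, TensorProduct.tmul_neg]
  comul_odd := by
    let Q := P.baseChange K
    refine baseChange_ext K (f := comul ∘ₗ Q) (g := (Q.rTensor (K ⊗[k] A) + Q.lTensor (K ⊗[k] A) -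
      (2 : K) • TensorProduct.map Q Q) ∘ₗ comul) fun a => ?_
    have h2 : ∀ t : A ⊗[k] A, (2 : K) • baseChangeTensor K t = baseChangeTensor K ((2 : k) • t) :=
      fun t => by rw [two_smul, two_smul, map_add]
    have h3 : ∀ t : A ⊗[k] A, TensorProduct.map Q Q (baseChangeTensor K t) =
        baseChangeTensor K (TensorProduct.map P P t) := fun t => by
      rw [← LinearMap.rTensor_comp_lTensor, ← LinearMap.rTensor_comp_lTensor,
        LinearMap.comp_apply, LinearMap.comp_apply, lTensor_baseChangeTensor,
        rTensor_baseChangeTensor]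
    simp only [LinearMap.comp_apply, LinearMap.sub_apply, LinearMap.add_apply,
      LinearMap.smul_apply, Q, LinearMap.baseChange_tmul, comul_one_tmul,
      rTensor_baseChangeTensor, lTensor_baseChangeTensor] at h3 ⊢
    rw [h3, h2, H.comul_odd, map_sub, map_add]
  counit_odd := baseChange_ext K (f := counit ∘ₗ P.baseChange K) (g := 0)
    fun a => by simp [H.counit_odd]
  antipode_odd := baseChange_ext K (f := S.baseChange K ∘ₗ P.baseChange K)
    (g := P.baseChange K ∘ₗ S.baseChange K) fun a => by simp [H.antipode_odd]
  counit_one := by simp [Algebra.TensorProduct.one_def, H.counit_one]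
  counit_mul := by
    let m := LinearMap.mul K (K ⊗[k] A)
    refine baseChange_ext₂ K (f := m.compr₂ counit)
      (g := (LinearMap.mul K K).compl₁₂ counit counit) fun a b => ?_
    simp [m, H.counit_mul, Algebra.smul_def]
  comul_one := by
    rw [Algebra.TensorProduct.one_def, comul_one_tmul, H.comul_one, baseChangeTensor_tmul]
  comul_mul := by
    let m := LinearMap.mul K (K ⊗[k] A)
    let M := LinearMap.mul K ((K ⊗[k] A) ⊗[K] (K ⊗[k] A))
    let Q := P.baseChange K
    let g₁ : K ⊗[k] A →ₗ[K] K ⊗[k] A →ₗ[K] (K ⊗[k] A) ⊗[K] (K ⊗[k] A) := M.compl₁₂ comul comul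
    let g₂ : K ⊗[k] A →ₗ[K] K ⊗[k] A →ₗ[K] (K ⊗[k] A) ⊗[K] (K ⊗[k] A) :=
      M.compl₁₂ (Q.lTensor (K ⊗[k] A) ∘ₗ comul) (Q.rTensor (K ⊗[k] A) ∘ₗ comul)
    intro y z
    rw [sub_eq_add_neg, ← neg_smul]
    refine baseChange_ext₂ K (f := m.compr₂ comul) (g := g₁ + (-2 : K) • g₂) (fun a b => ?_) y z
    have h2 : ∀ t : A ⊗[k] A, (2 : K) • baseChangeTensor K t = baseChangeTensor K ((2 : k) • t) :=
      fun t => by rw [two_smul, two_smul, map_add]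
    simp only [m, g₁, g₂, M, Q, LinearMap.compr₂_apply, LinearMap.mul_apply', LinearMap.add_apply,
      LinearMap.smul_apply, LinearMap.compl₁₂_apply, LinearMap.comp_apply, comul_one_tmul,
      Algebra.TensorProduct.tmul_mul_tmul, mul_one, rTensor_baseChangeTensor,
      lTensor_baseChangeTensor, ← map_mul, neg_smul, h2, ← map_neg, ← map_add, H.comul_mul,
      sub_eq_add_neg]
  antipode_left := by
    refine baseChange_ext K (f := LinearMap.mul' K (K ⊗[k] A) ∘ₗ
      (S.baseChange K).rTensor (K ⊗[k] A) ∘ₗ comul)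
      (g := Algebra.linearMap K (K ⊗[k] A) ∘ₗ counit) fun a => ?_
    simp only [LinearMap.comp_apply, comul_one_tmul, rTensor_baseChangeTensor,
      mul'_baseChangeTensor, H.antipode_left, TensorProduct.counit_tmul]
    simp [Algebra.algebraMap_eq_smul_one, Algebra.TensorProduct.one_def]
  antipode_right := by
    refine baseChange_ext K (f := LinearMap.mul' K (K ⊗[k] A) ∘ₗ
      (S.baseChange K).lTensor (K ⊗[k] A) ∘ₗ comul)
      (g := Algebra.linearMap K (K ⊗[k] A) ∘ₗ counit) fun a => ?_
    simp only [LinearMap.comp_apply, comul_one_tmul, lTensor_baseChangeTensor,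
      mul'_baseChangeTensor, H.antipode_right, TensorProduct.counit_tmul]
    simp [Algebra.algebraMap_eq_smul_one, Algebra.TensorProduct.one_def]
  integral_one := by simp [Algebra.TensorProduct.one_def, H.integral_one]
  integral_comul := by
    refine baseChange_ext K (f := (TensorProduct.lid K (K ⊗[k] A)).toLinearMap ∘ₗ
      (functionalBaseChange K l).rTensor (K ⊗[k] A) ∘ₗ comul)
      (g := Algebra.linearMap K (K ⊗[k] A) ∘ₗ functionalBaseChange K l) fun a => ?_
    have h : ∀ t : A ⊗[k] A, TensorProduct.lid K (K ⊗[k] A)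
        ((functionalBaseChange K l).rTensor (K ⊗[k] A) (baseChangeTensor K t)) =
        1 ⊗ₜ TensorProduct.lid k A (l.rTensor A t) := by
      intro t
      induction t with
      | zero => simp
      | add x y hx hy => simp only [map_add, hx, hy, TensorProduct.tmul_add]
      | tmul x y => simp
    simp only [LinearMap.comp_apply, comul_one_tmul, LinearEquiv.coe_coe, h, H.integral_comul]
    simp [Algebra.algebraMap_eq_smul_one, Algebra.TensorProduct.one_def]

/-- In odd characteristic, a super-commutative super Hopf algebra with a normalized integral is
purely even. -/
theorem IsSuperHopf.purelyEven [Coalgebra k A] {P S : A →ₗ[k] A} {l : A →ₗ[k] k}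
    (H : IsSuperHopf P S l) {p : ℕ} [Fact p.Prime] [CharP k p] (h2 : 2 < p) (a : A) : P a = 0 := by
  have : CharP (AlgebraicClosure k) p :=
    charP_of_injective_algebraMap (algebraMap k (AlgebraicClosure k)).injective p
  have h := (H.baseChange (AlgebraicClosure k)).odd_eq_zero h2 (1 ⊗ₜ a)
  rw [LinearMap.baseChange_tmul] at h
  have hinj := Algebra.TensorProduct.includeRight_injective (R := k) (A := AlgebraicClosure k)
    (B := A) (algebraMap k (AlgebraicClosure k)).injective
  exact hinj (by simpa using h)

end BaseChange

/-! ### From linear reductivity to an integral -/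

section Conversion

variable {k : Type u} [Field k] {A : Type v} [Ring A] [Algebra k A]
  (𝒜 : ZMod 2 → Submodule k A) [GradedAlgebra 𝒜]

/-- The projection onto the odd part. -/
abbrev oddProj : A →ₗ[k] A := GradedAlgebra.proj 𝒜 1

variable {𝒜}

theorem oddProj_of_odd {a : A} (ha : a ∈ 𝒜 1) : oddProj 𝒜 a = a :=
  DirectSum.decompose_of_mem_same 𝒜 ha

theorem oddProj_of_even {a : A} (ha : a ∈ 𝒜 0) : oddProj 𝒜 a = 0 :=
  DirectSum.decompose_of_mem_ne 𝒜 ha (by decide)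

variable (𝒜)

theorem oddProj_mem (a : A) : oddProj 𝒜 a ∈ 𝒜 1 := SetLike.coe_mem _

theorem sub_oddProj_mem (a : A) : a - oddProj 𝒜 a ∈ 𝒜 0 := by
  induction a using DirectSum.Decomposition.inductionOn 𝒜 with
  | zero => simp
  | @homogeneous i m =>
    obtain ⟨m, hm⟩ := m
    fin_cases i
    · change m - oddProj 𝒜 m ∈ 𝒜 0
      rw [oddProj_of_even hm, sub_zero]
      exact hm
    · change m - oddProj 𝒜 m ∈ 𝒜 0
      rw [oddProj_of_odd hm, sub_self]
      exact zero_mem _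
  | add m m' h h' =>
    rw [map_add, add_sub_add_comm]
    exact add_mem h h'

theorem exists_even_odd (a : A) : ∃ a₀ ∈ 𝒜 0, ∃ a₁ ∈ 𝒜 1, a = a₀ + a₁ :=
  ⟨_, sub_oddProj_mem 𝒜 a, _, oddProj_mem 𝒜 a, by simp⟩

theorem one_mem_even : (1 : A) ∈ 𝒜 0 := SetLike.one_mem_graded 𝒜

theorem oddProj_mul (a b : A) : oddProj 𝒜 (a * b) =
    oddProj 𝒜 a * (b - oddProj 𝒜 b) + (a - oddProj 𝒜 a) * oddProj 𝒜 b := by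
  obtain ⟨a₀, ha₀, a₁, ha₁, rfl⟩ := exists_even_odd 𝒜 a
  obtain ⟨b₀, hb₀, b₁, hb₁, rfl⟩ := exists_even_odd 𝒜 b
  have h00 : a₀ * b₀ ∈ 𝒜 0 := SetLike.mul_mem_graded ha₀ hb₀
  have h01 : a₀ * b₁ ∈ 𝒜 1 := SetLike.mul_mem_graded ha₀ hb₁
  have h10 : a₁ * b₀ ∈ 𝒜 1 := SetLike.mul_mem_graded ha₁ hb₀
  have h11 : a₁ * b₁ ∈ 𝒜 0 := SetLike.mul_mem_graded ha₁ hb₁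
  rw [add_mul, mul_add, mul_add]
  simp only [map_add, oddProj_of_even ha₀, oddProj_of_even hb₀, oddProj_of_odd ha₁,
    oddProj_of_odd hb₁, oddProj_of_even h00, oddProj_of_odd h01, oddProj_of_odd h10,
    oddProj_of_even h11]
  simp [add_comm]

/-- The multiplication of the graded tensor product, in terms of the usual one. -/
theorem of_mul_of (t s : A ⊗[k] A) :
    GradedTensorProduct.of k 𝒜 𝒜 t * GradedTensorProduct.of k 𝒜 𝒜 s =
      GradedTensorProduct.of k 𝒜 𝒜
        (t * s - (2 : k) • ((oddProj 𝒜).lTensor A t * (oddProj 𝒜).rTensor A s)) := by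
  induction t with
  | zero => simp
  | add t t' h h' =>
    rw [map_add, add_mul, h, h', ← map_add, map_add (LinearMap.lTensor A _), add_mul, add_mul,
      smul_add, add_sub_add_comm]
  | tmul x y =>
  induction s with
  | zero => simp
  | add t t' h h' =>
    rw [map_add, mul_add, h, h', ← map_add, map_add (LinearMap.rTensor A _), mul_add, mul_add,
      smul_add, add_sub_add_comm]
  | tmul z w =>
  have h := fun (i j : ZMod 2) (y : 𝒜 j) (z : 𝒜 i) =>
    GradedTensorProduct.tmul_coe_mul_coe_tmul 𝒜 𝒜 x y z w
  obtain ⟨y₀, hy₀, y₁, hy₁, rfl⟩ := exists_even_odd 𝒜 y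
  obtain ⟨z₀, hz₀, z₁, hz₁, rfl⟩ := exists_even_odd 𝒜 z
  have h00 := h 0 0 ⟨y₀, hy₀⟩ ⟨z₀, hz₀⟩
  have h01 := h 0 1 ⟨y₁, hy₁⟩ ⟨z₀, hz₀⟩
  have h10 := h 1 0 ⟨y₀, hy₀⟩ ⟨z₁, hz₁⟩
  have h11 := h 1 1 ⟨y₁, hy₁⟩ ⟨z₁, hz₁⟩
  simp only [mul_zero, mul_one, uzpow_zero, uzpow_one, one_smul, Units.neg_smul]
    at h00 h01 h10 h11
  simp only [LinearMap.lTensor_tmul, LinearMap.rTensor_tmul, map_add, oddProj_of_even hy₀,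
    oddProj_of_odd hy₁, oddProj_of_even hz₀, oddProj_of_odd hz₁,
    Algebra.TensorProduct.tmul_mul_tmul, TensorProduct.tmul_add, TensorProduct.add_tmul,
    mul_add, add_mul, h00, h01, h10, h11, map_sub, two_smul, mul_zero,
    zero_mul, TensorProduct.zero_tmul, TensorProduct.tmul_zero, map_zero]
  abel

omit [GradedAlgebra 𝒜] in
theorem tensorGrading_le {U : Submodule k (A ⊗[k] A)}
    {i : ZMod 2} (h : ∀ j l : ZMod 2, j + l = i → ∀ a ∈ 𝒜 j, ∀ b ∈ 𝒜 l, a ⊗ₜ[k] b ∈ U) :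
    tensorGrading 𝒜 𝒜 i ≤ U :=
  iSup_le fun j => iSup_le fun l => iSup_le fun hjl => Submodule.map₂_le.2 (h j l hjl)

variable [Coalgebra k A]

/-- For a linearly reductive super affine group the coordinate algebra has a normalized integral:
the projection onto `k 1` along a complementary subcomodule of the regular comodule. -/
theorem exists_integral [IsSuperBialgebra 𝒜] (hG : IsLinearlyReductive 𝒜) :
    ∃ l : A →ₗ[k] k, l 1 = 1 ∧ ∀ a, TensorProduct.lid k A (l.rTensor A (comul a)) =
      algebraMap k A (l a) := by
  have hone : comul (R := k) (1 : A) = 1 ⊗ₜ 1 := IsSuperBialgebra.comul_one (𝒜 := 𝒜)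
  have hcom : IsSuperComodule 𝒜 𝒜 (comul (R := k) (A := A)) :=
    { coassoc := Coalgebra.coassoc
      counit := by ext a; simp
      map_mem := IsSuperBialgebra.comul_mem }
  have hsub : IsSuperSubcomodule 𝒜 (comul (R := k) (A := A)) (k ∙ (1 : A)) := by
    refine ⟨?_, ?_⟩
    · have h1 : (k ∙ (1 : A)) ≤ 𝒜 0 :=
        (Submodule.span_singleton_le_iff_mem _ _).2 (one_mem_even 𝒜)
      rw [inf_eq_left.2 h1, left_eq_sup]
      exact inf_le_left
    · intro x hx
      obtain ⟨c, rfl⟩ := Submodule.mem_span_singleton.1 hx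
      refine ⟨(⟨c • 1, hx⟩ : k ∙ (1 : A)) ⊗ₜ 1, ?_⟩
      rw [map_smul, hone, LinearMap.rTensor_tmul, TensorProduct.smul_tmul']
      rfl
  obtain ⟨W', hW', hc⟩ := hG A 𝒜 comul hcom _ hsub
  have h1 : (1 : A) ∉ W' := by
    intro h
    have h0 : (1 : A) = 0 := Submodule.disjoint_def.1 hc.disjoint 1
      (Submodule.mem_span_singleton_self 1) h
    have := IsSuperBialgebra.counit_one (k := k) (𝒜 := 𝒜)
    rw [h0, map_zero] at this
    exact zero_ne_one this
  obtain ⟨f, hf1, hf⟩ := Submodule.exists_le_ker_of_notMem h1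
  have hl : ∀ w ∈ W', f w = 0 := fun w hw => hf hw
  refine ⟨(f 1)⁻¹ • f, by simp [hf1], fun a => ?_⟩
  obtain ⟨y, hy, w, hw, rfl⟩ := Submodule.mem_sup.1 (hc.sup_eq_top ▸ Submodule.mem_top (x := a))
  obtain ⟨c, rfl⟩ := Submodule.mem_span_singleton.1 hy
  obtain ⟨t, ht⟩ := hW'.map_mem w hw
  have h0 : ((f 1)⁻¹ • f).rTensor A (comul (R := k) w) = 0 := by
    rw [← ht, ← LinearMap.comp_apply, ← LinearMap.rTensor_comp]
    have : ((f 1)⁻¹ • f) ∘ₗ W'.subtype = 0 := by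
      ext w'
      simp [hl w' w'.2]
    rw [this, LinearMap.rTensor_zero, LinearMap.zero_apply]
  rw [map_add, map_add, h0, map_smul, hone]
  simp only [LinearMap.rTensor_tmul, map_smul, LinearMap.smul_apply, smul_eq_mul,
    TensorProduct.lid_tmul, map_add, hl w hw, Algebra.algebraMap_eq_smul_one, mul_zero,
    add_zero, smul_smul]

/-- The coordinate algebra of a linearly reductive super affine group as a super Hopf algebra with
a normalized integral. -/
theorem exists_isSuperHopf [IsSuperHopfAlgebra 𝒜] [IsSuperCommutative 𝒜]
    (hG : IsLinearlyReductive 𝒜) : ∃ (S : A →ₗ[k] A) (l : A →ₗ[k] k),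
      IsSuperHopf (oddProj 𝒜) S l := by
  obtain ⟨l, hl1, hl⟩ := exists_integral 𝒜 hG
  obtain ⟨S, hSmem, hSl, hSr⟩ := IsSuperHopfAlgebra.exists_antipode (k := k) (𝒜 := 𝒜)
  have hcomm := IsSuperCommutative.mul_comm_of_even (𝒜 := 𝒜)
  have hanti := IsSuperCommutative.mul_anticomm_of_odd (𝒜 := 𝒜)
  refine ⟨S, l, ?_⟩
  constructor
  case odd_odd => exact fun a => oddProj_of_odd (oddProj_mem 𝒜 a)
  case odd_one => exact oddProj_of_even (one_mem_even 𝒜)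
  case odd_mul => exact oddProj_mul 𝒜
  case even_comm => exact fun a b => hcomm _ (sub_oddProj_mem 𝒜 a) b
  case anticomm => exact fun a b => hanti _ (oddProj_mem 𝒜 a) _ (oddProj_mem 𝒜 b)
  case comul_odd =>
    -- the projection of `A ⊗ A` onto its odd part
    let F : A ⊗[k] A →ₗ[k] A ⊗[k] A := (oddProj 𝒜).rTensor A + (oddProj 𝒜).lTensor A
      - (2 : k) • TensorProduct.map (oddProj 𝒜) (oddProj 𝒜)
    have h0 : tensorGrading 𝒜 𝒜 0 ≤ LinearMap.ker F := by
      refine tensorGrading_le 𝒜 fun j l hjl a ha b hb => ?_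
      rw [LinearMap.mem_ker]
      have : (j = 0 ∧ l = 0) ∨ (j = 1 ∧ l = 1) := by
        clear ha hb; revert j l; decide
      obtain ⟨rfl, rfl⟩ | ⟨rfl, rfl⟩ := this
      · simp [F, oddProj_of_even ha, oddProj_of_even hb, -GradedAlgebra.proj_apply]
      · simp [F, oddProj_of_odd ha, oddProj_of_odd hb, two_smul, -GradedAlgebra.proj_apply]
    have h1 : tensorGrading 𝒜 𝒜 1 ≤ LinearMap.ker (F - LinearMap.id) := by
      refine tensorGrading_le 𝒜 fun j l hjl a ha b hb => ?_
      rw [LinearMap.mem_ker]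
      have : (j = 0 ∧ l = 1) ∨ (j = 1 ∧ l = 0) := by
        clear ha hb; revert j l; decide
      obtain ⟨rfl, rfl⟩ | ⟨rfl, rfl⟩ := this
      · simp [F, oddProj_of_even ha, oddProj_of_odd hb, -GradedAlgebra.proj_apply]
      · simp [F, oddProj_of_odd ha, oddProj_of_even hb, -GradedAlgebra.proj_apply]
    intro a
    change comul (R := k) (oddProj 𝒜 a) = F (comul a)
    obtain ⟨a₀, ha₀, a₁, ha₁, rfl⟩ := exists_even_odd 𝒜 a
    have e0 : F (comul (R := k) a₀) = 0 := h0 (IsSuperBialgebra.comul_mem 0 a₀ ha₀)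
    have e1 : F (comul (R := k) a₁) - comul (R := k) a₁ = 0 :=
      h1 (IsSuperBialgebra.comul_mem 1 a₁ ha₁)
    rw [map_add, oddProj_of_even ha₀, oddProj_of_odd ha₁, zero_add, map_add, map_add, e0,
      sub_eq_zero.1 e1, zero_add]
  case counit_odd =>
    exact fun a => IsSuperBialgebra.counit_odd (𝒜 := 𝒜) _ (oddProj_mem 𝒜 a)
  case antipode_odd =>
    intro a
    obtain ⟨a₀, ha₀, a₁, ha₁, rfl⟩ := exists_even_odd 𝒜 a
    rw [map_add, map_add, map_add, map_add, oddProj_of_even ha₀, oddProj_of_odd ha₁, map_zero,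
      oddProj_of_even (hSmem 0 a₀ ha₀), oddProj_of_odd (hSmem 1 a₁ ha₁)]
  case counit_one => exact IsSuperBialgebra.counit_one (𝒜 := 𝒜)
  case counit_mul => exact IsSuperBialgebra.counit_mul (𝒜 := 𝒜)
  case comul_one => exact IsSuperBialgebra.comul_one (𝒜 := 𝒜)
  case comul_mul =>
    intro a b
    apply (GradedTensorProduct.of k 𝒜 𝒜).injective
    rw [← of_mul_of]
    exact IsSuperBialgebra.comul_mul a b
  case antipode_left => exact LinearMap.congr_fun hSl
  case antipode_right => exact LinearMap.congr_fun hSr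
  case integral_one => exact hl1
  case integral_comul => exact hl

end Conversion

/-! ### The antipode of a commutative Hopf algebra -/

section RightInvariance

variable {k : Type*} [Field k] {A : Type*} [AddCommGroup A] [Module k A] [Coalgebra k A]

/-- The operators `leftConv x` are right invariant. -/
theorem comul_leftConv (x : A →ₗ[k] k) (a : A) :
    comul (R := k) (leftConv x a) = (leftConv x).rTensor A (comul a) := by
  refine eq_of_rid_lTensor fun φ => ?_
  rw [← rightConv_apply, ← rightConv_leftConv, rightConv_apply]
  generalize comul (R := k) a = t
  induction t with
  | zero => simp
  | add s t hs ht => simp only [map_add, hs, ht]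
  | tmul b c => simp

end RightInvariance

section CommHopf

open HopfAlgebra

variable {k : Type*} [Field k] {A : Type*} [CommRing A] [HopfAlgebra k A]

/-- The antipode of a commutative Hopf algebra is an anti-homomorphism of coalgebras: both sides are
the convolution inverse of the coproduct in the group of algebra maps `A → A ⊗ A`. -/
theorem comul_antipode (a : A) : comul (R := k) (antipode k a) =
    TensorProduct.map (antipode k) (antipode k) (TensorProduct.comm k A A (comul a)) := by
  let i₁ : WithConv (A →ₐ[k] A ⊗[k] A) := .toConv Algebra.TensorProduct.includeLeft
  let i₂ : WithConv (A →ₐ[k] A ⊗[k] A) := .toConv Algebra.TensorProduct.includeRight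
  let d : WithConv (A →ₐ[k] A ⊗[k] A) := .toConv (Bialgebra.comulAlgHom k A)
  have hd : d = i₁ * i₂ := by
    rw [AlgHom.convMul_def]
    have : (Algebra.TensorProduct.lmul' k).comp
        (Algebra.TensorProduct.map i₁.ofConv i₂.ofConv) = AlgHom.id k (A ⊗[k] A) := by
      ext <;> simp [i₁, i₂]
    rw [← AlgHom.comp_assoc, this, AlgHom.id_comp]
  have hinv : d⁻¹ = i₂⁻¹ * i₁⁻¹ := by
    rw [hd]
    exact mul_inv_rev i₁ i₂
  rw [AlgHom.convMul_def] at hinv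
  have h := congrArg (fun f : WithConv (A →ₐ[k] A ⊗[k] A) => f.ofConv a) hinv
  change comul (R := k) (antipode k a) = Algebra.TensorProduct.lmul' k
    (Algebra.TensorProduct.map (i₂⁻¹).ofConv (i₁⁻¹).ofConv (comul (R := k) a)) at h
  rw [h]
  generalize comul (R := k) a = t
  induction t with
  | zero => simp
  | add s t hs ht => simp only [map_add, hs, ht]
  | tmul b c =>
    rw [Algebra.TensorProduct.map_tmul, Algebra.TensorProduct.lmul'_apply_tmul]
    change ((1 : A) ⊗ₜ[k] antipode k b) * (antipode k c ⊗ₜ[k] (1 : A)) = _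
    simp

theorem antipode_antipode (a : A) : antipode k (antipode k a) = a := by
  have h := inv_inv (WithConv.toConv (AlgHom.id k A))
  exact congrArg (fun f : WithConv (A →ₐ[k] A) => f.ofConv a) h

theorem leftConv_antipode (x : A →ₗ[k] k) (a : A) :
    leftConv x (antipode k a) = antipode k (rightConv (x ∘ₗ antipode k) a) := by
  rw [leftConv_apply, comul_antipode, rightConv_apply]
  generalize comul (R := k) a = t
  induction t with
  | zero => simp
  | add s t hs ht => simp only [map_add, hs, ht]
  | tmul b c => simp

theorem sum_antipode_leftConv_mul (f : A →ₗ[k] k) (a : A) :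
    LinearMap.mul' k A ((antipode k ∘ₗ leftConv f).rTensor A (comul (R := k) a)) =
      algebraMap k A (f a) := by
  rw [LinearMap.rTensor_comp, LinearMap.comp_apply, ← comul_leftConv,
    mul_antipode_rTensor_comul_apply, counit_leftConv]

/-- A right-invariant functional `r` makes left and right translations adjoint for the form
`(v, a) ↦ r (v S(a))`. -/
theorem integral_adjoint {r : A →ₗ[k] k} (hr : ∀ a, rightConv r a = algebraMap k A (r a))
    (y : A →ₗ[k] k) (v a : A) :
    r (v * antipode k (rightConv y a)) = r (leftConv y v * antipode k a) := by
  let f : A → A →ₗ[k] k := fun q => r ∘ₗ LinearMap.mulLeft k q ∘ₗ antipode k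
  -- right invariance of `r` at the element `v S(a')`
  have h1 : ∀ a', ∑ i ∈ (ℛ k v).index, (ℛ k v).left i *
      antipode k (leftConv (f ((ℛ k v).right i)) a') = algebraMap k A (f v a') := by
    intro a'
    have h := hr (v * antipode k a')
    rw [rightConv_apply, Bialgebra.comul_mul, comul_antipode, ← (ℛ k v).eq, Finset.sum_mul,
      map_sum, map_sum] at h
    refine Eq.trans (Finset.sum_congr rfl fun i _ => ?_) h
    rw [leftConv_apply]
    generalize comul (R := k) a' = t
    induction t with
    | zero => simp
    | add s t hs ht => simp only [map_add, mul_add, hs, ht]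
    | tmul b c => simp [f]
  -- cancel the antipode in `h1` by `sum_antipode_leftConv_mul`
  have h2 : leftConv (f v) a = ∑ i ∈ (ℛ k v).index, f ((ℛ k v).right i) a • (ℛ k v).left i := by
    have e1 : ∀ t : A ⊗[k] A, TensorProduct.lid k A ((f v).rTensor A t) =
        ∑ i ∈ (ℛ k v).index, LinearMap.mul' k A ((LinearMap.mulLeft k ((ℛ k v).left i) ∘ₗ
          (antipode k ∘ₗ leftConv (f ((ℛ k v).right i)))).rTensor A t) := by
      intro t
      induction t with
      | zero => simp
      | add s t hs ht => simp only [map_add, hs, ht, Finset.sum_add_distrib]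
      | tmul b c =>
        simp only [LinearMap.rTensor_tmul, TensorProduct.lid_tmul,
          LinearMap.comp_apply, LinearMap.mulLeft_apply, LinearMap.mul'_apply,
          ← Finset.sum_mul, h1, ← Algebra.smul_def]
    have e2 : ∀ (q : A) (T : A →ₗ[k] A) (t : A ⊗[k] A), LinearMap.mul' k A
        ((LinearMap.mulLeft k q ∘ₗ T).rTensor A t) = q * LinearMap.mul' k A (T.rTensor A t) := by
      intro q T t
      induction t with
      | zero => simp
      | add s t hs ht => simp only [map_add, mul_add, hs, ht]
      | tmul b c => simp [mul_assoc]
    rw [leftConv_apply, e1]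
    refine Finset.sum_congr rfl fun i _ => ?_
    rw [e2, sum_antipode_leftConv_mul, Algebra.smul_def, mul_comm]
  have h3 := congrArg y h2
  rw [leftConv_eq_sum (f v) (ℛ k a)] at h3
  rw [leftConv_eq_sum y (ℛ k v), rightConv_eq_sum y (ℛ k a)]
  simp only [map_sum, map_smul, smul_eq_mul, Finset.sum_mul, Finset.mul_sum, mul_smul_comm,
    smul_mul_assoc, f, LinearMap.comp_apply, LinearMap.mulLeft_apply] at h3 ⊢
  rw [Finset.sum_congr rfl fun i _ => mul_comm (y ((ℛ k a).right i)) _,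
    Finset.sum_congr rfl fun i _ => mul_comm (y ((ℛ k v).left i)) _]
  exact h3

/-- A commutative Hopf algebra with a normalized integral is a super Hopf algebra with zero odd
part. -/
theorem isSuperHopf_of_comm {l : A →ₗ[k] k} (hl1 : l 1 = 1)
    (hl : ∀ a, leftConv l a = algebraMap k A (l a)) :
    IsSuperHopf (0 : A →ₗ[k] A) (antipode k) l where
  odd_odd _ := rfl
  odd_one := rfl
  odd_mul a b := by simp
  even_comm a b := mul_comm _ _
  anticomm a b := by simp
  comul_odd a := by simp
  counit_odd a := by simp
  antipode_odd a := by simp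
  counit_one := Bialgebra.counit_one
  counit_mul := Bialgebra.counit_mul
  comul_one := Bialgebra.comul_one
  comul_mul a b := by simp
  antipode_left a := mul_antipode_rTensor_comul_apply a
  antipode_right a := mul_antipode_lTensor_comul_apply a
  integral_one := hl1
  integral_comul := hl

/-- The antipode turns the integral into a right-invariant one. -/
theorem rightConv_integral_comp_antipode {l : A →ₗ[k] k}
    (hl : ∀ a, leftConv l a = algebraMap k A (l a)) (a : A) :
    rightConv (l ∘ₗ antipode k) a = algebraMap k A ((l ∘ₗ antipode k) a) := by
  rw [← antipode_antipode (k := k) (rightConv _ a), ← leftConv_antipode, hl,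
    Algebra.algebraMap_eq_smul_one, map_smul, antipode_one, Algebra.algebraMap_eq_smul_one]
  rfl

end CommHopf

/-! ### Averaging over a commutative Hopf algebra -/

section Averaging

open HopfAlgebra

variable {k : Type*} [Field k] {A : Type*} [CommRing A] [HopfAlgebra k A]

theorem apply_leftConv (x y : A →ₗ[k] k) (a : A) : x (leftConv y a) = y (rightConv x a) := by
  rw [← counit_rightConv x (leftConv y a), ← rightConv_leftConv, counit_leftConv]

/-- The map `v ⊗ b ↦ ∑ v₁ r (v₂ S(b))`. -/
def averageTensor (r : A →ₗ[k] k) : A ⊗[k] A →ₗ[k] A :=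
  (TensorProduct.rid k A).toLinearMap ∘ₗ (r ∘ₗ LinearMap.mul' k A).lTensor A ∘ₗ
    (TensorProduct.assoc k A A A).toLinearMap ∘ₗ TensorProduct.map comul (antipode k)

theorem averageTensor_tmul (r : A →ₗ[k] k) (v b : A) :
    averageTensor r (v ⊗ₜ b) = rightConv (r ∘ₗ LinearMap.mulRight k (antipode k b)) v := by
  simp only [averageTensor, LinearMap.comp_apply, TensorProduct.map_tmul, rightConv_apply,
    LinearEquiv.coe_coe]
  generalize comul (R := k) v = t
  induction t with
  | zero => simp
  | add s t hs ht => simp only [TensorProduct.add_tmul, map_add, hs, ht]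
  | tmul b c => simp

theorem averageTensor_comul {r : A →ₗ[k] k} (hr1 : r 1 = 1) (a : A) :
    averageTensor r (comul a) = a := by
  have h : ∀ t : A ⊗[k] A, averageTensor r t = TensorProduct.rid k A
      ((r ∘ₗ LinearMap.mul' k A ∘ₗ (antipode k).lTensor A).lTensor A
        (TensorProduct.assoc k A A A (comul.rTensor A t))) := by
    intro t
    induction t with
    | zero => simp
    | add s t hs ht => simp only [map_add, hs, ht]
    | tmul b c =>
      simp only [averageTensor, LinearMap.comp_apply, TensorProduct.map_tmul, LinearEquiv.coe_coe,
        LinearMap.rTensor_tmul]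
      generalize comul (R := k) b = t
      induction t with
      | zero => simp
      | add s t hs ht => simp only [TensorProduct.add_tmul, map_add, hs, ht]
      | tmul b c => simp
  have h2 : (r ∘ₗ LinearMap.mul' k A ∘ₗ (antipode k).lTensor A) ∘ₗ comul = counit := by
    ext a
    simp [Algebra.algebraMap_eq_smul_one, hr1]
  rw [h, coassoc_apply, ← LinearMap.comp_apply (LinearMap.lTensor _ _), ← LinearMap.lTensor_comp,
    h2, lTensor_counit_comul, TensorProduct.rid_tmul, one_smul]

/-- Averaging is equivariant for translations of the second tensor factor, by adjointness of left
and right translations under the integral. -/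
theorem averageTensor_rightConv {r : A →ₗ[k] k} (hr : ∀ a, rightConv r a = algebraMap k A (r a))
    (y : A →ₗ[k] k) (t : A ⊗[k] A) :
    averageTensor r ((rightConv y).lTensor A t) = rightConv y (averageTensor r t) := by
  induction t with
  | zero => simp
  | add s t hs ht => simp only [map_add, hs, ht]
  | tmul v b =>
    have : r ∘ₗ LinearMap.mulRight k (antipode k (rightConv y b)) =
        y ∘ₗ rightConv (r ∘ₗ LinearMap.mulRight k (antipode k b)) := by
      ext v
      rw [LinearMap.comp_apply y, ← apply_leftConv]
      simp [integral_adjoint hr]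
    rw [LinearMap.lTensor_tmul, averageTensor_tmul, averageTensor_tmul, this, ← rightConv_comp]
    rfl

/-- Complete reducibility: averaging a linear projection onto a subcomodule against the integral
gives a projection which is a map of comodules. -/
theorem exists_invariant_projection {r : A →ₗ[k] k} (hr1 : r 1 = 1)
    (hr : ∀ a, rightConv r a = algebraMap k A (r a)) {U : Submodule k A}
    (hU : ∀ y : A →ₗ[k] k, ∀ a ∈ U, rightConv y a ∈ U) :
    ∃ T : A →ₗ[k] A, (∀ a, T a ∈ U) ∧ (∀ a ∈ U, T a = a) ∧
      ∀ (y : A →ₗ[k] k) (a : A), T (rightConv y a) = rightConv y (T a) := by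
  obtain ⟨q, hq⟩ := U.subtype.exists_leftInverse_of_injective (Submodule.ker_subtype U)
  let Q : A →ₗ[k] A := U.subtype ∘ₗ q
  have hQU : ∀ a, Q a ∈ U := fun a => (q a).2
  have hQ : ∀ a ∈ U, Q a = a := fun a ha => by
    have := LinearMap.congr_fun hq ⟨a, ha⟩
    exact congrArg Subtype.val this
  refine ⟨averageTensor r ∘ₗ Q.rTensor A ∘ₗ comul, fun a => ?_, fun a ha => ?_, fun y a => ?_⟩
  · rw [LinearMap.comp_apply, LinearMap.comp_apply]
    generalize comul (R := k) a = t
    induction t with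
    | zero => simp
    | add s t hs ht => simpa only [map_add] using add_mem hs ht
    | tmul b c =>
      rw [LinearMap.rTensor_tmul, averageTensor_tmul]
      exact hU _ _ (hQU b)
  · have h : comul (R := k) a ∈ LinearMap.range (U.subtype.rTensor A) :=
      mem_range_rTensor_subtype fun φ => hU φ a ha
    obtain ⟨t, ht⟩ := h
    have hQc : Q.rTensor A (comul (R := k) a) = comul a := by
      rw [← ht, ← LinearMap.comp_apply, ← LinearMap.rTensor_comp]
      congr 2
      ext u
      exact hQ u u.2
    rw [LinearMap.comp_apply, LinearMap.comp_apply, hQc, averageTensor_comul hr1]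
  · rw [LinearMap.comp_apply, LinearMap.comp_apply, isLeftInvariant_rightConv y a,
      ← LinearMap.comp_apply (LinearMap.rTensor _ _), LinearMap.rTensor_comp_lTensor,
      ← LinearMap.lTensor_comp_rTensor, LinearMap.comp_apply, averageTensor_rightConv hr]
    rfl

/-- The adjoint orbit of a functional, as the map `a ↦ ∑ a₁ φ(a₂) S(a₃)`. -/
def adOrbit (φ : A →ₗ[k] k) : A →ₗ[k] A :=
  LinearMap.mul' k A ∘ₗ TensorProduct.map (rightConv φ) (antipode k) ∘ₗ comul

/-- The integral of the adjoint orbit of a functional is invariant under the adjoint action. -/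
theorem leftConv_average {r : A →ₗ[k] k} (hr : ∀ a, rightConv r a = algebraMap k A (r a))
    (φ : A →ₗ[k] k) : leftConv (r ∘ₗ adOrbit φ) = rightConv (r ∘ₗ adOrbit φ) := by
  rw [leftConv_eq_rightConv_iff]
  intro y a
  rw [← apply_leftConv (r ∘ₗ adOrbit φ) y]
  simp only [adOrbit, LinearMap.comp_apply]
  rw [isLeftInvariant_rightConv y a, comul_leftConv]
  generalize comul (R := k) a = t
  induction t with
  | zero => simp
  | add s t hs ht => simp only [map_add, hs, ht]
  | tmul b c =>
    simp only [LinearMap.lTensor_tmul, LinearMap.rTensor_tmul, TensorProduct.map_tmul,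
      LinearMap.mul'_apply]
    rw [integral_adjoint hr, rightConv_leftConv]

theorem adOrbit_of_central {φ : A →ₗ[k] k} (h : leftConv φ = rightConv φ) (a : A) :
    adOrbit φ a = algebraMap k A (φ a) := by
  rw [← counit_leftConv φ a, ← mul_antipode_lTensor_comul_apply, comul_leftConv,
    ← LinearMap.comp_apply (LinearMap.lTensor _ _), LinearMap.lTensor_comp_rTensor, h]
  rfl

variable (k A) in
/-- The right adjoint coaction `a ↦ ∑ a₂ ⊗ a₁ S(a₃)`, an algebra map. -/
def adCoaction : A →ₐ[k] A ⊗[k] A :=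
  ((Algebra.TensorProduct.lift (Algebra.TensorProduct.comm k A A).toAlgHom
    (Algebra.TensorProduct.includeRight.comp (antipodeAlgHom k A))
      (fun _ _ => Commute.all _ _)).comp
    (Algebra.TensorProduct.map (Bialgebra.comulAlgHom k A) (AlgHom.id k A))).comp
      (Bialgebra.comulAlgHom k A)

theorem lid_rTensor_adCoaction (φ : A →ₗ[k] k) (a : A) :
    TensorProduct.lid k A (φ.rTensor A (adCoaction k A a)) = adOrbit φ a := by
  simp only [adCoaction, adOrbit, AlgHom.comp_apply, LinearMap.comp_apply,
    Bialgebra.comulAlgHom_apply]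
  generalize comul (R := k) a = t
  induction t with
  | zero => simp
  | add s t hs ht => simp only [map_add, hs, ht]
  | tmul b c =>
    rw [Algebra.TensorProduct.map_tmul, Algebra.TensorProduct.lift_tmul, TensorProduct.map_tmul,
      rightConv_apply, Bialgebra.comulAlgHom_apply]
    generalize comul (R := k) b = t
    induction t with
    | zero => simp
    | add s t hs ht =>
      simp only [LinearMap.mul'_apply, map_add, add_mul] at hs ht ⊢
      rw [hs, ht]
    | tmul x y => simp

theorem adOrbit_one (φ : A →ₗ[k] k) : adOrbit φ 1 = algebraMap k A (φ 1) := by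
  rw [← lid_rTensor_adCoaction, map_one, Algebra.TensorProduct.one_def, LinearMap.rTensor_tmul,
    TensorProduct.lid_tmul, Algebra.algebraMap_eq_smul_one]

/-- If all functionals `φ (b ·)` with `ε(b) = 0` are central, then `φ` is invariant under the
adjoint action on products of two elements of the augmentation ideal. This uses that the adjoint coaction is
multiplicative and preserves the augmentation ideal. -/
theorem adOrbit_mul {φ : A →ₗ[k] k} (h : ∀ b : A, counit (R := k) b = 0 →
      leftConv (φ ∘ₗ LinearMap.mulLeft k b) = rightConv (φ ∘ₗ LinearMap.mulLeft k b))
    {a b : A} (ha : counit (R := k) a = 0) (hb : counit (R := k) b = 0) :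
    adOrbit φ (a * b) = algebraMap k A (φ (a * b)) := by
  let q : A →ₗ[k] A := LinearMap.id - Algebra.linearMap k A ∘ₗ counit
  have hq : ∀ c, counit (R := k) (q c) = 0 := fun c => by simp [q]
  -- the coaction of `b` lies in `M ⊗ A`, for the augmentation ideal `M`
  have hqb : q.rTensor A (adCoaction k A b) = adCoaction k A b := by
    have h0 : TensorProduct.lid k A
        ((counit (R := k) (A := A)).rTensor A (adCoaction k A b)) = 0 := by
      have hc : leftConv (counit (R := k) (A := A)) = rightConv counit := by
        rw [leftConv_counit, rightConv_counit]
      rw [lid_rTensor_adCoaction, adOrbit_of_central hc, hb, map_zero]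
    have h1 := (LinearEquiv.map_eq_zero_iff _).1 h0
    rw [LinearMap.rTensor_sub, LinearMap.rTensor_comp, LinearMap.sub_apply, LinearMap.comp_apply,
      h1, map_zero, LinearMap.rTensor_id, LinearMap.id_apply, sub_zero]
  -- centrality of `φ (x ·)` for the first tensor factors `x` of the coaction of `b`
  have key : ∀ t : A ⊗[k] A,
      TensorProduct.lid k A (φ.rTensor A (adCoaction k A a * q.rTensor A t)) =
        TensorProduct.lid k A (φ.rTensor A ((a ⊗ₜ 1) * q.rTensor A t)) := by
    intro t
    induction t with
    | zero => simp
    | add s t hs ht => simp only [map_add, mul_add, hs, ht]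
    | tmul x y =>
      have e : ∀ s : A ⊗[k] A,
          TensorProduct.lid k A (φ.rTensor A (s * (q x ⊗ₜ y))) =
          TensorProduct.lid k A ((φ ∘ₗ LinearMap.mulLeft k (q x)).rTensor A s) * y := by
        intro s
        induction s with
        | zero => simp
        | add s t hs ht => simp only [map_add, add_mul, hs, ht]
        | tmul u v => simp [mul_comm]
      rw [LinearMap.rTensor_tmul, e, lid_rTensor_adCoaction, adOrbit_of_central (h _ (hq x)), e,
        LinearMap.rTensor_tmul, TensorProduct.lid_tmul, Algebra.algebraMap_eq_smul_one]
  rw [← lid_rTensor_adCoaction, map_mul, ← hqb, key, hqb]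
  have e : ∀ s : A ⊗[k] A, TensorProduct.lid k A (φ.rTensor A ((a ⊗ₜ 1) * s)) =
      TensorProduct.lid k A ((φ ∘ₗ LinearMap.mulLeft k a).rTensor A s) := by
    intro s
    induction s with
    | zero => simp
    | add s t hs ht => simp only [map_add, mul_add, hs, ht]
    | tmul u v => simp
  rw [e, lid_rTensor_adCoaction, adOrbit_of_central (h a ha)]
  rfl

/-- If the derivations at the identity and all functionals `φ (b ·)` with `ε(b) = 0` are central,
then so is `φ`: the average of the adjoint orbit of `φ` is central, and it differs from `φ` by a
derivation at the identity. -/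
theorem central_of_central_mul {r : A →ₗ[k] k} (hr1 : r 1 = 1)
    (hr : ∀ a, rightConv r a = algebraMap k A (r a))
    (hg : ∀ x : A →ₗ[k] k, (∀ a b, x (a * b) = x a * counit b + counit a * x b) →
      leftConv x = rightConv x)
    {φ : A →ₗ[k] k} (h : ∀ b : A, counit (R := k) b = 0 →
      leftConv (φ ∘ₗ LinearMap.mulLeft k b) = rightConv (φ ∘ₗ LinearMap.mulLeft k b)) :
    leftConv φ = rightConv φ := by
  set x : A →ₗ[k] k := r ∘ₗ adOrbit φ - φ with hx
  have hr' : ∀ c : k, r (algebraMap k A c) = c := fun c => by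
    rw [Algebra.algebraMap_eq_smul_one, map_smul, hr1, smul_eq_mul, mul_one]
  have hx1 : ∀ c : k, x (algebraMap k A c) = 0 := fun c => by
    rw [Algebra.algebraMap_eq_smul_one, map_smul, hx, LinearMap.sub_apply, LinearMap.comp_apply,
      adOrbit_one, hr', sub_self, smul_zero]
  have hx2 : ∀ a b : A, counit (R := k) a = 0 → counit (R := k) b = 0 → x (a * b) = 0 :=
    fun a b ha hb => by
      rw [hx, LinearMap.sub_apply, LinearMap.comp_apply, adOrbit_mul h ha hb, hr', sub_self]
  have hder : ∀ a b, x (a * b) = x a * counit b + counit a * x b := by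
    intro a b
    have h0 := hx2 (a - algebraMap k A (counit a)) (b - algebraMap k A (counit b))
      (by simp) (by simp)
    have e : (a - algebraMap k A (counit a)) * (b - algebraMap k A (counit b)) =
        a * b - counit (R := k) a • b - counit (R := k) b • a
          + algebraMap k A (counit a * counit b) := by
      simp only [Algebra.smul_def, map_mul]
      ring
    rw [e, map_add, map_sub, map_sub, map_smul, map_smul, hx1, smul_eq_mul, smul_eq_mul] at h0
    linear_combination h0
  have hφ : φ = r ∘ₗ adOrbit φ - x := by rw [hx, sub_sub_cancel]
  have hR : ∀ y z : A →ₗ[k] k, rightConv (y - z) = rightConv y - rightConv z := fun y z => by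
    ext a; simp [rightConv_apply, LinearMap.lTensor_sub]
  rw [hφ, leftConv_sub, hR, leftConv_average hr, hg x hder]

end Averaging

/-! ### Derivations at the identity are diagonalizable -/

section Derivations

open HopfAlgebra

variable {k : Type*} [Field k] {A : Type*} [CommRing A] [HopfAlgebra k A]

/-- A derivation at the identity: an element of the Lie algebra. -/
def IsCounitDerivation (x : A →ₗ[k] k) : Prop :=
  ∀ a b, x (a * b) = x a * counit b + counit a * x b

namespace IsCounitDerivation

variable {x : A →ₗ[k] k} (hx : IsCounitDerivation x)
include hx

theorem apply_one : x 1 = 0 := by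
  have h := hx 1 1
  simpa using h

theorem apply_antipode (a : A) : x (antipode k a) = -x a := by
  have h := congrArg x (mul_antipode_rTensor_comul_apply (R := k) a)
  rw [Algebra.algebraMap_eq_smul_one, map_smul, hx.apply_one, smul_zero] at h
  have e : ∀ t : A ⊗[k] A, x (LinearMap.mul' k A ((antipode k).rTensor A t)) =
      x (antipode k (TensorProduct.rid k A (counit.lTensor A t))) +
        x (TensorProduct.lid k A (counit.rTensor A t)) := by
    intro t
    induction t with
    | zero => simp
    | add s t hs ht => simp only [map_add, hs, ht]; ring
    | tmul b c =>
      rw [LinearMap.rTensor_tmul, LinearMap.mul'_apply, hx (antipode k b) c]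
      simp [mul_comm]
  rw [e, lTensor_counit_comul, rTensor_counit_comul, TensorProduct.rid_tmul,
    TensorProduct.lid_tmul, one_smul] at h
  exact eq_neg_of_add_eq_zero_left h

theorem rightConv_mul (a b : A) :
    rightConv x (a * b) = a * rightConv x b + rightConv x a * b := by
  have e : ∀ s t : A ⊗[k] A, TensorProduct.rid k A (x.lTensor A (s * t)) =
      TensorProduct.rid k A (counit.lTensor A s) * TensorProduct.rid k A (x.lTensor A t) +
      TensorProduct.rid k A (x.lTensor A s) * TensorProduct.rid k A (counit.lTensor A t) := by
    intro s t
    induction s with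
    | zero => simp
    | add s s' hs hs' => simp only [map_add, add_mul, hs, hs']; abel
    | tmul c d =>
    induction t with
    | zero => simp
    | add t t' ht ht' => simp only [map_add, mul_add, ht, ht']; abel
    | tmul c' d' =>
      simp only [Algebra.TensorProduct.tmul_mul_tmul, LinearMap.lTensor_tmul,
        TensorProduct.rid_tmul, hx d d', smul_mul_smul_comm, add_smul]
      abel
  rw [rightConv_apply, Bialgebra.comul_mul, e]
  simp [rightConv_apply]

theorem leftConv_mul (a b : A) :
    leftConv x (a * b) = a * leftConv x b + leftConv x a * b := by
  have e : ∀ s t : A ⊗[k] A, TensorProduct.lid k A (x.rTensor A (s * t)) =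
      TensorProduct.lid k A (counit.rTensor A s) * TensorProduct.lid k A (x.rTensor A t) +
      TensorProduct.lid k A (x.rTensor A s) * TensorProduct.lid k A (counit.rTensor A t) := by
    intro s t
    induction s with
    | zero => simp
    | add s s' hs hs' => simp only [map_add, add_mul, hs, hs']; abel
    | tmul c d =>
    induction t with
    | zero => simp
    | add t t' ht ht' => simp only [map_add, mul_add, ht, ht']; abel
    | tmul c' d' =>
      simp only [Algebra.TensorProduct.tmul_mul_tmul, LinearMap.rTensor_tmul,
        TensorProduct.lid_tmul, hx c c', smul_mul_smul_comm, add_smul]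
      abel
  rw [leftConv_apply, Bialgebra.comul_mul, e]
  simp [leftConv_apply]

theorem leftConv_antipode (a : A) :
    leftConv x (antipode k a) = -antipode k (rightConv x a) := by
  have h : x ∘ₗ antipode k = (-1 : k) • x := by
    ext a
    simp [hx.apply_antipode]
  rw [SuperGroup.leftConv_antipode, h, rightConv_smul]
  simp

theorem rightConv_pow (a : A) (n : ℕ) :
    rightConv x (a ^ n) = n • (a ^ (n - 1) * rightConv x a) := by
  let D : Derivation k A A := Derivation.mk' (rightConv x) fun a b => by
    rw [hx.rightConv_mul, smul_eq_mul, smul_eq_mul, mul_comm b]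
  exact D.leibniz_pow a n

variable {l : A →ₗ[k] k} (hl1 : l 1 = 1) (hl : ∀ a, leftConv l a = algebraMap k A (l a))
  {p : ℕ} [Fact p.Prime] [CharP k p] (h2 : 2 < p)
include hl1 hl h2

/-- The translation operators of the Lie algebra are semisimple: they kill `p`-th powers, and the
integral annihilates their images. -/
theorem rightConv_semisimple (α : k) {a : A}
    (h : (rightConv x - α • (1 : Module.End k A))
      ((rightConv x - α • (1 : Module.End k A)) a) = 0) :
    (rightConv x - α • (1 : Module.End k A)) a = 0 := by
  have H := isSuperHopf_of_comm hl1 hl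
  have hB : IsSubBialgebra (0 : A →ₗ[k] A) (⊤ : Subalgebra k A) :=
    ⟨fun _ _ => trivial, fun _ _ _ => trivial, fun _ _ _ => trivial⟩
  refine H.ker_sq_eq_of_derivation h2 hB (fun _ => trivial) (isLeftInvariant_rightConv x)
    (fun _ _ => trivial) (fun a => by simp) (fun a _ b _ _ => hx.rightConv_mul a b) (fun a => ?_)
    (fun a => ?_) α (a := a) trivial h
  · rw [H.frob_apply, hx.rightConv_pow, ← Nat.cast_smul_eq_nsmul k, CharP.cast_eq_zero, zero_smul]
  · rw [H.integral_rightConv, hx.apply_one, mul_zero]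

theorem iSup_eigenspace_rightConv [IsAlgClosed k] :
    ⨆ α, Module.End.eigenspace (rightConv x) α = ⊤ := by
  refine eq_top_iff.2 fun a _ => ?_
  have h := mem_iSup_eigenspace_of_semisimple (rightConv x) (rightOrbit (k := k) a)
    (fun b hb => rightConv_mem_rightOrbit x hb)
    (fun α b _ hb => hx.rightConv_semisimple hl1 hl h2 α hb) (self_mem_rightOrbit a)
  exact (iSup_mono fun α => inf_le_right : _ ≤ ⨆ α, Module.End.eigenspace (rightConv x) α) h

/-- The infinitesimal adjoint action `D_x - D'_x` is diagonalizable, as a difference of two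
commuting diagonalizable operators. The antipode conjugates `-D_x` to `D'_x`. -/
theorem iSup_eigenspace_sub [IsAlgClosed k] :
    ⨆ γ, Module.End.eigenspace (rightConv x - leftConv x) γ = ⊤ := by
  rw [eq_top_iff, ← hx.iSup_eigenspace_rightConv hl1 hl h2]
  refine iSup_le fun α v hv => ?_
  rw [Module.End.mem_eigenspace_iff] at hv
  -- a finite-dimensional space stable under `D'_x`, on which `D_x` is still multiplication by `α`
  let U : Submodule k A := (rightOrbit (k := k) (antipode k v)).map (antipode k)
  have hUv : v ∈ U := ⟨antipode k v, self_mem_rightOrbit _, antipode_antipode v⟩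
  have hUeig : ∀ u ∈ U, rightConv x u = α • u := by
    rintro _ ⟨_, ⟨φ, rfl⟩, rfl⟩
    have e : antipode k (rightConv φ (antipode k v)) = leftConv (φ ∘ₗ antipode k) v := by
      have h := SuperGroup.leftConv_antipode (φ ∘ₗ antipode k) (antipode k v)
      have h' : (φ ∘ₗ antipode k) ∘ₗ antipode k = φ := by
        ext a
        simp [antipode_antipode]
      rw [antipode_antipode, h'] at h
      exact h.symm
    change rightConv x (antipode k (rightConv φ (antipode k v))) = _ •
      antipode k (rightConv φ (antipode k v))
    rw [e, ← rightConv_leftConv, hv, map_smul]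
  have hUstab : ∀ u ∈ U, leftConv x u ∈ U := by
    rintro _ ⟨w, hw, rfl⟩
    rw [hx.leftConv_antipode]
    exact U.neg_mem ⟨_, rightConv_mem_rightOrbit x hw, rfl⟩
  have hss : ∀ (β : k), ∀ u ∈ U,
      (leftConv x - β • (1 : Module.End k A)) ((leftConv x - β • (1 : Module.End k A)) u) = 0 →
      (leftConv x - β • (1 : Module.End k A)) u = 0 := by
    rintro β _ ⟨w, -, rfl⟩ h
    have e : ∀ b, (leftConv x - β • (1 : Module.End k A)) (antipode k b) =
        -antipode k ((rightConv x - (-β) • (1 : Module.End k A)) b) := by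
      intro b
      simp only [LinearMap.sub_apply, LinearMap.smul_apply, Module.End.one_apply,
        hx.leftConv_antipode, map_sub, map_smul]
      module
    rw [e, map_neg, e, neg_neg] at h
    have h' := congrArg (antipode k) h
    rw [antipode_antipode, map_zero] at h'
    rw [e, hx.rightConv_semisimple hl1 hl h2 _ h', map_zero, neg_zero]
  have h := mem_iSup_eigenspace_of_semisimple (leftConv x) U hUstab hss hUv
  refine (iSup_le fun β u hu => ?_ : ⨆ β, U ⊓ Module.End.eigenspace (leftConv x) β ≤ _) h
  refine Submodule.mem_iSup_of_mem (α - β) ?_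
  rw [Module.End.mem_eigenspace_iff, LinearMap.sub_apply, hUeig u hu.1,
    Module.End.mem_eigenspace_iff.1 hu.2, sub_smul]

end IsCounitDerivation

end Derivations

/-! ### Distributions at the identity are central -/

section Central

open HopfAlgebra

variable {k : Type*} [Field k] {A : Type*} [CommRing A] [HopfAlgebra k A]

variable (k A) in
/-- The augmentation ideal, that is, the maximal ideal of the identity. -/
def augIdeal : Ideal A := RingHom.ker (Bialgebra.counitAlgHom k A)

theorem mem_augIdeal {a : A} : a ∈ augIdeal k A ↔ counit (R := k) a = 0 := Iff.rfl

theorem sub_counit_mem_augIdeal (a : A) : a - algebraMap k A (counit a) ∈ augIdeal k A := by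
  rw [mem_augIdeal, map_sub, Bialgebra.counit_algebraMap, sub_self]

/-- Derivations at the identity separate the points of the cotangent space. -/
theorem mem_augIdeal_sq {a : A} (ha : counit (R := k) a = 0)
    (h : ∀ y : A →ₗ[k] k, IsCounitDerivation y → y a = 0) : a ∈ augIdeal k A ^ 2 := by
  by_contra hne
  obtain ⟨f, hf, hf0⟩ := Submodule.exists_le_ker_of_notMem
    (p := (augIdeal k A ^ 2).restrictScalars k) hne
  have hf0 : ∀ b ∈ augIdeal k A ^ 2, f b = 0 := fun b hb => hf0 hb
  let y : A →ₗ[k] k := f ∘ₗ (LinearMap.id - Algebra.linearMap k A ∘ₗ counit)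
  have hy : ∀ b, y b = f (b - algebraMap k A (counit b)) := fun b => rfl
  refine hf ?_
  have hya := h y fun b c => ?_
  · rwa [hy, ha, map_zero, sub_zero] at hya
  · have h0 := hf0 _ (by
      rw [pow_two]
      exact Ideal.mul_mem_mul (sub_counit_mem_augIdeal (k := k) b) (sub_counit_mem_augIdeal c))
    have e : b * c - algebraMap k A (counit (b * c)) =
        (b - algebraMap k A (counit b)) * (c - algebraMap k A (counit c)) +
        counit (R := k) b • (c - algebraMap k A (counit c)) +
        counit (R := k) c • (b - algebraMap k A (counit b)) := by
      simp only [Algebra.smul_def, map_mul, Bialgebra.counit_mul]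
      ring
    rw [hy, e, map_add, map_add, h0, map_smul, map_smul, ← hy, ← hy, smul_eq_mul, smul_eq_mul]
    ring

namespace IsCounitDerivation

variable {x y : A →ₗ[k] k} (hx : IsCounitDerivation x)

theorem sub_mul (hx : IsCounitDerivation x) (a b : A) : (rightConv x - leftConv x) (a * b) =
    a * (rightConv x - leftConv x) b + (rightConv x - leftConv x) a * b := by
  rw [LinearMap.sub_apply, LinearMap.sub_apply, LinearMap.sub_apply, hx.rightConv_mul,
    hx.leftConv_mul]
  ring

theorem counit_eq_zero_of_eigenvector {γ : k} (hγ : γ ≠ 0) {a : A}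
    (ha : (rightConv x - leftConv x) a = γ • a) : counit (R := k) a = 0 := by
  have h := congrArg (counit (R := k)) ha
  rw [LinearMap.sub_apply, map_sub, counit_rightConv, counit_leftConv, sub_self, map_smul,
    smul_eq_mul] at h
  exact (mul_eq_zero.1 h.symm).resolve_left hγ

variable {l : A →ₗ[k] k} (hl1 : l 1 = 1) (hl : ∀ a, leftConv l a = algebraMap k A (l a))
  {p : ℕ} [Fact p.Prime] [CharP k p] (h2 : 2 < p) [IsAlgClosed k]
include hl1 hl h2

/-- A root vector of the adjoint action of a diagonalizable element vanishes: a nonzero root would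
make its translation operator nilpotent on eigenvectors, but this operator is diagonalizable. -/
theorem eq_zero_of_root (hy : IsCounitDerivation y) {γ : k} (hγ : γ ≠ 0)
    (h : ∀ a, y ((rightConv x - leftConv x) a) = γ * y a) : y = 0 := by
  have hcomm : ∀ a, rightConv y (rightConv x a) =
      rightConv x (rightConv y a) + γ • rightConv y a := by
    intro a
    have e : y ∘ₗ rightConv x = x ∘ₗ rightConv y + γ • y := by
      ext a
      have h := h a
      rw [LinearMap.sub_apply, map_sub, apply_leftConv] at h
      simp only [LinearMap.comp_apply, LinearMap.add_apply, LinearMap.smul_apply, smul_eq_mul]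
      linear_combination h
    have h' := LinearMap.congr_fun (rightConv_comp y x) a
    rw [e, rightConv_add, ← rightConv_comp, rightConv_smul] at h'
    exact h'
  have hzero : ∀ v, rightConv y v = 0 := by
    intro v
    have hv : v ∈ ⨆ α, Module.End.eigenspace (rightConv y) α := by
      rw [hy.iSup_eigenspace_rightConv hl1 hl h2]
      trivial
    induction hv using Submodule.iSup_induction' with
    | zero => simp
    | add u w _ _ hu hw => rw [map_add, hu, hw, add_zero]
    | mem α v hv =>
      rw [Module.End.mem_eigenspace_iff] at hv
      have e : (rightConv y - α • (1 : Module.End k A)) (rightConv x v) = (γ * α) • v := by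
        simp only [LinearMap.sub_apply, LinearMap.smul_apply, Module.End.one_apply, hcomm, hv,
          map_smul]
        module
      have h0 : (rightConv y - α • (1 : Module.End k A))
          ((rightConv y - α • (1 : Module.End k A)) (rightConv x v)) = 0 := by
        rw [e]
        simp only [LinearMap.sub_apply, LinearMap.smul_apply, Module.End.one_apply, hv, map_smul]
        module
      have h1 := hy.rightConv_semisimple hl1 hl h2 α h0
      rw [e, mul_smul, smul_eq_zero] at h1
      rw [hv, h1.resolve_left hγ]
  ext a
  rw [← counit_rightConv, hzero, map_zero, LinearMap.zero_apply]

/-- Derivations at the identity kill the root vectors in the coordinate algebra: otherwise the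
component of a derivation on a nonzero eigenspace would be a root vector. -/
theorem apply_eigenvector_eq_zero (hx : IsCounitDerivation x) (hy : IsCounitDerivation y) {γ : k}
    (hγ : γ ≠ 0) {a : A} (ha : (rightConv x - leftConv x) a = γ • a) : y a = 0 := by
  set δ : Module.End k A := rightConv x - leftConv x with hδ
  have htop := hx.iSup_eigenspace_sub hl1 hl h2
  have hcompl : IsCompl (δ.eigenspace γ) (⨆ (β) (_ : β ≠ γ), δ.eigenspace β) :=
    ⟨δ.eigenspaces_iSupIndep γ, by
      rw [codisjoint_iff, eq_top_iff, ← htop]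
      refine iSup_le fun β => ?_
      by_cases hβ : β = γ
      · exact hβ ▸ le_sup_left
      · exact le_sup_of_le_right (le_iSup₂_of_le β hβ le_rfl)⟩
  -- the component of `y` of weight `γ`
  let y' : A →ₗ[k] k := y ∘ₗ Submodule.projection _ _ hcompl
  have hy1 : ∀ b ∈ δ.eigenspace γ, y' b = y b := fun b hb => by
    simp [y', Submodule.projection_apply_of_mem_left hcompl hb]
  have hy0 : ∀ β ≠ γ, ∀ b ∈ δ.eigenspace β, y' b = 0 := fun β hβ b hb => by
    have hb' : b ∈ ⨆ (β) (_ : β ≠ γ), δ.eigenspace β :=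
      Submodule.mem_iSup_of_mem β (Submodule.mem_iSup_of_mem hβ hb)
    have : Submodule.projection _ _ hcompl b = 0 := by
      rw [Submodule.projection_apply, (Submodule.projectionOnto_apply_eq_zero_iff hcompl).2 hb']
      rfl
    simp [y', this]
  have hmem : ∀ b : A, b ∈ ⨆ β, δ.eigenspace β := fun b => by rw [htop]; trivial
  -- eigenvalues add under multiplication, and `ε` vanishes on nonzero eigenvalues
  have hder : IsCounitDerivation y' := by
    intro b c
    have hb := hmem b
    have hc := hmem c
    induction hb using Submodule.iSup_induction' with
    | zero => simp
    | add u w _ _ hu hw => simp only [_root_.add_mul, map_add, hu, hw]; ring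
    | mem β b hb =>
    induction hc using Submodule.iSup_induction' with
    | zero => simp
    | add u w _ _ hu hw => simp only [_root_.mul_add, map_add, hu, hw]; ring
    | mem β' c hc =>
      have hbc : b * c ∈ δ.eigenspace (β + β') := by
        rw [Module.End.mem_eigenspace_iff] at hb hc ⊢
        rw [hx.sub_mul, ← hδ, hb, hc, mul_smul_comm, smul_mul_assoc, add_smul, add_comm]
      have hb0 : β ≠ 0 → counit (R := k) b = 0 := fun h =>
        counit_eq_zero_of_eigenvector h (Module.End.mem_eigenspace_iff.1 hb)
      have hc0 : β' ≠ 0 → counit (R := k) c = 0 := fun h =>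
        counit_eq_zero_of_eigenvector h (Module.End.mem_eigenspace_iff.1 hc)
      by_cases h1 : β = 0
      · subst h1
        rw [hy0 0 hγ.symm b hb, zero_mul, zero_add]
        rw [zero_add] at hbc
        by_cases h2 : β' = γ
        · subst h2
          rw [hy1 _ hbc, hy1 _ hc, hy, hc0 hγ, mul_zero, zero_add]
        · rw [hy0 _ h2 _ hbc, hy0 _ h2 _ hc, mul_zero]
      · rw [hb0 h1, zero_mul, add_zero]
        by_cases h3 : β' = 0
        · subst h3
          rw [add_zero] at hbc
          by_cases h2 : β = γ
          · subst h2
            rw [hy1 _ hbc, hy1 _ hb, hy, hb0 hγ, zero_mul, add_zero]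
          · rw [hy0 _ h2 _ hbc, hy0 _ h2 _ hb, zero_mul]
        · rw [hc0 h3, mul_zero]
          by_cases h2 : β + β' = γ
          · subst h2
            rw [hy1 _ hbc, hy, hb0 h1, hc0 h3, mul_zero, zero_mul, add_zero]
          · exact hy0 _ h2 _ hbc
  have hroot : ∀ b, y' (δ b) = γ * y' b := by
    intro b
    have hb := hmem b
    induction hb using Submodule.iSup_induction' with
    | zero => simp
    | add u w _ _ hu hw => simp only [map_add, hu, hw]; ring
    | mem β b hb =>
      have hb' := Module.End.mem_eigenspace_iff.1 hb
      rw [hb', map_smul, smul_eq_mul]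
      by_cases hβ : β = γ
      · rw [hβ]
      · rw [hy0 β hβ b hb, mul_zero, mul_zero]
  have h0 := eq_zero_of_root hl1 hl h2 hder hγ hroot
  rw [← hy1 a (Module.End.mem_eigenspace_iff.2 ha), h0, LinearMap.zero_apply]

/-- Derivations at the identity are central: `D_x - D'_x` maps the powers of the augmentation ideal
`M` into the next ones, so its eigenvectors with nonzero eigenvalue lie in all `M ^ n`. -/
theorem central (hM : ∀ a : A, (∀ n, a ∈ augIdeal k A ^ n) → a = 0) (hx : IsCounitDerivation x) :
    leftConv x = rightConv x := by
  set δ : Module.End k A := rightConv x - leftConv x with hδ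
  have htop := hx.iSup_eigenspace_sub hl1 hl h2
  have hmem : ∀ b : A, b ∈ ⨆ β, δ.eigenspace β := fun b => by rw [htop]; trivial
  have h1 : ∀ b, δ b ∈ augIdeal k A ^ 2 := by
    intro b
    have hb := hmem b
    induction hb using Submodule.iSup_induction' with
    | zero => simp
    | add u w _ _ hu hw => rw [map_add]; exact add_mem hu hw
    | mem β b hb =>
      have hb' := Module.End.mem_eigenspace_iff.1 hb
      by_cases hβ : β = 0
      · rw [hb', hβ, zero_smul]
        exact zero_mem _
      · rw [hb', Algebra.smul_def]
        exact Ideal.mul_mem_left _ _ (mem_augIdeal_sq (counit_eq_zero_of_eigenvector hβ hb')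
          fun y hy => hx.apply_eigenvector_eq_zero hl1 hl h2 hy hβ hb')
  have h3 : ∀ n, ∀ b ∈ augIdeal k A ^ n, δ b ∈ augIdeal k A ^ (n + 1) := by
    intro n
    induction n with
    | zero => exact fun b _ => Ideal.pow_le_pow_right one_le_two (h1 b)
    | succ n ih =>
      intro b hb
      rw [pow_succ] at hb
      induction hb using Submodule.mul_induction_on' with
      | add b _ c _ hb hc => rw [map_add]; exact add_mem hb hc
      | mem_mul_mem b hb c hc =>
        rw [hδ, hx.sub_mul, ← hδ]
        refine add_mem ?_ ?_
        · have := Ideal.mul_mem_mul hb (h1 c)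
          rwa [← pow_add] at this
        · have := Ideal.mul_mem_mul (ih b hb) hc
          rwa [← pow_succ] at this
  have h4 : ∀ b, δ b = 0 := by
    intro b
    have hb := hmem b
    induction hb using Submodule.iSup_induction' with
    | zero => simp
    | add u w _ _ hu hw => rw [map_add, hu, hw, add_zero]
    | mem β b hb =>
      have hb' := Module.End.mem_eigenspace_iff.1 hb
      by_cases hβ : β = 0
      · rw [hb', hβ, zero_smul]
      · have : b = 0 := hM b fun n => by
          induction n with
          | zero => simp
          | succ n ih =>
            have h := h3 n b ih
            rw [hb', Algebra.smul_def] at h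
            have h' := Ideal.mul_mem_left _ (algebraMap k A β⁻¹) h
            rwa [← mul_assoc, ← map_mul, inv_mul_cancel₀ hβ, map_one, one_mul] at h'
        rw [this, map_zero]
  ext b
  exact (sub_eq_zero.1 (h4 b)).symm

end IsCounitDerivation

variable {l : A →ₗ[k] k} (hl1 : l 1 = 1) (hl : ∀ a, leftConv l a = algebraMap k A (l a))
  {p : ℕ} [Fact p.Prime] [CharP k p] (h2 : 2 < p) [IsAlgClosed k]
include hl1 hl h2

/-- All distributions supported at the identity are central. -/
theorem central_of_apply_augIdeal_pow (hM : ∀ a : A, (∀ n, a ∈ augIdeal k A ^ n) → a = 0) (n : ℕ)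
    (φ : A →ₗ[k] k) (hφ : ∀ a ∈ augIdeal k A ^ n, φ a = 0) : leftConv φ = rightConv φ := by
  induction n generalizing φ with
  | zero =>
    have : φ = 0 := LinearMap.ext fun a => hφ a (by simp)
    ext a
    simp [this, leftConv_apply, rightConv_apply]
  | succ n ih =>
    -- if `φ` kills `M ^ (n + 1)` and `b ∈ M`, then `φ (b ·)` kills `M ^ n`
    refine central_of_central_mul (r := l ∘ₗ antipode k) (by simp [hl1])
      (rightConv_integral_comp_antipode hl) (fun x hx =>
        IsCounitDerivation.central hl1 hl h2 hM hx) fun b hb => ih _ fun a ha => ?_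
    refine hφ _ ?_
    rw [pow_succ']
    exact Ideal.mul_mem_mul (mem_augIdeal.2 hb) ha

/-- If the powers of the augmentation ideal meet in `0`, then the Hopf algebra is cocommutative. -/
theorem leftConv_eq_rightConv (hM : ∀ a : A, (∀ n, a ∈ augIdeal k A ^ n) → a = 0)
    (φ : A →ₗ[k] k) : leftConv φ = rightConv φ := by
  ext a
  refine sub_eq_zero.1 (hM _ fun n => ?_)
  by_contra hne
  obtain ⟨ψ, hψ, hψ0⟩ := Submodule.exists_le_ker_of_notMem
    (p := (augIdeal k A ^ n).restrictScalars k) hne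
  have hc := central_of_apply_augIdeal_pow hl1 hl h2 hM n ψ fun b hb => hψ0 hb
  refine hψ ?_
  rw [map_sub, apply_leftConv, ← hc, apply_leftConv, sub_self]

end Central

/-! ### Grouplike elements -/

section GroupLike

open HopfAlgebra

/-- A family of commuting operators has a common eigenvector in every nonzero finite-dimensional
stable subspace. -/
theorem exists_common_eigenvector {k V ι : Type*} [Field k] [IsAlgClosed k] [AddCommGroup V]
    [Module k V] (f : ι → Module.End k V) (hf : ∀ i j v, f i (f j v) = f j (f i v))
    (U : Submodule k V) [FiniteDimensional k U] (hU : ∀ i, ∀ v ∈ U, f i v ∈ U) (hne : U ≠ ⊥) :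
    ∃ v ∈ U, v ≠ 0 ∧ ∀ i, ∃ c : k, f i v = c • v := by
  induction hn : Module.finrank k U using Nat.strong_induction_on generalizing U with
  | _ n ih =>
  by_cases h : ∀ i, ∃ c : k, ∀ v ∈ U, f i v = c • v
  · obtain ⟨v, hv, hv0⟩ := Submodule.exists_mem_ne_zero_of_ne_bot hne
    exact ⟨v, hv, hv0, fun i => (h i).imp fun c hc => hc v hv⟩
  · push Not at h
    obtain ⟨i, hi⟩ := h
    have : Nontrivial U := Submodule.nontrivial_iff_ne_bot.2 hne
    obtain ⟨c, hc⟩ := Module.End.exists_eigenvalue ((f i).restrict (hU i))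
    obtain ⟨w, hw⟩ := hc.exists_hasEigenvector
    have hw' : f i w = c • (w : V) := congrArg Subtype.val hw.apply_eq_smul
    let U' : Submodule k V := U ⊓ (f i).eigenspace c
    have hlt : U' < U := by
      refine lt_of_le_of_ne inf_le_left fun he => ?_
      obtain ⟨v, hv, hvc⟩ := hi c
      rw [← he] at hv
      exact hvc (Module.End.mem_eigenspace_iff.1 hv.2)
    have : FiniteDimensional k U' := Submodule.finiteDimensional_of_le hlt.le
    have hne' : U' ≠ ⊥ := fun h0 => hw.2 (Subtype.ext ((Submodule.mem_bot k).1
      (h0 ▸ (⟨w.2, Module.End.mem_eigenspace_iff.2 hw'⟩ : (w : V) ∈ U'))))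
    obtain ⟨v, hv, hv'⟩ := ih _ (hn ▸ Submodule.finrank_lt_finrank_of_lt hlt) U'
      (fun j v hv => ⟨hU j v hv.1, Module.End.mem_eigenspace_iff.2 (by
        rw [hf, Module.End.mem_eigenspace_iff.1 hv.2, map_smul])⟩)
      hne' rfl
    exact ⟨v, hv.1, hv'⟩

variable {k : Type*} [Field k] {A : Type*} [CommRing A] [HopfAlgebra k A]

theorem rightConv_of_isGroupLikeElem {g : A} (hg : IsGroupLikeElem k g) (y : A →ₗ[k] k) :
    rightConv y g = y g • g := by
  simp [rightConv_apply, hg.comul_eq_tmul_self]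

/-- A common eigenvector of all translations is a multiple of a grouplike element. -/
theorem isGroupLikeElem_of_eigenvector {v : A} (hv : v ≠ 0)
    (h : ∀ y : A →ₗ[k] k, ∃ c : k, rightConv y v = c • v) :
    IsGroupLikeElem k ((counit (R := k) v)⁻¹ • v) := by
  have hε : counit (R := k) v ≠ 0 := by
    intro h0
    refine hv ((Module.forall_dual_apply_eq_zero_iff k v).1 fun y => ?_)
    obtain ⟨c, hc⟩ := h y
    rw [← counit_rightConv, hc, map_smul, h0, smul_zero]
  set g := (counit (R := k) v)⁻¹ • v with hg
  have h1 : counit (R := k) g = 1 := by rw [hg, map_smul, smul_eq_mul, inv_mul_cancel₀ hε]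
  refine ⟨h1, eq_of_rid_lTensor fun y => ?_⟩
  obtain ⟨c, hc⟩ := h y
  have hgc : rightConv y g = c • g := by rw [hg, map_smul, hc, smul_comm]
  rw [← rightConv_apply, hgc]
  have : y g = c := by rw [← counit_rightConv, hgc, map_smul, h1, smul_eq_mul, mul_one]
  simp [this]

/-- A cocommutative, commutative Hopf algebra over an algebraically closed field with a normalized
integral is spanned by its grouplike elements: in an invariant complement of their span, a common
eigenvector of all translations would be a multiple of a further grouplike element. -/
theorem span_groupLike_eq_top [IsAlgClosed k] {r : A →ₗ[k] k} (hr1 : r 1 = 1)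
    (hr : ∀ a, rightConv r a = algebraMap k A (r a))
    (hc : ∀ φ : A →ₗ[k] k, leftConv φ = rightConv φ) :
    Submodule.span k (Set.range (GroupLike.val (R := k) (A := A))) = ⊤ := by
  set L := Submodule.span k (Set.range (GroupLike.val (R := k) (A := A)))
  have hL : ∀ y : A →ₗ[k] k, ∀ a ∈ L, rightConv y a ∈ L := by
    intro y a ha
    induction ha using Submodule.span_induction with
    | mem a ha =>
      obtain ⟨g, rfl⟩ := ha
      rw [rightConv_of_isGroupLikeElem g.2]
      exact L.smul_mem _ (Submodule.subset_span ⟨g, rfl⟩)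
    | zero => simp
    | add a b _ _ ha hb => rw [map_add]; exact add_mem ha hb
    | smul c a _ ha => rw [map_smul]; exact L.smul_mem _ ha
  obtain ⟨T, hTL, hT, hTy⟩ := exists_invariant_projection hr1 hr hL
  by_contra hne
  obtain ⟨a, ha⟩ : ∃ a, a ∉ L := by
    by_contra! h
    exact hne (eq_top_iff.2 fun a _ => h a)
  -- a nonzero element of the complement `ker T`
  set w := a - T a
  have hw0 : w ≠ 0 := fun h => ha (by rw [sub_eq_zero.1 h]; exact hTL a)
  have hTw : T w = 0 := by rw [map_sub, hT _ (hTL a), sub_self]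
  have hU : rightOrbit (k := k) w ≠ ⊥ := fun h =>
    hw0 ((Submodule.mem_bot k).1 (h ▸ self_mem_rightOrbit w))
  have hcomm : ∀ (x y : A →ₗ[k] k) (a : A),
      rightConv x (rightConv y a) = rightConv y (rightConv x a) := fun x y a => by
    rw [← hc x, rightConv_leftConv]
  obtain ⟨v, ⟨y, rfl⟩, hv0, hv⟩ := exists_common_eigenvector (fun x : A →ₗ[k] k => rightConv x)
    hcomm (rightOrbit (k := k) w) (fun x b hb => rightConv_mem_rightOrbit x hb) hU
  have hg := isGroupLikeElem_of_eigenvector hv0 hv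
  set g := (counit (R := k) (rightConv y w))⁻¹ • rightConv y w with hgdef
  have h0 : T g = 0 := by
    rw [hgdef, map_smul]
    rw [hTy, hTw, map_zero, smul_zero]
  rw [hT g (Submodule.subset_span ⟨⟨g, hg⟩, rfl⟩)] at h0
  have := hg.counit_eq_one
  rw [h0, map_zero] at this
  exact zero_ne_one this

theorem bijective_liftGroupLikeBialgHom
    (h : Submodule.span k (Set.range (GroupLike.val (R := k) (A := A))) = ⊤) :
    Function.Bijective (MonoidAlgebra.liftGroupLikeBialgHom (R := k) (A := A)) := by
  have hli := linearIndep_groupLikeVal (R := k) (A := A)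
  have e : ∀ z : MonoidAlgebra k (GroupLike k A),
      MonoidAlgebra.liftGroupLikeBialgHom (R := k) (A := A) z =
        Finsupp.linearCombination k GroupLike.val z.coeff := by
    intro z
    rw [MonoidAlgebra.liftGroupLikeBialgHom_apply, Finsupp.linearCombination_apply]
    exact MonoidAlgebra.lift_apply _ _
  have hrange : LinearMap.range (Finsupp.linearCombination k
      (GroupLike.val (R := k) (A := A))) = ⊤ := by
    rw [Finsupp.range_linearCombination, h]
  refine ⟨fun y z hyz => ?_, fun a => ?_⟩
  · rw [e, e] at hyz
    exact (MonoidAlgebra.coeffLinearEquiv k).injective (hli hyz)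
  · obtain ⟨f, hf⟩ := LinearMap.range_eq_top.1 hrange a
    exact ⟨.ofCoeff f, by rw [e, hf]⟩

end GroupLike

/-! ### The intersection of the powers of the augmentation ideal -/

section Krull

open HopfAlgebra

variable {k : Type*} [Field k] {A : Type*} [CommRing A] [HopfAlgebra k A]

/-- If all distributions at the identity of order at most `n` kill `a`, then `a` lies in
`M ^ n`. -/
theorem mem_augIdeal_pow {n : ℕ} {a : A}
    (h : ∀ φ : A →ₗ[k] k, (∀ b ∈ augIdeal k A ^ n, φ b = 0) → φ a = 0) : a ∈ augIdeal k A ^ n := by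
  by_contra hne
  obtain ⟨f, hf, hf0⟩ := Submodule.exists_le_ker_of_notMem
    (p := (augIdeal k A ^ n).restrictScalars k) hne
  exact hf (h f fun b hb => hf0 hb)

/-- The coproduct maps the augmentation ideal `M` into `M ⊗ A + A ⊗ M`. -/
theorem comul_mem_sup {a : A} (ha : a ∈ augIdeal k A) : Bialgebra.comulAlgHom k A a ∈
    (augIdeal k A).map (Algebra.TensorProduct.includeLeft : A →ₐ[k] A ⊗[k] A) ⊔
      (augIdeal k A).map (Algebra.TensorProduct.includeRight : A →ₐ[k] A ⊗[k] A) := by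
  set Q := (augIdeal k A).map (Algebra.TensorProduct.includeLeft : A →ₐ[k] A ⊗[k] A) ⊔
      (augIdeal k A).map (Algebra.TensorProduct.includeRight : A →ₐ[k] A ⊗[k] A)
  have h : ∀ t : A ⊗[k] A, t - algebraMap k (A ⊗[k] A)
      (counit (R := k) (TensorProduct.lid k A (counit.rTensor A t))) ∈ Q := by
    intro t
    induction t with
    | zero => simp
    | add s t hs ht => simpa only [map_add, add_sub_add_comm] using add_mem hs ht
    | tmul x y =>
      have e : x ⊗ₜ[k] y - algebraMap k (A ⊗[k] A)
          (counit (R := k) (TensorProduct.lid k A (counit.rTensor A (x ⊗ₜ[k] y)))) =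
          (1 ⊗ₜ y) * ((x - algebraMap k A (counit x)) ⊗ₜ 1) +
          algebraMap k (A ⊗[k] A) (counit x) * (1 ⊗ₜ (y - algebraMap k A (counit y))) := by
        simp only [LinearMap.rTensor_tmul, TensorProduct.lid_tmul, map_smul, smul_eq_mul,
          Algebra.algebraMap_eq_smul_one, Algebra.TensorProduct.one_def, TensorProduct.sub_tmul,
          TensorProduct.tmul_sub, mul_sub, smul_mul_assoc, mul_smul_comm, TensorProduct.tmul_smul,
          TensorProduct.smul_tmul, mul_smul, Algebra.TensorProduct.tmul_mul_tmul, one_mul, mul_one]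
        module
      rw [e]
      exact add_mem
        (Ideal.mul_mem_left _ _ (Ideal.mem_sup_left (Ideal.mem_map_of_mem _
          (sub_counit_mem_augIdeal x))))
        (Ideal.mul_mem_left _ _ (Ideal.mem_sup_right (Ideal.mem_map_of_mem _
          (sub_counit_mem_augIdeal y))))
  have h0 := h (comul (R := k) a)
  rwa [rTensor_counit_comul, TensorProduct.lid_tmul, one_smul, mem_augIdeal.1 ha, map_zero,
    sub_zero] at h0

/-- Distributions at the identity are closed under convolution, and their orders add up. -/
theorem apply_rightConv_eq_zero {m n : ℕ} {φ ψ : A →ₗ[k] k}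
    (hφ : ∀ b ∈ augIdeal k A ^ m, φ b = 0) (hψ : ∀ b ∈ augIdeal k A ^ n, ψ b = 0) {a : A}
    (ha : a ∈ augIdeal k A ^ (m + n)) : φ (rightConv ψ a) = 0 := by
  have h1 : Bialgebra.comulAlgHom k A a ∈
      (augIdeal k A ^ m).map (Algebra.TensorProduct.includeLeft : A →ₐ[k] A ⊗[k] A) ⊔
      (augIdeal k A ^ n).map (Algebra.TensorProduct.includeRight : A →ₐ[k] A ⊗[k] A) := by
    rw [Ideal.map_pow, Ideal.map_pow]
    refine Ideal.sup_pow_add_le_pow_sup_pow ?_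
    exact Ideal.pow_right_mono (Ideal.map_le_iff_le_comap.2 fun b hb => comul_mem_sup hb) _
      (by rw [← Ideal.map_pow]; exact Ideal.mem_map_of_mem _ ha)
  obtain ⟨t, ht, s, hs, hts⟩ := Submodule.mem_sup.1 h1
  let F : A ⊗[k] A →ₗ[k] k := φ ∘ₗ (TensorProduct.rid k A).toLinearMap ∘ₗ ψ.lTensor A
  have hF : ∀ x y, F (x ⊗ₜ y) = ψ y * φ x := fun x y => by simp [F]
  have ht0 : ∀ w : A ⊗[k] A, F (w * t) = 0 := by
    refine Submodule.span_induction (p := fun t _ => ∀ w, F (w * t) = 0) ?_ ?_ ?_ ?_ ht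
    · rintro _ ⟨b, hb, rfl⟩ w
      induction w with
      | zero => simp
      | add w w' hw hw' => rw [add_mul, map_add, hw, hw', add_zero]
      | tmul x y =>
        have : φ (x * b) = 0 := hφ _ (Ideal.mul_mem_left _ _ hb)
        simp [hF, this]
    · simp
    · intro x y _ _ hx hy w
      rw [mul_add, map_add, hx, hy, add_zero]
    · intro c x _ hx w
      rw [smul_eq_mul, ← mul_assoc]
      exact hx _
  have hs0 : ∀ w : A ⊗[k] A, F (w * s) = 0 := by
    refine Submodule.span_induction (p := fun t _ => ∀ w, F (w * t) = 0) ?_ ?_ ?_ ?_ hs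
    · rintro _ ⟨b, hb, rfl⟩ w
      induction w with
      | zero => simp
      | add w w' hw hw' => rw [add_mul, map_add, hw, hw', add_zero]
      | tmul x y =>
        have : ψ (y * b) = 0 := hψ _ (Ideal.mul_mem_left _ _ hb)
        simp [hF, this]
    · simp
    · intro x y _ _ hx hy w
      rw [mul_add, map_add, hx, hy, add_zero]
    · intro c x _ hx w
      rw [smul_eq_mul, ← mul_assoc]
      exact hx _
  change F (Bialgebra.comulAlgHom k A a) = 0
  rw [← hts, map_add, ← one_mul t, ht0, ← one_mul s, hs0, add_zero]

variable (k A) in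
/-- The intersection of the powers of the augmentation ideal. -/
def augInf : Submodule k A := (⨅ n, augIdeal k A ^ n).restrictScalars k

theorem mem_augInf {a : A} : a ∈ augInf k A ↔ ∀ n, a ∈ augIdeal k A ^ n := by
  simp [augInf, Submodule.mem_iInf]

theorem antipode_mem_augInf {a : A} (ha : a ∈ augInf k A) : antipode k a ∈ augInf k A := by
  rw [mem_augInf] at ha ⊢
  intro n
  have h : augIdeal k A ≤ (augIdeal k A).comap (antipodeAlgHom k A) := fun b hb => by
    rw [Ideal.mem_comap, mem_augIdeal, antipodeAlgHom_apply, counit_antipode, mem_augIdeal.1 hb]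
  exact ((Ideal.pow_right_mono h n).trans (Ideal.le_comap_pow _ n)) (ha n)

/-- The intersection of the powers of the augmentation ideal is a coideal. Its annihilator is not
spanned by distributions, so the two tensor factors are treated one after the other. -/
theorem comul_mem_augInf {a : A} (ha : a ∈ augInf k A) : comul (R := k) a ∈
    LinearMap.range ((augInf k A).subtype.rTensor A) ⊔
      LinearMap.range ((augInf k A).subtype.lTensor A) := by
  refine mem_range_rTensor_sup_range_lTensor fun χ hχ => ?_
  rw [← rightConv_apply, mem_augInf]
  refine fun j => mem_augIdeal_pow fun φ hφ => ?_
  rw [← apply_leftConv]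
  refine hχ _ (mem_augInf.2 fun i => mem_augIdeal_pow fun ψ hψ => ?_)
  rw [apply_leftConv]
  exact apply_rightConv_eq_zero hφ hψ (mem_augInf.1 ha _)

/-- Krull's intersection theorem: some function with value `1` at the identity annihilates the
intersection of the powers of the augmentation ideal. -/
theorem exists_annihilator_augInf [IsNoetherianRing A] :
    ∃ f : A, counit (R := k) f = 1 ∧ ∀ x ∈ augInf k A, f * x = 0 := by
  set N : Ideal A := ⨅ n, augIdeal k A ^ n with hN
  have hle : N ≤ augIdeal k A • N := by
    intro x hx
    have hx' : x ∈ (⨅ i, augIdeal k A ^ i • ⊤ : Submodule A A) := by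
      simpa [hN] using hx
    obtain ⟨r, hr⟩ := ((augIdeal k A).mem_iInf_smul_pow_eq_bot_iff x).1 hx'
    rw [← hr]
    exact Submodule.smul_mem_smul r.2 hx
  obtain ⟨f, hf, hfN⟩ := Submodule.exists_sub_one_mem_and_smul_eq_zero_of_fg_of_le_smul
    (augIdeal k A) N (IsNoetherian.noetherian N) hle
  refine ⟨f, ?_, hfN⟩
  rwa [mem_augIdeal, map_sub, Bialgebra.counit_one, sub_eq_zero] at hf

/-- If `A` is Noetherian without nontrivial idempotents, then the powers of the augmentation ideal
meet in `0`. Write `N` for the intersection; then `1 = ε(f) = ∑ f₁ S(f₂)` lies in `Ann N + N`, for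
an `f` annihilating `N` with `ε(f) = 1`, and this produces an idempotent in `N`. -/
theorem eq_zero_of_mem_augInf [IsNoetherianRing A] (hid : ∀ e : A, e * e = e → e = 0 ∨ e = 1)
    {l : A →ₗ[k] k} (hl1 : l 1 = 1) (hl : ∀ a, leftConv l a = algebraMap k A (l a))
    (a : A) (ha : ∀ n, a ∈ augIdeal k A ^ n) : a = 0 := by
  obtain ⟨f, hf1, hf⟩ := exists_annihilator_augInf (k := k) (A := A)
  have hJ : ∀ a, ∀ j ∈ augInf k A, a * j ∈ augInf k A := fun a j hj =>
    mem_augInf.2 fun n => Ideal.mul_mem_left _ _ (mem_augInf.1 hj n)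
  obtain ⟨Ann, s, t, hAnn, hst⟩ := (isSuperHopf_of_comm hl1 hl).comul_mem_annihilator_sup
    (X := augInf k A) (J := augInf k A) (J' := augInf k A) hJ (fun a => zero_mem _)
    (fun j hj => antipode_mem_augInf hj) (fun x hx => comul_mem_augInf hx) hf
  have h1 := mul_antipode_lTensor_comul_apply (R := k) f
  rw [hst, hf1, map_one, map_add, map_add, map_sum, map_sum, map_sum, map_sum] at h1
  simp only [LinearMap.lTensor_tmul, LinearMap.mul'_apply] at h1
  set u := ∑ i ∈ s, (i.1 : A) * antipode k i.2
  set v := ∑ i ∈ t, i.1 * antipode k (i.2 : A)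
  have hu : ∀ x ∈ augInf k A, u * x = 0 := fun x hx => by
    rw [Finset.sum_mul]
    exact Finset.sum_eq_zero fun i _ => by rw [mul_right_comm, hAnn _ i.1.2 x hx, zero_mul]
  have hv : v ∈ augInf k A := Submodule.sum_mem _ fun i _ => hJ _ _ (antipode_mem_augInf i.2.2)
  have hvv : v * v = v := by
    have h := congrArg (· * v) h1
    simpa [add_mul, hu v hv] using h
  rcases hid v hvv with h0 | h0
  · have := hu a (mem_augInf.2 ha)
    rwa [show u = 1 by rw [← h1, h0, add_zero], one_mul] at this
  · exfalso
    have h := mem_augInf.1 hv 1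
    rw [pow_one, mem_augIdeal, h0, Bialgebra.counit_one] at h
    exact one_ne_zero h

/-- The condition `⋂ M ^ n = 0` survives an extension of the base field. -/
theorem baseChange_eq_zero_of_mem_augIdeal_pow (K : Type*) [Field K] [Algebra k K]
    (hM : ∀ a : A, (∀ n, a ∈ augIdeal k A ^ n) → a = 0) (z : K ⊗[k] A)
    (hz : ∀ n, z ∈ augIdeal K (K ⊗[k] A) ^ n) : z = 0 := by
  let ι : A →ₐ[k] K ⊗[k] A := Algebra.TensorProduct.includeRight
  have hle : augIdeal K (K ⊗[k] A) ≤ (augIdeal k A).map ι := by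
    intro z hz
    have h : ∀ z : K ⊗[k] A, z - algebraMap K (K ⊗[k] A) (counit (R := K) z) ∈
        (augIdeal k A).map ι := by
      intro z
      induction z with
      | zero => simp
      | add s t hs ht => simpa only [map_add, add_sub_add_comm] using add_mem hs ht
      | tmul c a =>
        have e : c ⊗ₜ[k] a - algebraMap K (K ⊗[k] A) (counit (R := K) (c ⊗ₜ[k] a)) =
            (c ⊗ₜ 1) * ι (a - algebraMap k A (counit a)) := by
          simp [ι, TensorProduct.tmul_sub, mul_sub, Algebra.algebraMap_eq_smul_one,
            TensorProduct.smul_tmul', Algebra.TensorProduct.one_def]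
        rw [e]
        exact Ideal.mul_mem_left _ _ (Ideal.mem_map_of_mem _ (sub_counit_mem_augIdeal a))
    have h0 := h z
    rwa [mem_augIdeal.1 hz, map_zero, sub_zero] at h0
  -- the slices of `z` along functionals on `K` lie in all powers of the augmentation ideal of `A`
  have hslice : ∀ (φ : K →ₗ[k] k), TensorProduct.lid k A (φ.rTensor A z) ∈
      (⊥ : Submodule k A) := by
    intro φ
    refine (Submodule.mem_bot k).2 (hM _ fun n => ?_)
    have h1 : z ∈ (augIdeal k A ^ n).map ι := by
      rw [Ideal.map_pow]
      exact Ideal.pow_right_mono hle n (hz n)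
    have h2 : ∀ w : K ⊗[k] A, TensorProduct.lid k A (φ.rTensor A (w * z)) ∈
        augIdeal k A ^ n := by
      refine Submodule.span_induction
        (p := fun t _ => ∀ w, TensorProduct.lid k A (φ.rTensor A (w * t)) ∈ augIdeal k A ^ n)
        ?_ ?_ ?_ ?_ h1
      · rintro _ ⟨b, hb, rfl⟩ w
        induction w with
        | zero => simp
        | add w w' hw hw' => simpa only [add_mul, map_add] using add_mem hw hw'
        | tmul x y =>
          simp only [ι, Algebra.TensorProduct.includeRight_apply,
            Algebra.TensorProduct.tmul_mul_tmul, mul_one, LinearMap.rTensor_tmul,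
            TensorProduct.lid_tmul, Algebra.smul_def]
          exact Ideal.mul_mem_left _ _ (Ideal.mul_mem_left _ _ hb)
      · simp
      · intro x y _ _ hx hy w
        simpa only [mul_add, map_add] using add_mem (hx w) (hy w)
      · intro c x _ hx w
        rw [smul_eq_mul, ← mul_assoc]
        exact hx _
    simpa using h2 1
  obtain ⟨r, hr⟩ := mem_range_lTensor_subtype hslice
  have h0 : (⊥ : Submodule k A).subtype = 0 := by
    ext x
    exact (Submodule.mem_bot k).1 x.2
  rw [← hr, h0, LinearMap.lTensor_zero, LinearMap.zero_apply]

end Krull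

/-! ### The structure theorem -/

section Main

open HopfAlgebra

/-- A commutative Hopf algebra of finite type with a normalized integral and without nontrivial
idempotents becomes a group algebra over the algebraic closure. -/
theorem nonempty_bialgEquiv {k : Type*} [Field k] {A : Type*} [CommRing A] [HopfAlgebra k A]
    {p : ℕ} [Fact p.Prime] [CharP k p] (h2 : 2 < p)
    {l : A →ₗ[k] k} (hl1 : l 1 = 1) (hl : ∀ a, leftConv l a = algebraMap k A (l a))
    (hft : Algebra.FiniteType k A) (hid : ∀ e : A, e * e = e → e = 0 ∨ e = 1) :
    Nonempty ((AlgebraicClosure k ⊗[k] A) ≃ₐc[AlgebraicClosure k] MonoidAlgebra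
      (AlgebraicClosure k) (GroupLike (AlgebraicClosure k) (AlgebraicClosure k ⊗[k] A))) := by
  have : IsNoetherianRing A := Algebra.FiniteType.isNoetherianRing k A
  have : CharP (AlgebraicClosure k) p :=
    charP_of_injective_algebraMap (algebraMap k (AlgebraicClosure k)).injective p
  have H := (isSuperHopf_of_comm hl1 hl).baseChange (AlgebraicClosure k)
  have hM := baseChange_eq_zero_of_mem_augIdeal_pow (AlgebraicClosure k)
    (eq_zero_of_mem_augInf hid hl1 hl)
  have hL1 := H.integral_one
  have hL : ∀ a, leftConv (functionalBaseChange (AlgebraicClosure k) l) a =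
    algebraMap _ _ (functionalBaseChange (AlgebraicClosure k) l a) := H.integral_comul
  have htop := span_groupLike_eq_top
    (by rw [LinearMap.comp_apply, antipode_one, hL1]) (rightConv_integral_comp_antipode hL)
    (leftConv_eq_rightConv hL1 hL h2 hM)
  exact ⟨(BialgEquiv.ofBijective _ (bijective_liftGroupLikeBialgHom htop)).symm⟩

variable {k : Type u} [Field k] {A : Type v} [Ring A] [Algebra k A]

/-- The coordinate algebra of a connected, purely even group has no nontrivial idempotents. -/
theorem idempotent_of_isConnected (𝒜 : ZMod 2 → Submodule k A) [GradedAlgebra 𝒜]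
    [IsSuperCommutative 𝒜] (h0 : IsPurelyEven 𝒜) (hc : IsConnected 𝒜) (e : A) (he : e * e = e) :
    e = 0 ∨ e = 1 := by
  let _ := evenCommRing 𝒜
  have hc : ConnectedSpace (PrimeSpectrum (𝒜 0)) := hc
  have h0 : 𝒜 0 = ⊤ := h0
  have hmem : e ∈ 𝒜 0 := h0 ▸ Submodule.mem_top
  let e' : 𝒜 0 := ⟨e, hmem⟩
  have he' : IsIdempotentElem e' := Subtype.ext he
  have hclopen := PrimeSpectrum.isClopen_iff.2 ⟨e', he', rfl⟩
  rcases isClopen_iff.1 hclopen with h | h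
  · left
    have : e' = 0 := PrimeSpectrum.basicOpen_injOn_isIdempotentElem he' IsIdempotentElem.zero
      (TopologicalSpace.Opens.ext (by simp [h]))
    exact congrArg Subtype.val this
  · right
    have : e' = 1 := PrimeSpectrum.basicOpen_injOn_isIdempotentElem he' IsIdempotentElem.one
      (TopologicalSpace.Opens.ext (by simp [h]))
    exact congrArg Subtype.val this

end Main

end SuperGroup

end

theorem proposition9p2 {k : Type u} [Field k] (p : ℕ) [CharP k p] (hp : 2 < p)
    {A : Type v} [Ring A] [Algebra k A] [Coalgebra k A]
    (𝒜 : ZMod 2 → Submodule k A) [GradedAlgebra 𝒜]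
    [SuperGroup.IsSuperHopfAlgebra 𝒜] [SuperGroup.IsSuperCommutative 𝒜]
    (hG : SuperGroup.IsLinearlyReductive 𝒜) :
    (SuperGroup.IsPurelyEven 𝒜 ∧
      (∀ a b : A, a * b = b * a) ∧
      Coalgebra.comul (R := k) (1 : A) = 1 ∧
      (∀ a b : A, Coalgebra.comul (R := k) (a * b) =
        Coalgebra.comul (R := k) a * Coalgebra.comul (R := k) b)) ∧
    (Algebra.FiniteType k A → SuperGroup.IsConnected 𝒜 →
      ∃ (Γ : Type (max u v)) (_ : CommGroup Γ),
        Nonempty ((AlgebraicClosure k ⊗[k] A) ≃ₐc[AlgebraicClosure k]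
          MonoidAlgebra (AlgebraicClosure k) Γ)) := by
  have : Fact p.Prime := ⟨(CharP.char_is_prime_or_zero k p).resolve_right (by omega)⟩
  obtain ⟨S, l, H⟩ := SuperGroup.exists_isSuperHopf 𝒜 hG
  have hP : SuperGroup.oddProj 𝒜 = 0 := LinearMap.ext (H.purelyEven hp)
  have hcomm : ∀ a b : A, a * b = b * a := fun a b => by
    simpa [hP] using H.even_comm a b
  have hmul : ∀ a b : A, Coalgebra.comul (R := k) (a * b) =
      Coalgebra.comul (R := k) a * Coalgebra.comul (R := k) b := fun a b => by
    simpa [hP] using H.comul_mul a b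
  have heven : SuperGroup.IsPurelyEven 𝒜 := by
    refine eq_top_iff.2 fun a _ => ?_
    have h := SuperGroup.sub_oddProj_mem 𝒜 a
    rwa [hP, LinearMap.zero_apply, sub_zero] at h
  refine ⟨⟨heven, hcomm, H.comul_one, hmul⟩, fun hft hconn => ?_⟩
  let _ : CommRing A := { (inferInstance : Ring A) with mul_comm := hcomm }
  let _ : Bialgebra k A :=
    Bialgebra.mk' k A H.counit_one (H.counit_mul _ _) H.comul_one (hmul _ _)
  let _ : HopfAlgebra k A :=
    { antipode := S
      mul_antipode_rTensor_comul := LinearMap.ext H.antipode_left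
      mul_antipode_lTensor_comul := LinearMap.ext H.antipode_right }
  exact ⟨_, inferInstance, SuperGroup.nonempty_bialgEquiv hp H.integral_one H.integral_comul hft
    (SuperGroup.idempotent_of_isConnected 𝒜 heven hconn)⟩
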